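/- **Setting.** Let $d\ge1$. Write $X=(t,y,x_d,\tau,\eta,\gamma)$, $\zeta=(\tau-i\gamma,\eta)$, $\lambda(\zeta)=(\gamma^2+\tau^2+|\eta|^2)^{1/2}$, and let $\mathbb X$ be the set of all $X$ with $(t,y)\in\mathbb R^d$, $x_d\ge0$, $(\tau,\eta)\in\mathbb R^d$, $\gamma\ge0$, $\zeta\ne0$. Put $\mathbb Y=\mathbb X\cap\{x_d=0\}$, and let the index $S$ mean $\lambda(\zeta)=1$. "Homogeneous" and "conic" refer to $\zeta$, and smooth functions on subsets of $\mathbb X$ are smooth up to $x_d=0$ and $\gamma=0$. Let $P_\gamma=D_d+\mathcal A_\gamma(t,y,x_d,D_t,D_y)$ and $B_\gamma(t,y,D_t,D_y)$ be a boundary value problem on the half-space $x_d>0$ with smooth principal symbols $a$ ($n\times n$, homogeneous of degree $1$, on $\mathbb X$) and $b$ ($p\times n$, homogeneous of degree $0$, on $\mathbb Y$), such that: * (hyperbolicity) for $\underline X\in\mathbb X_S$: if $\underline\gamma\neq0$ then $\pi_P(\underline X,\xi_d):=\det(\xi_dI+a(\underline X))\ne0$ for all real $\xi_d$; if $\pi_P(\underline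 X,\underline\xi_d)=0$ with $\underline\xi_d$ real, then near $(\underline X,\underline\xi_d)$ one has $\pi_P=e(X,\xi_d)\,(\tau-i\gamma+\ell(t,x,\eta,\xi_d))^\alpha$ with $\alpha\in\mathbb N$, $e,\ell$ smooth and holomorphic in $\xi_d$, $e(\underline X,\underline\xi_d)\neq0$, $\ell$ real for real $\xi_d$, and there is a smooth projector $\Pi(X,\xi_d)$ of rank $\alpha$, holomorphic in $\xi_d$, with range $\ker(\xi_dI+a(X))$ whenever $\tau-i\gamma+\ell=0$; * $a,b$ do not depend on $(t,x)$ outside a compact set; $b$ has rank $p$ everywhere; and $p=\dim\mathbb E^-(X)$, where for $\gamma>0$ the stable subspace $\mathbb E^-(X)$ is the sum of the generalized eigenspaces of $a(X)$ for eigenvalues of negative imaginary part, extended to $\gamma=0$ by taking limits; * (WR class) with $X$ called critical if $\mathbb E^-(X)\cap\ker b(X)\ne\{0\}$: no $X\in\mathbb Y_S$ with $\gamma>0$ is critical; critical points exist in $\mathbb Y_S$; all of them lie in the hyperbolic region $\mathcal H$ (the points with $\gamma=0$ near which $a$ is smoothly diagonalizable with eigenvalues $\mu_j$ such that $\mu_j\in\mathbb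 R$ and $i\partial_\gamma\mu_j\in\mathbb R\setminus\{0\}$ when $\gamma=0$); and there $\partial_\tau\det(b e_1,\dots,b e_p)\ne0$ for some smooth homogeneous local basis $e_1,\dots,e_p$ of $\mathbb E^-$ over $\mathbb Y$. Let $\underline X\in\mathcal H\cap\mathbb Y_S$, let $V$ be an open conic neighbourhood of $\underline X$, and let $\delta$ be the symbol of a Lopatinskii family on $V$. This means that there are: a smooth invertible $\tilde e_0(X)$, homogeneous of degree $0$, with $\tilde e_0^{-1}a\tilde e_0=\mathrm{diag}(a_{1,1},\dots,a_{1,n})$ on $V\cap\mathbb X$; a smooth real $\omega$ on $V\cap\mathbb Y$, homogeneous of degree $1$, with $\partial_\tau\omega\neq0$ where $\omega=0$, such that, with $\underline\Delta=(\gamma+i\omega)/\lambda$, one has $(b\underline e_1,\dots,b\underline e_p)=\mathfrak p\,\mathrm{diag}(\underline\Delta,1,\dots,1)$ on $V\cap\mathbb Y$ for some smooth basis $\underline e_j$ of $\mathbb E^-$, homogeneous of degree $0$, and some smooth $\mathfrak p$ with values in $GL_p(\mathbb C)$; an integer $0\le s\le p$ and smooth functions $\delta_1,\dots,\delta_s$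 on $V\cap\mathbb X$, homogeneous of degree $0$, with $$\partial_d\delta_j+\{\delta_j,a_{1,j}\}=0\ \text{ on } V\cap\mathbb X,\qquad \delta_j|_{x_d=0}=\underline\Delta,\qquad \delta=\mathrm{diag}(\delta_1,\dots,\delta_s,1,\dots,1),$$ where $\{f,g\}=\sum_{k=0}^{d-1}(\partial_{y_k}f\,\partial_{\eta_k}g-\partial_{\eta_k}f\,\partial_{y_k}g)$, $y_0=t$, $\eta_0=\tau$. Moreover, on $V\cap\mathbb Y$: $q\,b\,\tilde e_0=m\,\delta$ for some smooth $p\times p$ and $p\times n$ matrices $q$ and $m$; $\ker\delta(X)\ne\{0\}$ if and only if $X$ is critical; and in that case $\ker\delta(X)$ has dimension $s$, is invariant under $\tilde e_0^{-1}a\tilde e_0$, and contains $\tilde e_0^{-1}(\mathbb E^-(X)\cap\ker b(X))$. **Norms and operators.** For $u:\mathbb R^{d}\times(0,\infty)\to\mathbb C^n$ let $\hat u(\xi,x_d)$ be the Fourier transform of $e^{-\gamma t}u$ in $(t,y)$ and $$\|u\|_{s,\gamma}^2=\int_0^\infty\frac1{(2\pi)^d}\int_{\mathbb R^d}(\gamma^2+|\xi|^2)^s|\hat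 u(\xi,x_d)|^2\,d\xi\,dx_d ,\qquad \|u\|_{0,\gamma}^2=\int e^{-2\gamma t}|u|^2 .$$ Write $L^2_\gamma$ for the space $\|u\|_{0,\gamma}<\infty$. For a symbol $g$ let $\mathrm{Op}_\gamma(g)=e^{\gamma t}g(t,y,x_d,D_t,D_y,\gamma)e^{-\gamma t}$ on test functions on the closed half-space, extended to $L^2_\gamma$ by closure. **Proposition 1.1.** There is an open conic neighbourhood $V'\subseteq V$ of $\underline X$ with the following property. Let $\theta$ be any cutoff in $V'$, that is, $\theta$ is smooth on $\mathbb X$, homogeneous of degree $0$, $0\le\theta\le1$, and vanishes on $\mathbb X_S$ outside a compact subset of $V'$. Let $\Delta_\gamma=\mathrm{Op}_\gamma(\theta\delta+(1-\theta)I_n)$, whose symbol is $\delta$ where $\theta=1$. Then there are $\gamma_1\ge1$ and $C_1,C_2>0$ such that for all $\gamma_0\ge\gamma_1$, all $\gamma\in(\gamma_0,+\infty)$ and all $u\in L^2_\gamma$, the function $\Delta_\gamma u\in L^2_\gamma$ is defined and $$C_1\|u\|_{-1,\gamma}\le\frac1{\gamma_0}\|\Delta_\gamma u\|_{0,\gamma}\le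 C_2\|u\|_{0,\gamma}.$$ -/

import Mathlib

open scoped ContDiff FourierTransform ENNReal
open MeasureTheory

noncomputable section

namespace WRClass

/-! ### The space-time-frequency set

The space dimension is `d = m + 1`.  A tangential variable is `(t, y) ∈ ℝ ^ d`, with `t` the
coordinate of index `0`; its covariable is `(τ, η) ∈ ℝ ^ d`, with `τ` the coordinate of index `0`. -/

/-- Tangential variables `(t, y)`, and their covariables `(τ, η)`. -/
abbrev Tan (m : ℕ) : Type := EuclideanSpace ℝ (Fin (m + 1))

/-- Points `X = ((t, y), x_d, (τ, η), γ)`. -/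
abbrev Phase (m : ℕ) : Type := Tan m × ℝ × Tan m × ℝ

variable {m n p : ℕ}

/-- `(t, y)` -/
def tan (X : Phase m) : Tan m := X.1

/-- `x_d` -/
def xd (X : Phase m) : ℝ := X.2.1

/-- `(τ, η)` -/
def cov (X : Phase m) : Tan m := X.2.2.1

/-- `γ` -/
def gam (X : Phase m) : ℝ := X.2.2.2

/-- `λ(ζ) = (γ² + τ² + |η|²)^(1/2)` -/
def lam (X : Phase m) : ℝ := Real.sqrt (gam X ^ 2 + ‖cov X‖ ^ 2)

/-- The dilation `ζ ↦ r ζ` of the frequency `ζ = (τ - iγ, η)`. -/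
def dil (r : ℝ) (X : Phase m) : Phase m := (tan X, xd X, r • cov X, r * gam X)

/-- The set `𝕏`: `x_d ≥ 0`, `γ ≥ 0` and `ζ ≠ 0`. -/
def XX (m : ℕ) : Set (Phase m) := {X | 0 ≤ xd X ∧ 0 ≤ gam X ∧ ¬ (cov X = 0 ∧ gam X = 0)}

/-- The set `𝕐 = 𝕏 ∩ {x_d = 0}`. -/
def YY (m : ℕ) : Set (Phase m) := {X | X ∈ XX m ∧ xd X = 0}

/-- The set `𝕏_S` of the points of `𝕏` whose frequency lies on the unit sphere. -/
def XS (m : ℕ) : Set (Phase m) := {X | X ∈ XX m ∧ lam X = 1}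

/-- `V` is an open conic neighbourhood of `X₀`. -/
def IsConicNhd (V : Set (Phase m)) (X₀ : Phase m) : Prop :=
  IsOpen V ∧ X₀ ∈ V ∧ ∀ X ∈ V, ∀ r : ℝ, 0 < r → dil r X ∈ V

/-- Homogeneity of degree `k` in `ζ` on the conic set `S`. -/
def IsHomog {M : Type*} [SMul ℝ M] (k : ℕ) (S : Set (Phase m)) (f : Phase m → M) : Prop :=
  ∀ X ∈ S, ∀ r : ℝ, 0 < r → f (dil r X) = (r ^ k) • f X

/-- Smoothness of a matrix-valued function on a set, entry by entry. -/
def MatSmoothOn {E : Type*} [NormedAddCommGroup E] [NormedSpace ℝ E] {k l : ℕ}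
    (f : E → Matrix (Fin k) (Fin l) ℂ) (S : Set E) : Prop :=
  ∀ i j, ContDiffOn ℝ ∞ (fun X => f X i j) S

/-! ### Partial derivatives and the Poisson bracket -/

/-- Derivative in the `i`-th tangential variable (`i = 0` is `t`). -/
def dTan (i : Fin (m + 1)) (f : Phase m → ℂ) (X : Phase m) : ℂ :=
  deriv (fun s : ℝ => f (tan X + s • EuclideanSpace.single i (1 : ℝ), xd X, cov X, gam X)) 0

/-- Derivative in the `i`-th tangential covariable (`i = 0` is `τ`). -/
def dCov (i : Fin (m + 1)) (f : Phase m → ℂ) (X : Phase m) : ℂ :=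
  deriv (fun s : ℝ => f (tan X, xd X, cov X + s • EuclideanSpace.single i (1 : ℝ), gam X)) 0

/-- Derivative in `x_d` (one-sided at `x_d = 0`). -/
def dXd (f : Phase m → ℂ) (X : Phase m) : ℂ :=
  derivWithin (fun s : ℝ => f (tan X, s, cov X, gam X)) (Set.Ici 0) (xd X)

/-- Derivative in `γ` (one-sided at `γ = 0`). -/
def dGam (f : Phase m → ℂ) (X : Phase m) : ℂ :=
  derivWithin (fun s : ℝ => f (tan X, xd X, cov X, s)) (Set.Ici 0) (gam X)

/-- The Poisson bracket in `(t, y; τ, η)`, with the sign for which the characteristics of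
`∂_d f + {f, g} = 0` solve `dy/dx_d = ∂g/∂η`, `dη/dx_d = - ∂g/∂y`. -/
def poisson (f g : Phase m → ℂ) (X : Phase m) : ℂ :=
  ∑ i, (dTan i f X * dCov i g X - dCov i f X * dTan i g X)

/-! ### Boundary value problems -/

/-- The principal symbols of a boundary value problem `(P_γ, B_γ)`, with
`P_γ = D_d + 𝒜_γ(t, y, x_d, D_t, D_y)` on the half-space and `B_γ(t, y, D_t, D_y)` on its boundary:
`a` is `n × n` and homogeneous of degree one, `b` is `p × n` and homogeneous of degree zero.
All the conditions below are conditions on the principal symbols. -/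
structure BVP (m n p : ℕ) where
  a : Phase m → Matrix (Fin n) (Fin n) ℂ
  b : Phase m → Matrix (Fin p) (Fin n) ℂ
  a_smooth : MatSmoothOn a (XX m)
  a_homog : IsHomog 1 (XX m) a
  b_smooth : MatSmoothOn b (YY m)
  b_homog : IsHomog 0 (YY m) b

/-- `π_P(X, ξ_d) = det (ξ_d I + a(X))` -/
def charPol (a : Phase m → Matrix (Fin n) (Fin n) ℂ) (X : Phase m) (z : ℂ) : ℂ :=
  (z • (1 : Matrix (Fin n) (Fin n) ℂ) + a X).det

/-- The point `(t, x, η, ξ_d)` below `(X, ξ_d)`: `τ` and `γ` are forgotten. -/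
def below (Q : Phase m × ℂ) : Tan m × ℝ × (Fin m → ℝ) × ℂ :=
  (tan Q.1, xd Q.1, fun i => cov Q.1 i.succ, Q.2)

/-- Hyperbolicity of `P_γ` (with constant multiplicities), as a condition on its symbol `a`. -/
def IsHyperbolic (a : Phase m → Matrix (Fin n) (Fin n) ℂ) : Prop :=
  ∀ X₀ ∈ XS m,
    (gam X₀ ≠ 0 → ∀ ξ : ℝ, charPol a X₀ (ξ : ℂ) ≠ 0) ∧
    (∀ ξ₀ : ℝ, charPol a X₀ (ξ₀ : ℂ) = 0 →
      ∃ (α : ℕ) (W : Set (Tan m × ℝ × (Fin m → ℝ) × ℂ)) (U : Set (Phase m × ℂ))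
        (l : Tan m × ℝ × (Fin m → ℝ) × ℂ → ℂ) (e : Phase m × ℂ → ℂ)
        (Pr : Phase m × ℂ → Matrix (Fin n) (Fin n) ℂ),
        IsOpen W ∧ IsOpen U ∧ (X₀, (ξ₀ : ℂ)) ∈ U ∧ (∀ Q ∈ U, below Q ∈ W) ∧
        -- smoothness, and holomorphy with respect to `ξ_d`
        ContDiffOn ℝ ∞ l (W ∩ {w | 0 ≤ w.2.1}) ∧
        ContDiffOn ℝ ∞ e (U ∩ {Q | Q.1 ∈ XX m}) ∧
        MatSmoothOn Pr (U ∩ {Q | Q.1 ∈ XX m}) ∧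
        (∀ w ∈ W, 0 ≤ w.2.1 →
          DifferentiableAt ℂ (fun z : ℂ => l (w.1, w.2.1, w.2.2.1, z)) w.2.2.2) ∧
        (∀ Q ∈ U, Q.1 ∈ XX m → DifferentiableAt ℂ (fun z : ℂ => e (Q.1, z)) Q.2) ∧
        (∀ Q ∈ U, Q.1 ∈ XX m → ∀ i j, DifferentiableAt ℂ (fun z : ℂ => Pr (Q.1, z) i j) Q.2) ∧
        -- the factorization of the characteristic polynomial
        e (X₀, (ξ₀ : ℂ)) ≠ 0 ∧
        (∀ Q ∈ U, Q.1 ∈ XX m → charPol a Q.1 Q.2 =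
          e Q * (((cov Q.1 0 : ℝ) : ℂ) - Complex.I * ((gam Q.1 : ℝ) : ℂ) + l (below Q)) ^ α) ∧
        (∀ w ∈ W, 0 ≤ w.2.1 → w.2.2.2.im = 0 → (l w).im = 0) ∧
        -- the projector on the kernel
        (∀ Q ∈ U, Q.1 ∈ XX m → Pr Q * Pr Q = Pr Q ∧ (Pr Q).rank = α) ∧
        (∀ Q ∈ U, Q.1 ∈ XX m →
          ((cov Q.1 0 : ℝ) : ℂ) - Complex.I * ((gam Q.1 : ℝ) : ℂ) + l (below Q) = 0 →
          ∀ v : Fin n → ℂ,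
            (Q.2 • (1 : Matrix (Fin n) (Fin n) ℂ) + a Q.1).mulVec v = 0 ↔
              ∃ w, (Pr Q).mulVec w = v))

/-- Property (C): the symbols do not depend on `(t, x)` outside of a compact set. -/
def BVP.PropertyC (S : BVP m n p) : Prop :=
  ∃ K : Set (Tan m × ℝ), IsCompact K ∧
    (∀ X ∈ XX m, ∀ X' ∈ XX m, (tan X, xd X) ∉ K → (tan X', xd X') ∉ K →
      cov X = cov X' → gam X = gam X' → S.a X = S.a X') ∧
    (∀ X ∈ YY m, ∀ X' ∈ YY m, (tan X, xd X) ∉ K → (tan X', xd X') ∉ K →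
      cov X = cov X' → gam X = gam X' → S.b X = S.b X')

/-- For `γ > 0`, the stable subspace: the initial values of the solutions of `D_s v + a(X) v = 0`
that decay as `s → +∞`, that is, the sum of the generalized eigenspaces of `a(X)` for the
eigenvalues of negative imaginary part. -/
def stable (a : Phase m → Matrix (Fin n) (Fin n) ℂ) (X : Phase m) : Submodule ℂ (Fin n → ℂ) :=
  ⨆ μ ∈ {μ : ℂ | μ.im < 0}, Module.End.maxGenEigenspace (Matrix.toLin' (a X)) μ

/-- The fibre at `X ∈ 𝕏` of the continuous extension `𝔼⁻` of the stable bundle up to `γ = 0`: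
the limits of the elements of the stable subspaces at points with `γ > 0`. -/
def Eminus (a : Phase m → Matrix (Fin n) (Fin n) ℂ) (X : Phase m) : Set (Fin n → ℂ) :=
  {v | (X, v) ∈ closure {Q : Phase m × (Fin n → ℂ) |
    Q.1 ∈ XX m ∧ 0 < gam Q.1 ∧ Q.2 ∈ stable a Q.1}}

/-- `b(X)` has maximal rank `p`, and `p` is the dimension of the stable subspace. -/
def BVP.MaximalRank (S : BVP m n p) : Prop :=
  (∀ X ∈ YY m, (S.b X).rank = p) ∧
  (∀ X ∈ XX m, 0 < gam X → Module.finrank ℂ (stable S.a X) = p)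

/-- The Lopatinskii condition fails at `X`: `𝔼⁻(X) ∩ ker b(X) ≠ {0}`. -/
def BVP.IsCritical (S : BVP m n p) (X : Phase m) : Prop :=
  ∃ v : Fin n → ℂ, v ≠ 0 ∧ v ∈ Eminus S.a X ∧ (S.b X).mulVec v = 0

/-- The weak Lopatinskii condition. -/
def BVP.WeakLopatinski (S : BVP m n p) : Prop :=
  ∀ X ∈ YY m, X ∈ XS m → 0 < gam X → ¬ S.IsCritical X

/-- The hyperbolic region `ℋ`: the points with `γ = 0` near which `a` satisfies the block structure
condition with blocks of size one, which are real when `γ = 0` and such that `i ∂_γ` of them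
is then real and nonzero. -/
def hypRegion (a : Phase m → Matrix (Fin n) (Fin n) ℂ) : Set (Phase m) :=
  {X₀ | X₀ ∈ XX m ∧ gam X₀ = 0 ∧
    ∃ (V : Set (Phase m)) (e₀ : Phase m → Matrix (Fin n) (Fin n) ℂ) (μ : Fin n → Phase m → ℂ),
      IsOpen V ∧ X₀ ∈ V ∧ MatSmoothOn e₀ (V ∩ XX m) ∧
      (∀ X ∈ V ∩ XX m, IsUnit (e₀ X).det ∧
        (e₀ X)⁻¹ * a X * e₀ X = Matrix.diagonal fun j => μ j X) ∧
      (∀ X ∈ V ∩ XX m, gam X = 0 → ∀ j, (μ j X).im = 0 ∧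
        (Complex.I * dGam (μ j) X).im = 0 ∧ dGam (μ j) X ≠ 0)}

/-- A smooth basis of `𝔼⁻`, homogeneous of degree zero, over the boundary points of `V`. -/
def IsStableFrame (a : Phase m → Matrix (Fin n) (Fin n) ℂ) (V : Set (Phase m))
    (e : Fin p → Phase m → (Fin n → ℂ)) : Prop :=
  ∀ j, ContDiffOn ℝ ∞ (e j) (V ∩ YY m) ∧ IsHomog 0 (V ∩ YY m) (e j) ∧
    ∀ X ∈ V ∩ YY m, LinearIndependent ℂ (fun i => e i X) ∧
      (Submodule.span ℂ (Set.range fun i => e i X) : Set (Fin n → ℂ)) = Eminus a X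

/-- The matrix `b⁻(X)`, whose columns are the vectors `b(X) e_j(X)`. -/
def BVP.bMinus (S : BVP m n p) (e : Fin p → Phase m → (Fin n → ℂ)) (X : Phase m) :
    Matrix (Fin p) (Fin p) ℂ :=
  Matrix.of fun i j => (S.b X).mulVec (e j X) i

/-- The WR class: the weak Lopatinskii condition holds; the Lopatinskii determinant has zeros;
all of them lie in the hyperbolic region and are simple with respect to `τ`. -/
def BVP.IsWR (S : BVP m n p) : Prop :=
  S.WeakLopatinski ∧
  (∃ X ∈ YY m, X ∈ XS m ∧ S.IsCritical X) ∧
  ∀ X ∈ YY m, X ∈ XS m → S.IsCritical X →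
    X ∈ hypRegion S.a ∧
    ∃ (V : Set (Phase m)) (e : Fin p → Phase m → (Fin n → ℂ)),
      IsConicNhd V X ∧ IsStableFrame S.a V e ∧ dCov 0 (fun X' => (S.bMinus e X').det) X ≠ 0

/-! ### The symbol of a Lopatinskii family -/

/-- `(γ + i ω(X)) / λ(ζ)` -/
def lopDelta (om : Phase m → ℝ) (X : Phase m) : ℂ :=
  (((gam X : ℝ) : ℂ) + Complex.I * ((om X : ℝ) : ℂ)) / ((lam X : ℝ) : ℂ)

/-- The symbol `δ = diag (δ₁, …, δ_s, 1, …, 1)` of a Lopatinskii family of operators for the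
problem `S` on the conic set `V`, together with the basis `ẽ₀` in which it is diagonal. -/
structure LopatinskiSymbol (S : BVP m n p) (V : Set (Phase m)) where
  /-- the basis `ẽ₀` (columns) -/
  frame : Phase m → Matrix (Fin n) (Fin n) ℂ
  frame_smooth : MatSmoothOn frame (V ∩ XX m)
  frame_homog : IsHomog 0 (V ∩ XX m) frame
  frame_unit : ∀ X ∈ V ∩ XX m, IsUnit (frame X).det
  /-- the diagonal entries `a_{1,j}` of the symbol of `P_γ` in this basis -/
  eig : Fin n → Phase m → ℂ
  frame_diag : ∀ X ∈ V ∩ XX m,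
    (frame X)⁻¹ * S.a X * frame X = Matrix.diagonal fun j => eig j X
  /-- the function `ω` in the normal form of `b⁻` on the boundary -/
  omega : Phase m → ℝ
  omega_smooth : ContDiffOn ℝ ∞ omega (V ∩ YY m)
  omega_homog : IsHomog 1 (V ∩ YY m) omega
  omega_simple : ∀ X ∈ V ∩ YY m, omega X = 0 → dCov 0 (fun X' => ((omega X' : ℝ) : ℂ)) X ≠ 0
  normal_form : ∃ (e : Fin p → Phase m → (Fin n → ℂ)) (P : Phase m → Matrix (Fin p) (Fin p) ℂ),
    IsStableFrame S.a V e ∧ MatSmoothOn P (V ∩ YY m) ∧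
    ∀ X ∈ V ∩ YY m, IsUnit (P X).det ∧
      S.bMinus e X = P X *
        Matrix.diagonal fun j : Fin p => if (j : ℕ) = 0 then lopDelta omega X else 1
  /-- the number of nontrivial entries -/
  s : ℕ
  s_le : s ≤ p
  /-- the entries `δ_j`, relevant for the first `s` indices -/
  entry : Fin n → Phase m → ℂ
  entry_smooth : ∀ j : Fin n, (j : ℕ) < s → ContDiffOn ℝ ∞ (entry j) (V ∩ XX m)
  entry_homog : ∀ j : Fin n, (j : ℕ) < s → IsHomog 0 (V ∩ XX m) (entry j)
  transport : ∀ j : Fin n, (j : ℕ) < s → ∀ X ∈ V ∩ XX m,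
    dXd (entry j) X + poisson (entry j) (eig j) X = 0
  boundary_value : ∀ j : Fin n, (j : ℕ) < s → ∀ X ∈ V ∩ YY m, entry j X = lopDelta omega X
  /-- on the boundary, `q b ẽ₀ = M δ` with smooth matrices `q` and `M` -/
  boundary_relation : ∃ (q : Phase m → Matrix (Fin p) (Fin p) ℂ)
    (M : Phase m → Matrix (Fin p) (Fin n) ℂ),
    MatSmoothOn q (V ∩ YY m) ∧ MatSmoothOn M (V ∩ YY m) ∧
    ∀ X ∈ V ∩ YY m, q X * (S.b X * frame X) =
      M X * Matrix.diagonal fun j : Fin n => if (j : ℕ) < s then entry j X else 1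
  /-- on the boundary, `δ` degenerates exactly at the critical points -/
  degenerate_iff : ∀ X ∈ V ∩ YY m,
    (Matrix.diagonal fun j : Fin n => if (j : ℕ) < s then entry j X else 1).det = 0 ↔
      S.IsCritical X
  /-- and there its kernel, an invariant subspace of `a` read in the basis `ẽ₀`, has dimension `s`
  and contains the critical direction `𝔼⁻ ∩ ker b` -/
  kernel : ∀ X ∈ V ∩ YY m, S.IsCritical X →
    let δ : Matrix (Fin n) (Fin n) ℂ :=
      Matrix.diagonal fun j : Fin n => if (j : ℕ) < s then entry j X else 1
    Module.finrank ℂ (LinearMap.ker (Matrix.toLin' δ)) = s ∧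
    (∀ v, δ.mulVec v = 0 → δ.mulVec (((frame X)⁻¹ * S.a X * frame X).mulVec v) = 0) ∧
    (∀ v ∈ Eminus S.a X, (S.b X).mulVec v = 0 → δ.mulVec ((frame X)⁻¹.mulVec v) = 0)

/-- The matrix symbol `δ`. -/
def LopatinskiSymbol.delta {S : BVP m n p} {V : Set (Phase m)} (L : LopatinskiSymbol S V)
    (X : Phase m) : Matrix (Fin n) (Fin n) ℂ :=
  Matrix.diagonal fun j : Fin n => if (j : ℕ) < L.s then L.entry j X else 1

/-- A microlocal cutoff in `V`: smooth on `𝕏`, homogeneous of degree zero, with values in `[0, 1]`,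
and supported, over the unit sphere of frequencies, in a compact subset of `V`. -/
def IsCutoff (V : Set (Phase m)) (θ : Phase m → ℝ) : Prop :=
  ContDiffOn ℝ ∞ θ (XX m) ∧ IsHomog 0 (XX m) θ ∧ (∀ X, 0 ≤ θ X ∧ θ X ≤ 1) ∧
    ∃ K : Set (Phase m), IsCompact K ∧ K ⊆ V ∧ ∀ X ∈ XS m, X ∉ K → θ X = 0

/-- The global symbol `θ δ + (1 - θ) I`, equal to `δ` where `θ = 1` and to `I` off the support
of `θ`. -/
def LopatinskiSymbol.globalSymbol {S : BVP m n p} {V : Set (Phase m)} (L : LopatinskiSymbol S V)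
    (θ : Phase m → ℝ) (X : Phase m) : Matrix (Fin n) (Fin n) ℂ :=
  θ X • L.delta X + (1 - θ X) • (1 : Matrix (Fin n) (Fin n) ℂ)

/-! ### Weighted norms and pseudodifferential operators with parameter -/

/-- Values of the unknown. -/
abbrev Vec (n : ℕ) : Type := EuclideanSpace ℂ (Fin n)

/-- Lebesgue measure on the half-space `x_d > 0`. -/
def halfMeasure (m : ℕ) : Measure (Tan m × ℝ) := volume.restrict {x | 0 < x.2}

/-- `e^{-γ t} u` -/
def weight (γ : ℝ) (u : Tan m × ℝ → Vec n) (x : Tan m × ℝ) : Vec n :=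
  ((Real.exp (-γ * x.1 0) : ℝ) : ℂ) • u x

/-- `u ∈ L²_γ` of the half-space. -/
def MemL2 (γ : ℝ) (u : Tan m × ℝ → Vec n) : Prop := MemLp (weight γ u) 2 (halfMeasure m)

/-- The norm of `L²_γ`, that is, `(∫ e^{-2γt} |u|²)^(1/2)`. -/
def normL2 (γ : ℝ) (u : Tan m × ℝ → Vec n) : ℝ≥0∞ := eLpNorm (weight γ u) 2 (halfMeasure m)

open Classical in
/-- For `u ∈ L²_γ` and almost every `r`, the `L²` Fourier transform of `e^{-γt} u(·, r)` in `(t, y)`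
(in the normalization `∫ e^{-2πi k·z} … dz`). -/
def sliceFourier (γ : ℝ) (u : Tan m × ℝ → Vec n) (r : ℝ) : Tan m → Vec n :=
  if h : MemLp (fun z : Tan m => weight γ u (z, r)) 2 volume then
    ((𝓕 (h.toLp (fun z : Tan m => weight γ u (z, r))) : Lp (Vec n) 2 (volume : Measure (Tan m))) :
      Tan m → Vec n)
  else 0

/-- The norm of `H^s_γ` (tangential regularity) of a function in `L²_γ`, that is,
`(∫_0^∞ (2π)^{-d} ∫ (γ² + |ξ|²)^s |û(ξ, x_d)|² dξ dx_d)^(1/2)`, with `û` the Fourier transform of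
`e^{-γt} u` in `(t, y)`; here `ξ = 2πk`. -/
def normSobolev (s γ : ℝ) (u : Tan m × ℝ → Vec n) : ℝ≥0∞ :=
  (∫⁻ r in Set.Ioi (0 : ℝ), ∫⁻ k : Tan m,
    ENNReal.ofReal ((γ ^ 2 + ‖(2 * Real.pi) • k‖ ^ 2) ^ s) * ‖sliceFourier γ u r k‖ₑ ^ 2)
      ^ (1 / 2 : ℝ)

/-- Test functions on the closed half-space (restrictions of test functions on the whole space). -/
def IsTest (u : Tan m × ℝ → Vec n) : Prop := ContDiff ℝ ∞ u ∧ HasCompactSupport u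

/-- The operator `Op_γ(g) = e^{γt} g(t, y, x_d, D_t, D_y, γ) e^{-γt}` on test functions:
`e^{γt} (2π)^{-d} ∫ e^{i(t,y)·ξ} g(t, y, x_d, ξ, γ) û(ξ, x_d) dξ`, with `û` the Fourier transform of
`e^{-γt} u` in `(t, y)`; here `ξ = 2πk`. -/
def op (g : Phase m → Matrix (Fin n) (Fin n) ℂ) (γ : ℝ) (u : Tan m × ℝ → Vec n)
    (x : Tan m × ℝ) : Vec n :=
  ((Real.exp (γ * x.1 0) : ℝ) : ℂ) • ∫ k : Tan m,
    Complex.exp (2 * Real.pi * Complex.I * ((inner ℝ k x.1 : ℝ) : ℂ)) •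
      WithLp.toLp 2 ((g (x.1, x.2, (2 * Real.pi) • k, γ)).mulVec
        (WithLp.ofLp (𝓕 (fun z : Tan m => weight γ u (z, x.2)) k)))

/-- `w = Op_γ(g) u` for `u ∈ L²_γ`: the closure in `L²_γ` of `Op_γ(g)` on test functions. -/
def IsOp (g : Phase m → Matrix (Fin n) (Fin n) ℂ) (γ : ℝ) (u w : Tan m × ℝ → Vec n) : Prop :=
  MemL2 γ u ∧ MemL2 γ w ∧ ∃ φ : ℕ → Tan m × ℝ → Vec n, (∀ k, IsTest (φ k)) ∧
    Filter.Tendsto (fun k => normL2 γ (φ k - u)) Filter.atTop (nhds 0) ∧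
    Filter.Tendsto (fun k => normL2 γ (op g γ (φ k) - w)) Filter.atTop (nhds 0)

end WRClass

end

/-!
The symbol `θ δ + (1 - θ) I` is diagonal, so the operator consists of scalar operators with symbols
`g_j = 1 + G_j / λ`, where `G_j = λ θ (δ_j - 1)` is homogeneous of degree one and, over the unit sphere
of frequencies, compactly supported. The variables `x_d` and `γ` are parameters: all estimates are made
on a slice `x_d = r`, uniformly in `r` and `γ`, mostly on the Fourier side.

*Geometry.* Near a point `X₀` of the hyperbolic region the eigenvalues `a_{1,j}` are real for `γ = 0`.
There the real part of `δ_j` solves the transport equation `∂_d ρ + {ρ, a_{1,j}} = 0`, whose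
coefficients are real and bounded, and vanishes on the boundary, where it equals `γ / λ`. Hence it
vanishes for `γ = 0`, by a maximum principle (`transport_nonpos`) that asks for no regularity of the
coefficients: the eigenvalues need only be Lipschitz. Since `∂_γ Re δ_j = 1` at `X₀`, one obtains
`Re δ_j ≥ γ / (2 λ)` in a conic neighbourhood `V'` of `X₀` (`LopatinskiSymbol.exists_conicNhd`), and then
`λ Re g_j ≥ γ / 2` everywhere for every cutoff in `V'` (`LopatinskiSymbol.le_re_cutSymbol`).

*Lower bound.* Let `T` be the operator of symbol `g_j` and `v` the Fourier transform of `f` divided by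
`λ`. The pairing of the Fourier transform of `T f` with `v` is the quadratic form at `v` of the symbol
`λ g_j` of order one, whose real part is at least `γ / 2`. By the sharp Gårding inequality
(`IsOrderOne.sharp_garding`) the real part of the form is at least `(γ / 2 - C) ‖v‖²`, with `C`
independent of `γ`, so that `‖T f‖ ≥ (γ / 4) ‖v‖` for large `γ`. The inequality is proved by averaging
the symbol over frequency windows whose width is the square root of the weight: the averaged form is
nonnegative, and its kernel differs from that of the operator by a kernel bounded by an integrable
convolution (`IsOrderOne.norm_kernel_sub_le`), which the Schur test (`schur_form`) controls. The
required symbol estimates, uniform in the parameters, follow from homogeneity and compactness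
(`IsCompactSymbol.exists_isOrderOne`).

*Upper bound and closure.* Young's inequality bounds `T` on `L²` (`IsOrderOne.integral_sliceOp_sq_le`).
Both bounds are integrated over the slices for test functions (`IsDiagonalSymbol.exists_test_bounds`).
As test functions are dense in `L²_γ`, the closure of the operator is defined on the whole of `L²_γ`
and inherits the bounds (`IsDiagonalSymbol.exists_bounds`). Finally `γ > γ₀ ≥ 1` turns the factor
`γ / 4` into `γ₀ / 4`, and `1 / γ₀ ≤ 1` gives the upper estimate.
-/

section
open scoped ComplexConjugate
open Module

/-! ### The Fourier transform on `L¹ ∩ L²` -/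

section Fourier
variable {E F : Type*} [NormedAddCommGroup E] [InnerProductSpace ℝ E] [FiniteDimensional ℝ E]
  [MeasurableSpace E] [BorelSpace E] [NormedAddCommGroup F] [InnerProductSpace ℂ F]

theorem Real.continuous_fourier_of_integrable {f : E → F} (hf : Integrable f) :
    Continuous (𝓕 f) :=
  VectorFourier.fourierIntegral_continuous Real.continuous_fourierChar
    (by exact continuous_inner) hf

variable [CompleteSpace F]

/-- On `L¹ ∩ L²` the `L²` Fourier transform agrees almost everywhere with the Fourier integral:
the two coincide as tempered distributions. -/
theorem MeasureTheory.MemLp.fourier_toLp_ae_eq {f : E → F} (h1 : Integrable f)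
    (h2 : MemLp f 2 volume) :
    ((𝓕 (h2.toLp f) : Lp F 2 (volume : Measure E)) : E → F) =ᵐ[volume] 𝓕 f := by
  have hc := Real.continuous_fourier_of_integrable h1
  refine ae_eq_of_integral_contDiff_smul_eq
    ((Lp.memLp _).locallyIntegrable (by norm_num)) hc.locallyIntegrable ?_
  intro g hg hgs
  have hg₁ : HasCompactSupport (Complex.ofRealCLM ∘ g) := hgs.comp_left rfl
  have hg₂ : ContDiff ℝ ∞ (Complex.ofRealCLM ∘ g) := by fun_prop
  set G : SchwartzMap E ℂ := hg₁.toSchwartzMap hg₂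
  have hG : ∀ x, G x = (g x : ℂ) := fun x => rfl
  have e1 : Lp.toTemperedDistribution (𝓕 (h2.toLp f) : Lp F 2 (volume : Measure E)) G
      = ∫ x, g x • ((𝓕 (h2.toLp f) : Lp F 2 (volume : Measure E)) : E → F) x := by
    simp [hG]
  rw [← e1, ← Lp.fourier_toTemperedDistribution_eq, TemperedDistribution.fourier_apply,
    Lp.toTemperedDistribution_apply]
  have e2 : ∫ x, (𝓕 G) x • (h2.toLp f) x = ∫ x, (𝓕 (G : E → ℂ)) x • f x := by
    refine integral_congr_ae ?_
    filter_upwards [h2.coeFn_toLp] with x hx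
    rw [hx, SchwartzMap.fourier_coe]
  have e3 : ∫ x, (𝓕 (G : E → ℂ)) x • f x = ∫ x, G x • 𝓕 f x := by
    have := VectorFourier.integral_fourierIntegral_smul_eq_flip (L := innerₗ E) (μ := volume)
      (ν := volume) Real.continuous_fourierChar (by exact continuous_inner) G.integrable h1
    rwa [flip_innerₗ] at this
  rw [e2, e3]
  refine integral_congr_ae (Filter.Eventually.of_forall fun x => ?_)
  simp [hG]

theorem Real.memLp_two_fourier {f : E → F} (h1 : Integrable f) (h2 : MemLp f 2 volume) :
    MemLp (𝓕 f) 2 volume :=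
  (memLp_congr_ae (h2.fourier_toLp_ae_eq h1)).1 (Lp.memLp _)

theorem Real.eLpNorm_fourier {f : E → F} (h1 : Integrable f) (h2 : MemLp f 2 volume) :
    eLpNorm (𝓕 f) 2 volume = eLpNorm f 2 volume := by
  rw [← eLpNorm_congr_ae (h2.fourier_toLp_ae_eq h1), ← eLpNorm_congr_ae h2.coeFn_toLp]
  have := Lp.norm_fourier_eq (h2.toLp f)
  rw [Lp.norm_def, Lp.norm_def, ENNReal.toReal_eq_toReal_iff' (Lp.eLpNorm_ne_top _)
    (Lp.eLpNorm_ne_top _)] at this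
  exact this

theorem Real.integral_norm_sq_fourier {f : E → F} (h1 : Integrable f) (h2 : MemLp f 2 volume) :
    ∫ ξ, ‖𝓕 f ξ‖ ^ 2 = ∫ x, ‖f x‖ ^ 2 := by
  have a := Real.eLpNorm_fourier h1 h2
  have h3 := Real.memLp_two_fourier h1 h2
  rw [h3.eLpNorm_eq_integral_rpow_norm (by norm_num) (by norm_num),
    h2.eLpNorm_eq_integral_rpow_norm (by norm_num) (by norm_num)] at a
  have b := (ENNReal.ofReal_eq_ofReal_iff (by positivity) (by positivity)).1 a
  have c := (Real.rpow_left_inj (integral_nonneg fun _ => by positivity)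
    (integral_nonneg fun _ => by positivity) (by norm_num)).1 b
  simpa using c

theorem Real.integral_norm_sq_fourierInv {f : E → F} (h1 : Integrable f)
    (h2 : MemLp f 2 volume) : ∫ ξ, ‖𝓕⁻ f ξ‖ ^ 2 = ∫ x, ‖f x‖ ^ 2 := by
  simp_rw [Real.fourierInv_eq_fourier_neg]
  rw [integral_neg_eq_self (fun ξ => ‖𝓕 f ξ‖ ^ 2)]
  exact Real.integral_norm_sq_fourier h1 h2

end Fourier

/-! ### Schur and Young inequalities -/

section Schur

/-- The Cauchy-Schwarz inequality for the measure of density `w`. -/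
theorem lintegral_mul_sq_le {α : Type*} [MeasurableSpace α] (μ : Measure α) {w a : α → ℝ≥0∞}
    (hw : AEMeasurable w μ) (ha : AEMeasurable a μ) :
    (∫⁻ k, w k * a k ∂μ) ^ 2 ≤ (∫⁻ k, w k ∂μ) * ∫⁻ k, w k * a k ^ 2 ∂μ := by
  have h := ENNReal.lintegral_mul_le_Lp_mul_Lq μ (p := 2) (q := 2) (by constructor <;> norm_num)
    (hw.pow_const (1 / 2 : ℝ)) ((hw.pow_const (1 / 2 : ℝ)).mul ha)
  have hs : ∀ x : ℝ≥0∞, x ^ (1 / 2 : ℝ) * x ^ (1 / 2 : ℝ) = x := fun x => by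
    rw [← ENNReal.rpow_add_of_nonneg _ _ (by norm_num) (by norm_num)]; norm_num
  have hs2 : ∀ x : ℝ≥0∞, (x ^ (1 / 2 : ℝ)) ^ 2 = x := fun x => by rw [sq, hs]
  have h1 : ∀ k, ((fun k => w k ^ (1 / 2 : ℝ)) * ((fun k => w k ^ (1 / 2 : ℝ)) * a)) k
      = w k * a k := fun k => by simp only [Pi.mul_apply]; rw [← mul_assoc, hs]
  have h2 : ∀ k, (w k ^ (1 / 2 : ℝ)) ^ (2 : ℝ) = w k := fun k => by
    rw [← ENNReal.rpow_mul]; norm_num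
  have h3 : ∀ k, ((fun k => w k ^ (1 / 2 : ℝ)) * a) k ^ (2 : ℝ) = w k * a k ^ 2 := fun k => by
    simp only [Pi.mul_apply]
    rw [ENNReal.mul_rpow_of_nonneg _ _ (by norm_num), h2]; norm_num
  simp_rw [h1, h2, h3] at h
  calc _ ≤ ((∫⁻ k, w k ∂μ) ^ (1 / 2 : ℝ) * (∫⁻ k, w k * a k ^ 2 ∂μ) ^ (1 / 2 : ℝ)) ^ 2 := by gcongr
    _ = _ := by rw [mul_pow, hs2, hs2]

variable {E : Type*} [NormedAddCommGroup E] [InnerProductSpace ℝ E] [FiniteDimensional ℝ E]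
  [MeasurableSpace E] [BorelSpace E]

/-- Young's inequality `L¹ * L² ⊆ L²`. -/
theorem lintegral_convolution_sq_le {w a : E → ℝ≥0∞} (hw : Measurable w) (ha : Measurable a) :
    ∫⁻ ξ, (∫⁻ k, w (ξ - k) * a k) ^ 2 ≤ (∫⁻ k, w k) ^ 2 * ∫⁻ k, a k ^ 2 := by
  calc ∫⁻ ξ, (∫⁻ k, w (ξ - k) * a k) ^ 2
      ≤ ∫⁻ ξ, (∫⁻ k, w k) * ∫⁻ k, w (ξ - k) * a k ^ 2 := by
        refine lintegral_mono fun ξ => ?_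
        refine (lintegral_mul_sq_le volume (by fun_prop) (by fun_prop)).trans ?_
        rw [lintegral_sub_left_eq_self w ξ]
    _ = (∫⁻ k, w k) * ∫⁻ k, ∫⁻ ξ, w (ξ - k) * a k ^ 2 := by
        rw [lintegral_const_mul _ (Measurable.lintegral_prod_right' (f := fun p : E × E =>
          w (p.1 - p.2) * a p.2 ^ 2) (by fun_prop)), lintegral_lintegral_swap]
        exact (by fun_prop : Measurable fun p : E × E => w (p.1 - p.2) * a p.2 ^ 2).aemeasurable
    _ = (∫⁻ k, w k) * ∫⁻ k, (∫⁻ ξ, w ξ) * a k ^ 2 := by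
        congr 1
        refine lintegral_congr fun k => ?_
        rw [lintegral_mul_const _ (by fun_prop), lintegral_sub_right_eq_self w k]
    _ = _ := by rw [lintegral_const_mul _ (by fun_prop), sq, mul_assoc]

/-- The Schur test for a kernel dominated by an even convolution kernel, as a bound on the
sesquilinear form. -/
theorem schur_form {w : E → ℝ} (hw : Integrable w) (hw0 : ∀ k, 0 ≤ w k)
    (hwe : ∀ k, w (-k) = w k) {a b : E → ℂ} (ha : MemLp a 2 volume) (hb : MemLp b 2 volume)
    {K : E × E → ℂ} (hKm : AEStronglyMeasurable K (volume.prod volume))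
    (hK : ∀ p, ‖K p‖ ≤ w (p.1 - p.2) * (‖a p.2‖ * ‖b p.1‖)) :
    Integrable K (volume.prod volume) ∧
      ‖∫ p, K p ∂(volume.prod volume)‖ ≤ (∫ k, w k) * ((∫ k, ‖a k‖ ^ 2) + ∫ k, ‖b k‖ ^ 2) := by
  have ha2 : Integrable (fun k => ‖a k‖ ^ 2) := ha.integrable_norm_pow (by norm_num)
  have hb2 : Integrable (fun k => ‖b k‖ ^ 2) := hb.integrable_norm_pow (by norm_num)
  have key : ∀ c : E → ℝ, Integrable c →
      Integrable (fun p : E × E => c p.2 * w (p.1 - p.2)) (volume.prod volume) ∧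
      ∫ p : E × E, c p.2 * w (p.1 - p.2) ∂(volume.prod volume) = (∫ k, c k) * ∫ k, w k := by
    intro c hc
    have h : Integrable (fun p : E × E => c p.2 * w (p.1 - p.2)) (volume.prod volume) :=
      hc.convolution_integrand (ContinuousLinearMap.mul ℝ ℝ) hw
    refine ⟨h, ?_⟩
    have := integral_convolution (ContinuousLinearMap.mul ℝ ℝ) hc hw
    simp only [convolution, ContinuousLinearMap.mul_apply'] at this
    rw [← this, integral_prod _ h]
  obtain ⟨i1, e1⟩ := key _ ha2
  obtain ⟨i2, e2⟩ := key _ hb2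
  have i2' := i2.swap
  have e2' : ∫ p : E × E, ‖b p.1‖ ^ 2 * w (p.2 - p.1) ∂(volume.prod volume)
      = (∫ k, ‖b k‖ ^ 2) * ∫ k, w k := by
    rw [← e2]
    exact integral_prod_swap (fun p : E × E => ‖b p.2‖ ^ 2 * w (p.1 - p.2))
  have hdom : ∀ p : E × E, ‖K p‖ ≤ ‖a p.2‖ ^ 2 * w (p.1 - p.2) + ‖b p.1‖ ^ 2 * w (p.2 - p.1) := by
    intro p
    have : w (p.2 - p.1) = w (p.1 - p.2) := by rw [← hwe, neg_sub]
    rw [this]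
    nlinarith [hK p, hw0 (p.1 - p.2), mul_nonneg (hw0 (p.1 - p.2))
      (sq_nonneg (‖a p.2‖ - ‖b p.1‖)), mul_nonneg (hw0 (p.1 - p.2)) (sq_nonneg ‖a p.2‖),
      mul_nonneg (hw0 (p.1 - p.2)) (sq_nonneg ‖b p.1‖)]
  have i3 := i1.add i2'
  refine ⟨i3.mono' hKm (Filter.Eventually.of_forall hdom), ?_⟩
  refine (norm_integral_le_of_norm_le i3 (Filter.Eventually.of_forall hdom)).trans (le_of_eq ?_)
  have := integral_add i1 i2'
  simp only [Function.comp_apply, Prod.fst_swap, Prod.snd_swap] at this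
  rw [e1, e2'] at this
  simp only [Pi.add_apply, Function.comp_apply, Prod.fst_swap, Prod.snd_swap]
  rw [this]; ring

end Schur

/-! ### Windows -/

section Window
set_option linter.unusedSectionVars false
variable {E : Type*} [NormedAddCommGroup E]

/-- The tent function `max (1 - ‖z‖) 0`. -/
noncomputable def tent (z : E) : ℝ := max 0 (1 - ‖z‖)

theorem tent_nonneg (z : E) : 0 ≤ tent z := le_max_left _ _

theorem tent_le_one (z : E) : tent z ≤ 1 := by
  unfold tent; exact max_le zero_le_one (by linarith [norm_nonneg z])

theorem tent_eq_zero {z : E} (h : 1 ≤ ‖z‖) : tent z = 0 := by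
  unfold tent; exact max_eq_left (by linarith)

theorem tent_neg (z : E) : tent (-z) = tent z := by simp [tent]

theorem abs_tent_sub_le (z z' : E) : |tent z - tent z'| ≤ ‖z - z'‖ := by
  unfold tent
  refine (abs_max_sub_max_le_max _ _ _ _).trans ?_
  rw [sub_self, abs_zero]
  refine max_le (norm_nonneg _) ?_
  rw [show 1 - ‖z‖ - (1 - ‖z'‖) = ‖z'‖ - ‖z‖ by ring, ← norm_neg (z - z'), neg_sub]
  exact abs_norm_sub_norm_le _ _

theorem continuous_tent : Continuous (tent : E → ℝ) := by unfold tent; fun_prop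

variable [InnerProductSpace ℝ E] [FiniteDimensional ℝ E] [MeasurableSpace E] [BorelSpace E]

theorem hasCompactSupport_tent : HasCompactSupport (tent : E → ℝ) :=
  HasCompactSupport.of_support_subset_isCompact (isCompact_closedBall (0 : E) 1) fun z hz => by
    rw [mem_closedBall_zero_iff]
    by_contra h
    exact hz (tent_eq_zero (not_le.1 h).le)

theorem integral_tent_sq_pos : 0 < ∫ z : E, tent z ^ 2 := by
  refine Continuous.integral_pos_of_hasCompactSupport_nonneg_nonzero (x := 0)
    (continuous_tent.pow 2) ?_ (fun z => sq_nonneg _) (by simp [tent])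
  have := (hasCompactSupport_tent (E := E)).comp_left (g := fun x : ℝ => x ^ 2) (by norm_num)
  exact this

variable (E) in
/-- The constant that normalizes the tent function in `L²`. -/
noncomputable def tentConst : ℝ := 1 / Real.sqrt (∫ z : E, tent z ^ 2)

theorem tentConst_pos : 0 < tentConst E :=
  one_div_pos.2 (Real.sqrt_pos.2 integral_tent_sq_pos)

/-- The window of width `a⁻²`, normalized in `L²`.  With `a = (l ξ)^(-1/4)` the width is the square
root of the weight, and the normalizing factor is a natural power of `a` whatever the dimension. -/
noncomputable def window (a : ℝ) (z : E) : ℝ :=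
  tentConst E * (a ^ finrank ℝ E * tent ((a ^ 2) • z))

theorem continuous_window : Continuous fun p : ℝ × E => window p.1 p.2 := by
  unfold window
  have := continuous_tent (E := E)
  fun_prop

theorem window_neg (a : ℝ) (z : E) : window a (-z) = window a z := by
  simp [window, tent_neg]

theorem window_eq_zero {a : ℝ} {z : E} (h : 1 ≤ a ^ 2 * ‖z‖) : window a z = 0 := by
  unfold window
  rw [tent_eq_zero, mul_zero, mul_zero]
  rwa [norm_smul, Real.norm_of_nonneg (sq_nonneg a)]

theorem integral_window_sq {a : ℝ} (ha : 0 < a) : ∫ z : E, window a z ^ 2 = 1 := by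
  unfold window
  have h0 := integral_tent_sq_pos (E := E)
  have h1 := Measure.integral_comp_smul (volume : Measure E) (fun z => tent z ^ 2) (a ^ 2)
  rw [abs_of_nonneg (by positivity), smul_eq_mul] at h1
  have h2 : tentConst E ^ 2 * ∫ z : E, tent z ^ 2 = 1 := by
    unfold tentConst
    rw [div_pow, Real.sq_sqrt h0.le]; field_simp
  simp_rw [mul_pow]
  rw [integral_const_mul, integral_const_mul, h1, ← mul_assoc (_ ^ 2),
    ← pow_mul, mul_comm _ 2, pow_mul]
  field_simp
  simpa using h2

/-- Two windows with nearby centres and widths, compared pointwise.  Here `κ` is the distance of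
the centres, and the condition on `a ^ 2 - b ^ 2` is what a Lipschitz weight gives. -/
theorem abs_window_sub_le {a b κ : ℝ} (ha : 0 < a) (ha1 : a ≤ 1) (hb : 0 < b)
    (hba : b ^ 2 ≤ 2 * a ^ 2) (hab : |a ^ 2 - b ^ 2| ≤ 14 * κ * a ^ 6) {z z' : E}
    (hz : a ^ 2 * ‖z‖ ≤ 2) (hzz : ‖z - z'‖ ≤ κ) :
    |window a z - window b z'| ≤
      tentConst E * (14 * finrank ℝ E * 2 ^ finrank ℝ E + 30) * κ * (a ^ finrank ℝ E * a ^ 2) := by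
  set n := finrank ℝ E
  have hκ : 0 ≤ κ := (norm_nonneg _).trans hzz
  have hb2 : b ≤ 2 * a := by nlinarith
  have hc := tentConst_pos (E := E)
  have ha2 : a ^ 2 ≤ 1 := by nlinarith
  have h1 : |tent (a ^ 2 • z) - tent (b ^ 2 • z')| ≤ 30 * κ * a ^ 2 := by
    refine (abs_tent_sub_le _ _).trans ?_
    have : a ^ 2 • z - b ^ 2 • z' = (a ^ 2 - b ^ 2) • z + b ^ 2 • (z - z') := by module
    rw [this]
    refine (norm_add_le _ _).trans ?_
    rw [norm_smul, norm_smul, Real.norm_eq_abs, Real.norm_of_nonneg (sq_nonneg b)]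
    have e1 : |a ^ 2 - b ^ 2| * ‖z‖ ≤ 28 * κ * a ^ 2 := by
      calc |a ^ 2 - b ^ 2| * ‖z‖ ≤ 14 * κ * a ^ 6 * ‖z‖ := by gcongr
        _ = 14 * κ * a ^ 4 * (a ^ 2 * ‖z‖) := by ring
        _ ≤ 14 * κ * a ^ 4 * 2 := by gcongr
        _ = 28 * κ * a ^ 2 * a ^ 2 := by ring
        _ ≤ 28 * κ * a ^ 2 * 1 := by gcongr
        _ = _ := by ring
    have e2 : b ^ 2 * ‖z - z'‖ ≤ 2 * a ^ 2 * κ := by gcongr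
    linarith
  have h2 : |a ^ n - b ^ n| ≤ 14 * n * 2 ^ n * κ * (a ^ n * a ^ 2) := by
    rcases Nat.eq_zero_or_pos n with h | h
    · simp [h]
    have e0 : |a - b| * a ≤ 14 * κ * a ^ 6 := by
      refine le_trans ?_ hab
      rw [show a ^ 2 - b ^ 2 = (a - b) * (a + b) by ring, abs_mul, abs_of_pos (add_pos ha hb)]
      gcongr; linarith
    have e1 : |a - b| ≤ 14 * κ * a ^ 5 := by
      refine le_of_mul_le_mul_right (e0.trans (le_of_eq (by ring))) ha
    have e2 := abs_pow_sub_pow_le a b n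
    rw [abs_of_pos ha, abs_of_pos hb] at e2
    calc |a ^ n - b ^ n| ≤ |a - b| * n * max a b ^ (n - 1) := e2
      _ ≤ (14 * κ * a ^ 5) * n * (2 * a) ^ (n - 1) := by
          gcongr; exact max_le (by linarith) hb2
      _ = 14 * n * 2 ^ (n - 1) * κ * (a ^ (n - 1) * a * a ^ 2) * a ^ 2 := by ring
      _ = 14 * n * 2 ^ (n - 1) * κ * (a ^ n * a ^ 2) * a ^ 2 := by
          rw [← pow_succ, Nat.sub_add_cancel h]
      _ ≤ 14 * n * 2 ^ n * κ * (a ^ n * a ^ 2) * 1 := by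
          gcongr
          · norm_num
          · omega
      _ = _ := by ring
  have h3 : window a z - window b z' = tentConst E * (a ^ n * (tent (a ^ 2 • z) -
      tent (b ^ 2 • z')) + (a ^ n - b ^ n) * tent (b ^ 2 • z')) := by
    simp only [window, n]; ring
  rw [h3, abs_mul, abs_of_pos hc, mul_assoc, mul_assoc]
  refine mul_le_mul_of_nonneg_left ((abs_add_le _ _).trans ?_) hc.le
  rw [abs_mul, abs_mul, abs_of_nonneg (by positivity : (0:ℝ) ≤ a ^ n), abs_of_nonneg (tent_nonneg _)]
  have e3 : a ^ n * |tent (a ^ 2 • z) - tent (b ^ 2 • z')| ≤ a ^ n * (30 * κ * a ^ 2) := by gcongr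
  have e4 : |a ^ n - b ^ n| * tent (b ^ 2 • z') ≤ |a ^ n - b ^ n| * 1 := by
    gcongr; exact tent_le_one _
  linarith

end Window

/-! ### Frequency weights and slowly varying windows -/

section FreqWindow
set_option linter.unusedSectionVars false
variable {E : Type*} [NormedAddCommGroup E]

/-- A frequency weight: large, Lipschitz, and almost concave at the scale of its square root.
The numerical constants suit `(γ² + |2πξ|²)^(1/2)` for `γ ≥ 200`. -/
structure IsFreqWeight (l : E → ℝ) : Prop where
  large : ∀ ξ, 200 ≤ l ξ
  lip : ∀ ξ k, |l ξ - l k| ≤ 7 * ‖ξ - k‖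
  second : ∀ ξ w, ‖w‖ ^ 2 ≤ l ξ → l (ξ + w) + l (ξ - w) ≤ 2 * l ξ + 40

namespace IsFreqWeight
variable {l : E → ℝ} (hl : IsFreqWeight l)
include hl

theorem pos (ξ : E) : 0 < l ξ := by linarith [hl.large ξ]

theorem continuous : Continuous l :=
  (LipschitzWith.of_dist_le_mul (K := 7) fun ξ k => by
    rw [Real.dist_eq, dist_eq_norm]; exact hl.lip ξ k).continuous

/-- The weight varies by a factor between `1 / 2` and `3 / 2` over the support of a window. -/
theorem abs_sub_le {ξ ζ : E} (h : ‖ζ - ξ‖ ^ 2 ≤ l ξ) : |l ζ - l ξ| ≤ l ξ / 2 := by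
  refine (hl.lip _ _).trans ?_
  have := hl.large ξ
  refine abs_le_of_sq_le_sq' ?_ (by linarith) |>.2
  nlinarith

theorem scale_pos (ξ : E) : 0 < 1 / √√(l ξ) := by
  have := hl.pos ξ
  positivity

theorem scale_sq (ξ : E) : (1 / √√(l ξ)) ^ 2 = 1 / √(l ξ) := by
  rw [div_pow, Real.sq_sqrt (Real.sqrt_nonneg _), one_pow]

theorem sqrt_ge (ξ : E) : 14 ≤ √(l ξ) :=
  Real.le_sqrt_of_sq_le (by linarith [hl.large ξ])

end IsFreqWeight

variable [InnerProductSpace ℝ E] [FiniteDimensional ℝ E] [MeasurableSpace E] [BorelSpace E]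

variable (E) in
/-- The constant in the estimate of the variation of the windows. -/
noncomputable def windowVar : ℝ :=
  3 * (tentConst E * (14 * finrank ℝ E * 2 ^ finrank ℝ E + 30)) ^ 2 * 2 ^ finrank ℝ E *
    volume.real (Metric.closedBall (0 : E) 1) + 10000

theorem windowVar_pos : 0 < windowVar E := by
  unfold windowVar
  have := tentConst_pos (E := E)
  have : 0 ≤ volume.real (Metric.closedBall (0 : E) 1) := measureReal_nonneg
  positivity

/-- The window centred at the frequency `ξ`, of width `(l ξ)^(1/2)`. -/
noncomputable def freqWindow (l : E → ℝ) (ξ ζ : E) : ℝ :=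
  window (1 / √√(l ξ)) (ζ - ξ)

namespace IsFreqWeight
variable {l : E → ℝ} (hl : IsFreqWeight l)
include hl

theorem freqWindow_eq_zero {ξ ζ : E} (h : l ξ ≤ ‖ζ - ξ‖ ^ 2) : freqWindow l ξ ζ = 0 := by
  refine window_eq_zero ?_
  rw [hl.scale_sq, div_mul_eq_mul_div, one_mul, one_le_div (Real.sqrt_pos.2 (hl.pos ξ))]
  exact Real.sqrt_le_iff.2 ⟨norm_nonneg _, h⟩

theorem continuous_freqWindow : Continuous fun p : E × E => freqWindow l p.1 p.2 := by
  unfold freqWindow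
  have h := hl.continuous
  refine continuous_window.comp (f := fun p : E × E => (1 / √√(l p.1), p.2 - p.1)) ?_
  refine Continuous.prodMk (Continuous.div₀ continuous_const (by fun_prop) fun p => ?_) (by fun_prop)
  have := hl.pos p.1
  positivity

theorem integral_freqWindow_sq (ξ : E) : ∫ ζ, freqWindow l ξ ζ ^ 2 = 1 := by
  unfold freqWindow
  rw [integral_sub_right_eq_self (fun z => window (1 / √√(l ξ)) z ^ 2) ξ]
  exact integral_window_sq (hl.scale_pos ξ)

theorem integrable_freqWindow_sq (ξ : E) : Integrable fun ζ => freqWindow l ξ ζ ^ 2 :=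
  Integrable.of_integral_ne_zero (by rw [hl.integral_freqWindow_sq]; exact one_ne_zero)

theorem hasCompactSupport_freqWindow (ξ : E) : HasCompactSupport (freqWindow l ξ) :=
  HasCompactSupport.of_support_subset_isCompact (isCompact_closedBall ξ (√(l ξ))) fun z hz => by
    rw [Metric.mem_closedBall, dist_eq_norm]
    by_contra h
    refine hz (hl.freqWindow_eq_zero ?_)
    have := Real.lt_sq_of_sqrt_lt (not_le.1 h)
    exact this.le

/-- Fixing the second argument also gives a compactly supported function. -/
theorem hasCompactSupport_freqWindow_left (ζ : E) :
    HasCompactSupport fun ξ => freqWindow l ξ ζ :=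
  HasCompactSupport.of_support_subset_isCompact (isCompact_closedBall ζ (l ζ)) fun ξ hξ => by
    rw [Metric.mem_closedBall, dist_eq_norm]
    by_contra h
    rw [not_le] at h
    refine hξ (hl.freqWindow_eq_zero ?_)
    have h1 := hl.large ζ
    have h2 := (abs_le.1 (hl.lip ξ ζ)).2
    rw [← norm_neg (ζ - ξ), neg_sub]
    nlinarith

theorem integrable_mul_freqWindow_sq {f : E → ℂ} (hf : Continuous f) (ξ : E) :
    Integrable fun ζ => f ζ * (freqWindow l ξ ζ : ℂ) ^ 2 := by
  have h := hl.continuous_freqWindow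
  refine Continuous.integrable_of_hasCompactSupport (by fun_prop) ?_
  refine HasCompactSupport.mul_left ?_
  exact (hl.hasCompactSupport_freqWindow ξ).comp_left (g := fun x : ℝ => (x : ℂ) ^ 2) (by simp)

theorem integrable_weight_mul_freqWindow_sq (ξ : E) :
    Integrable fun ζ => l ζ * freqWindow l ξ ζ ^ 2 := by
  have h := hl.continuous_freqWindow
  have h2 := hl.continuous
  refine Continuous.integrable_of_hasCompactSupport (by fun_prop) ?_
  refine HasCompactSupport.mul_left ?_
  exact (hl.hasCompactSupport_freqWindow ξ).comp_left (g := fun x : ℝ => x ^ 2) (by simp)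

theorem weight_mul_freqWindow_sq_le (ξ ζ : E) :
    l ζ * freqWindow l ξ ζ ^ 2 ≤ 2 * l ξ * freqWindow l ξ ζ ^ 2 := by
  rcases le_total (l ξ) (‖ζ - ξ‖ ^ 2) with h | h
  · rw [hl.freqWindow_eq_zero h]; simp
  · have := (abs_le.1 (hl.abs_sub_le h)).2
    have := hl.pos ξ
    gcongr
    linarith

theorem integral_weight_mul_freqWindow_sq_le (ξ : E) :
    ∫ ζ, l ζ * freqWindow l ξ ζ ^ 2 ≤ 2 * l ξ := by
  refine (integral_mono (hl.integrable_weight_mul_freqWindow_sq ξ)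
    ((hl.integrable_freqWindow_sq ξ).const_mul _)
    (hl.weight_mul_freqWindow_sq_le ξ)).trans (le_of_eq ?_)
  rw [integral_const_mul, hl.integral_freqWindow_sq, mul_one]

/-- Since the window is even about its centre, averages against its square only see the even part
of a function. -/
theorem integral_mul_freqWindow_sq_symm {f : E → ℂ} (hf : Continuous f) (ξ : E) :
    ∫ ζ, (f ζ - f ξ) * (freqWindow l ξ ζ : ℂ) ^ 2
      = ∫ w, (f (ξ + w) + f (ξ - w) - 2 * f ξ) / 2 * (freqWindow l ξ (ξ + w) : ℂ) ^ 2 := by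
  set g : E → ℂ := fun w => (f (ξ + w) - f ξ) * (freqWindow l ξ (ξ + w) : ℂ) ^ 2
  have hg : Integrable g :=
    ((hl.integrable_mul_freqWindow_sq (f := fun ζ => f ζ - f ξ) (by fun_prop) ξ).comp_add_left ξ)
  have e1 : ∫ ζ, (f ζ - f ξ) * (freqWindow l ξ ζ : ℂ) ^ 2 = ∫ w, g w :=
    (integral_add_left_eq_self (fun ζ => (f ζ - f ξ) * (freqWindow l ξ ζ : ℂ) ^ 2) ξ).symm
  have e2 : ∫ w, g (-w) = ∫ w, g w := integral_neg_eq_self g volume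
  have e3 : ∫ w, (g w + g (-w)) / 2 = ∫ w, g w := by
    rw [integral_div, integral_add hg hg.comp_neg, e2]; ring
  rw [e1, ← e3]
  refine integral_congr_ae (Filter.Eventually.of_forall fun w => ?_)
  have : freqWindow l ξ (ξ - w) = freqWindow l ξ (ξ + w) := by
    simp only [freqWindow]; rw [← window_neg]; congr 1; abel
  simp only [g, ← sub_eq_add_neg, this]
  ring

/-- The average of the weight over a window exceeds its value at the centre by a bounded amount: the
first order term vanishes by symmetry, and the second difference is bounded. -/
theorem integral_weight_mul_freqWindow_sq_le_add (ξ : E) :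
    ∫ ζ, l ζ * freqWindow l ξ ζ ^ 2 ≤ l ξ + 20 := by
  have hlc := hl.continuous
  have h := hl.integral_mul_freqWindow_sq_symm (f := fun ζ => (l ζ : ℂ)) (by fun_prop) ξ
  have h' : ∫ ζ, (l ζ - l ξ) * freqWindow l ξ ζ ^ 2
      = ∫ w, (l (ξ + w) + l (ξ - w) - 2 * l ξ) / 2 * freqWindow l ξ (ξ + w) ^ 2 := by
    exact_mod_cast h
  have e1 : ∫ ζ, (l ζ - l ξ) * freqWindow l ξ ζ ^ 2
      = (∫ ζ, l ζ * freqWindow l ξ ζ ^ 2) - l ξ := by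
    simp_rw [sub_mul]
    rw [integral_sub (hl.integrable_weight_mul_freqWindow_sq ξ)
      ((hl.integrable_freqWindow_sq ξ).const_mul _), integral_const_mul,
      hl.integral_freqWindow_sq, mul_one]
  have e2 : ∫ w, (l (ξ + w) + l (ξ - w) - 2 * l ξ) / 2 * freqWindow l ξ (ξ + w) ^ 2
      ≤ ∫ w, 20 * freqWindow l ξ (ξ + w) ^ 2 := by
    refine integral_mono ?_ ?_ ?_
    · have h := hl.continuous_freqWindow
      refine Continuous.integrable_of_hasCompactSupport (by fun_prop) (HasCompactSupport.mul_left ?_)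
      have h2 : HasCompactSupport fun w => freqWindow l ξ (ξ + w) :=
        (hl.hasCompactSupport_freqWindow ξ).comp_homeomorph (Homeomorph.addLeft ξ)
      exact h2.comp_left (g := fun x : ℝ => x ^ 2) (by simp)
    · exact ((hl.integrable_freqWindow_sq ξ).comp_add_left ξ).const_mul _
    · intro w
      rcases le_total (l ξ) (‖w‖ ^ 2) with hw | hw
      · have : freqWindow l ξ (ξ + w) = 0 := hl.freqWindow_eq_zero (by simpa using hw)
        simp [this]
      · have := hl.second ξ w hw
        show _ / 2 * _ ≤ 20 * _
        gcongr
        linarith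
  rw [integral_const_mul, integral_add_left_eq_self (fun ζ => freqWindow l ξ ζ ^ 2),
    hl.integral_freqWindow_sq] at e2
  linarith

theorem integrable_weight_mul_sub_sq (ξ k : E) :
    Integrable fun ζ => l ζ * (freqWindow l ξ ζ - freqWindow l k ζ) ^ 2 := by
  have h := hl.continuous_freqWindow
  have h2 := hl.continuous
  refine Continuous.integrable_of_hasCompactSupport (by fun_prop) (HasCompactSupport.mul_left ?_)
  exact ((hl.hasCompactSupport_freqWindow ξ).sub (hl.hasCompactSupport_freqWindow k)).comp_left
    (g := fun x : ℝ => x ^ 2) (by simp)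

set_option maxHeartbeats 1000000 in
/-- The windows vary slowly: their variation is measured by the distance of the centres divided by
the width. -/
theorem integral_weight_mul_sub_sq_le (ξ k : E) :
    ∫ ζ, l ζ * (freqWindow l ξ ζ - freqWindow l k ζ) ^ 2
      ≤ windowVar E * (1 + ‖ξ - k‖) ^ 2 := by
  set κ := ‖ξ - k‖ with hκ
  set n := finrank ℝ E with hn
  set M := tentConst E * (14 * finrank ℝ E * 2 ^ finrank ℝ E + 30) with hM
  set v := volume.real (Metric.closedBall (0 : E) 1) with hv
  have hκ0 : 0 ≤ κ := norm_nonneg _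
  have hv0 : 0 ≤ v := measureReal_nonneg
  have hVar : windowVar E = 3 * M ^ 2 * 2 ^ n * v + 10000 := rfl
  have hM0 : 0 ≤ M := by have := tentConst_pos (E := E); positivity
  set s := √(l ξ) with hs
  have hs14 : 14 ≤ s := hl.sqrt_ge ξ
  have hs2 : s ^ 2 = l ξ := Real.sq_sqrt (hl.pos ξ).le
  set s' := √(l k) with hs'
  have hs14' : 14 ≤ s' := hl.sqrt_ge k
  have hs2' : s' ^ 2 = l k := Real.sq_sqrt (hl.pos k).le
  have hlip := abs_le.1 (hl.lip ξ k)
  -- For distant centres both windows are estimated separately, since `l ξ` is then `O(κ²)`.  For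
  -- nearby centres the windows are compared pointwise, and the volume of the support compensates the
  -- normalization.
  rcases le_total s (28 * κ) with hA | hB
  · have e1 : ∫ ζ, l ζ * (freqWindow l ξ ζ - freqWindow l k ζ) ^ 2
        ≤ ∫ ζ, 2 * (l ζ * freqWindow l ξ ζ ^ 2) + 2 * (l ζ * freqWindow l k ζ ^ 2) := by
      refine integral_mono (hl.integrable_weight_mul_sub_sq ξ k)
        (((hl.integrable_weight_mul_freqWindow_sq ξ).const_mul 2).add
          ((hl.integrable_weight_mul_freqWindow_sq k).const_mul 2)) fun ζ => ?_
      nlinarith [mul_nonneg (hl.pos ζ).le (sq_nonneg (freqWindow l ξ ζ + freqWindow l k ζ))]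
    rw [integral_add ((hl.integrable_weight_mul_freqWindow_sq ξ).const_mul 2)
      ((hl.integrable_weight_mul_freqWindow_sq k).const_mul 2), integral_const_mul,
      integral_const_mul] at e1
    have e2 := hl.integral_weight_mul_freqWindow_sq_le ξ
    have e3 := hl.integral_weight_mul_freqWindow_sq_le k
    have e4 : l ξ ≤ 784 * κ ^ 2 := by rw [← hs2]; nlinarith
    have e5 : 0 ≤ 3 * M ^ 2 * 2 ^ n * v * (1 + κ) ^ 2 := by positivity
    rw [hVar, add_mul]
    nlinarith
  · set a := 1 / √√(l ξ) with ha
    set b := 1 / √√(l k) with hb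
    have ha0 : 0 < a := hl.scale_pos ξ
    have hb0 : 0 < b := hl.scale_pos k
    have ha2 : a ^ 2 = 1 / s := hl.scale_sq ξ
    have hb2 : b ^ 2 = 1 / s' := hl.scale_sq k
    have hs0 : 0 < s := by linarith
    have hs0' : 0 < s' := by linarith
    have hdiff : (s - s') * (s + s') = l ξ - l k := by rw [← hs2, ← hs2']; ring
    have habs : |s' - s| * s ≤ 7 * κ := by
      have : |s' - s| * (s + s') ≤ 7 * κ := by
        rw [← abs_of_pos (add_pos hs0 hs0'), ← abs_mul]
        refine abs_le.2 ⟨by linarith, by linarith⟩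
      have h0 : |s' - s| * s ≤ |s' - s| * (s + s') := by gcongr; linarith
      linarith
    have hd : |s' - s| ≤ 1 / 4 := by
      refine le_of_mul_le_mul_right (habs.trans ?_) hs0
      linarith
    have hlow : s ≤ 2 * s' := by have := neg_abs_le (s' - s); linarith
    have ha1 : a ≤ 1 := by
      have : a ^ 2 ≤ 1 := by rw [ha2, div_le_one hs0]; linarith
      exact (sq_le_one_iff₀ ha0.le).1 this
    have hba : b ^ 2 ≤ 2 * a ^ 2 := by
      rw [ha2, hb2, mul_one_div, div_le_div_iff₀ hs0' hs0]; linarith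
    have hab : |a ^ 2 - b ^ 2| ≤ 14 * κ * a ^ 6 := by
      rw [show a ^ 6 = (a ^ 2) ^ 3 by ring, ha2, hb2, div_sub_div _ _ hs0.ne' hs0'.ne', abs_div,
        abs_of_pos (mul_pos hs0 hs0'), one_mul, mul_one, one_div, inv_pow, ← div_eq_mul_inv,
        div_le_div_iff₀ (by positivity) (by positivity)]
      calc |s' - s| * s ^ 3 = |s' - s| * s * s ^ 2 := by ring
        _ ≤ 7 * κ * s ^ 2 := by gcongr
        _ ≤ 7 * κ * (s * (2 * s')) := by rw [sq]; gcongr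
        _ = _ := by ring
    have hsup : ∀ ζ, ‖ζ - ξ‖ ^ 2 < l ξ ∨ ‖ζ - k‖ ^ 2 < l k → ‖ζ - ξ‖ ≤ 2 * s := by
      intro ζ h
      rcases h with h | h
      · rw [← hs2] at h
        have := abs_lt_of_sq_lt_sq h hs0.le
        rw [abs_of_nonneg (norm_nonneg _)] at this
        linarith
      · rw [← hs2'] at h
        have h1 := abs_lt_of_sq_lt_sq h hs0'.le
        rw [abs_of_nonneg (norm_nonneg _)] at h1
        have h2 : ‖ζ - ξ‖ ≤ ‖ζ - k‖ + κ := by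
          rw [hκ, ← norm_neg (ξ - k), neg_sub]
          simpa using norm_add_le (ζ - k) (k - ξ)
        have h3 : s' ≤ s + s / 4 := by have := le_abs_self (s' - s); linarith
        linarith
    have hpt : ∀ ζ, l ζ * (freqWindow l ξ ζ - freqWindow l k ζ) ^ 2 ≤
        (Metric.closedBall ξ (2 * s)).indicator
          (fun _ => 3 * s ^ 2 * (M * κ * (a ^ n * a ^ 2)) ^ 2) ζ := by
      intro ζ
      by_cases hζ : ‖ζ - ξ‖ ≤ 2 * s
      · rw [Set.indicator_of_mem (by rwa [Metric.mem_closedBall, dist_eq_norm])]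
        have h1 : l ζ ≤ 3 * s ^ 2 := by
          have := (abs_le.1 (hl.lip ζ ξ)).2
          have h0 : 15 * s ≤ 2 * s ^ 2 := by rw [sq]; linarith [mul_le_mul_of_nonneg_right hs14 hs0.le]
          linarith
        have h2 : |freqWindow l ξ ζ - freqWindow l k ζ| ≤ M * κ * (a ^ n * a ^ 2) := by
          refine abs_window_sub_le ha0 ha1 hb0 hba hab ?_ ?_
          · rw [ha2, one_div_mul_eq_div, div_le_iff₀ hs0]; exact hζ
          · rw [hκ, ← norm_neg (ξ - k)]; apply le_of_eq; congr 1; abel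
        have h3 : (freqWindow l ξ ζ - freqWindow l k ζ) ^ 2 ≤ (M * κ * (a ^ n * a ^ 2)) ^ 2 := by
          rw [← sq_abs]; gcongr
        exact mul_le_mul h1 h3 (sq_nonneg _) (by positivity)
      · rw [Set.indicator_of_notMem (by rwa [Metric.mem_closedBall, dist_eq_norm])]
        have h1 : freqWindow l ξ ζ = 0 := hl.freqWindow_eq_zero <| by
          by_contra h; exact hζ (hsup ζ (Or.inl (not_le.1 h)))
        have h2 : freqWindow l k ζ = 0 := hl.freqWindow_eq_zero <| by
          by_contra h; exact hζ (hsup ζ (Or.inr (not_le.1 h)))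
        simp [h1, h2]
    have hball : volume.real (Metric.closedBall ξ (2 * s)) = (2 * s) ^ n * v := by
      rw [hv, Measure.real, Measure.real, Measure.addHaar_closedBall' _ _ (by positivity),
        ENNReal.toReal_mul, ENNReal.toReal_ofReal (by positivity)]
    have hfin : volume (Metric.closedBall ξ (2 * s)) ≠ ⊤ := measure_closedBall_lt_top.ne
    calc ∫ ζ, l ζ * (freqWindow l ξ ζ - freqWindow l k ζ) ^ 2
        ≤ ∫ ζ, (Metric.closedBall ξ (2 * s)).indicator
          (fun _ => 3 * s ^ 2 * (M * κ * (a ^ n * a ^ 2)) ^ 2) ζ :=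
          integral_mono (hl.integrable_weight_mul_sub_sq ξ k)
            ((integrable_indicator_iff Metric.isClosed_closedBall.measurableSet).2
              (integrableOn_const hfin)) hpt
      _ = (2 * s) ^ n * v * (3 * s ^ 2 * (M * κ * (a ^ n * a ^ 2)) ^ 2) := by
          rw [integral_indicator Metric.isClosed_closedBall.measurableSet, setIntegral_const, hball,
            smul_eq_mul]
      _ = 3 * M ^ 2 * 2 ^ n * v * κ ^ 2 * ((s * a ^ 2) ^ n * (s * a ^ 2) ^ 2) := by
          rw [mul_pow 2 s n, mul_pow s (a ^ 2) n, ← pow_mul a 2 n, mul_comm 2 n, pow_mul a n 2]; ring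
      _ = 3 * M ^ 2 * 2 ^ n * v * κ ^ 2 := by
          rw [ha2, mul_one_div_cancel hs0.ne']; simp
      _ ≤ (3 * M ^ 2 * 2 ^ n * v + 10000) * (1 + κ) ^ 2 := by
          gcongr
          · linarith
          · linarith
      _ = _ := by rw [hVar]

end IsFreqWeight

end FreqWindow

/-! ### Symbols of order one and their symmetrization -/

section Garding
set_option linter.unusedSectionVars false
variable {E : Type*} [NormedAddCommGroup E] [InnerProductSpace ℝ E] [FiniteDimensional ℝ E]
  [MeasurableSpace E] [BorelSpace E]

/-- An integrable polynomial weight. -/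
noncomputable def polyDecay (κ : E) : ℝ := ((1 + ‖κ‖) ^ (finrank ℝ E + 1))⁻¹

theorem polyDecay_nonneg (κ : E) : 0 ≤ polyDecay κ := by unfold polyDecay; positivity

theorem polyDecay_neg (κ : E) : polyDecay (-κ) = polyDecay κ := by simp [polyDecay]

theorem continuous_polyDecay : Continuous (polyDecay : E → ℝ) := by
  unfold polyDecay
  exact Continuous.inv₀ (by fun_prop) fun x => by positivity

theorem integrable_polyDecay : Integrable (polyDecay : E → ℝ) := by
  have := integrable_one_add_norm (E := E) (μ := volume) (r := (finrank ℝ E + 1 : ℕ))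
    (by push_cast; linarith)
  refine this.congr (Filter.Eventually.of_forall fun x => ?_)
  simp only [polyDecay]
  rw [Real.rpow_neg (by positivity), Real.rpow_natCast]

/-- The partial Fourier transform of a symbol in the space variable. -/
noncomputable def partialFourier (G : E → E → ℂ) (κ ζ : E) : ℂ := 𝓕 (fun x => G x ζ) κ

/-- The estimates of a symbol of order one, compactly supported in space: size, first differences
and second differences in frequency of its partial Fourier transform.  Second differences are only
bounded, and only for increments up to the square root of the weight, which is all that is needed
at the scale of the windows; the factors `(1 + ‖κ‖) ^ 2` absorb the variation of the windows. -/
structure IsOrderOne (l : E → ℝ) (R C : ℝ) (G : E → E → ℂ) : Prop where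
  cont : Continuous (Function.uncurry G)
  supp : ∀ x ζ, R < ‖x‖ → G x ζ = 0
  nonneg : 0 ≤ C
  bdd : ∀ x ζ, ‖G x ζ‖ ≤ C * l ζ
  size : ∀ κ ζ, ‖partialFourier G κ ζ‖ * (1 + ‖κ‖) ^ 2 ≤ C * l ζ * polyDecay κ
  first : ∀ κ ζ ζ', ‖partialFourier G κ ζ - partialFourier G κ ζ'‖ * (1 + ‖κ‖) ^ 2 ≤
    C * ‖ζ - ζ'‖ * polyDecay κ
  second : ∀ κ ζ w, ‖w‖ ^ 2 ≤ l ζ →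
    ‖partialFourier G κ (ζ + w) + partialFourier G κ (ζ - w) - 2 * partialFourier G κ ζ‖ *
      (1 + ‖κ‖) ^ 2 ≤ C * polyDecay κ

/-- The quadratic form of multiplication by `g`, on the Fourier side. -/
theorem integral_mul_normSq_fourierInv {g v : E → ℂ} (hg : Integrable g) (hv : Integrable v) :
    ∫ x, g x * (‖𝓕⁻ v x‖ : ℂ) ^ 2
      = ∫ p : E × E, 𝓕 g (p.1 - p.2) * (v p.2 * conj (v p.1)) ∂(volume.prod volume) := by
  have hvc : Integrable fun ξ => conj (v ξ) := by
    exact (Complex.conjCLE : ℂ →L[ℝ] ℂ).integrable_comp hv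
  set Φ : E → E × E → ℂ := fun x p => Real.fourierChar (-(inner ℝ x (p.1 - p.2))) •
      (g x * (conj (v p.1) * v p.2))
  have hΦ : Integrable (Function.uncurry Φ) (volume.prod (volume.prod volume)) := by
    have h1 : Integrable (fun q : E × (E × E) => g q.1 * (conj (v q.2.1) * v q.2.2))
        (volume.prod (volume.prod volume)) := hg.mul_prod (hvc.mul_prod hv)
    refine h1.norm.mono' ?_ (Filter.Eventually.of_forall fun q => ?_)
    · refine AEStronglyMeasurable.smul (f := fun q : E × (E × E) =>
        Real.fourierChar (-(inner ℝ q.1 (q.2.1 - q.2.2)))) ?_ h1.1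
      have := Real.continuous_fourierChar
      exact (by fun_prop : Continuous fun q : E × (E × E) =>
        Real.fourierChar (-(inner ℝ q.1 (q.2.1 - q.2.2)))).aestronglyMeasurable
    · simp [Function.uncurry, Φ, Circle.smul_def, Circle.norm_coe]
  have e1 : ∀ x, g x * (‖𝓕⁻ v x‖ : ℂ) ^ 2 = ∫ p, Φ x p ∂(volume.prod volume) := by
    intro x
    have a1 : conj (𝓕⁻ v x) = ∫ ξ, Real.fourierChar (-(inner ℝ x ξ)) • conj (v ξ) := by
      rw [Real.fourierInv_eq, ← integral_conj]
      refine integral_congr_ae (Filter.Eventually.of_forall fun ξ => ?_)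
      simp only [Circle.smul_def, smul_eq_mul, map_mul]
      rw [← Circle.coe_inv_eq_conj, ← AddChar.map_neg_eq_inv, real_inner_comm]
    have a2 : 𝓕⁻ v x = ∫ k, Real.fourierChar (inner ℝ x k) • v k := by
      rw [Real.fourierInv_eq]
      simp_rw [real_inner_comm]
    rw [← Complex.conj_mul', a1]
    nth_rw 1 [a2]
    rw [← integral_prod_mul, ← integral_const_mul]
    refine integral_congr_ae (Filter.Eventually.of_forall fun p => ?_)
    have h : -(inner ℝ x (p.1 - p.2)) = -(inner ℝ x p.1) + inner ℝ x p.2 := by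
      rw [inner_sub_right]; ring
    simp only [Φ, Circle.smul_def, smul_eq_mul, h, AddChar.map_add_eq_mul, Circle.coe_mul]
    ring
  have e2 : ∀ p : E × E, 𝓕 g (p.1 - p.2) * (v p.2 * conj (v p.1)) = ∫ x, Φ x p := by
    intro p
    rw [Real.fourier_eq, ← integral_mul_const]
    refine integral_congr_ae (Filter.Eventually.of_forall fun x => ?_)
    simp only [Φ, Circle.smul_def, smul_eq_mul]
    ring
  simp_rw [e1, e2]
  exact integral_integral_swap hΦ

namespace IsOrderOne
variable {l : E → ℝ} {R C : ℝ} {G : E → E → ℂ} (hG : IsOrderOne l R C G)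
include hG

theorem hasCompactSupport (ζ : E) : HasCompactSupport fun x => G x ζ :=
  HasCompactSupport.of_support_subset_isCompact (isCompact_closedBall (0 : E) R) fun x hx => by
    rw [mem_closedBall_zero_iff]
    by_contra h
    exact hx (hG.supp x ζ (not_le.1 h))

theorem integrable (ζ : E) : Integrable fun x => G x ζ :=
  (hG.cont.comp (by fun_prop : Continuous fun x : E => (x, ζ))).integrable_of_hasCompactSupport
    (hG.hasCompactSupport ζ)

theorem continuous_partialFourier :
    Continuous fun q : E × E => partialFourier G q.1 q.2 := by
  have h : ∀ q : E × E, partialFourier G q.1 q.2 = ∫ x in Metric.closedBall (0 : E) R,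
      Real.fourierChar (-(inner ℝ x q.1)) • G x q.2 := by
    intro q
    rw [partialFourier, Real.fourier_eq, setIntegral_eq_integral_of_forall_compl_eq_zero]
    intro x hx
    rw [mem_closedBall_zero_iff, not_le] at hx
    rw [hG.supp x _ hx, smul_zero]
  simp_rw [h]
  refine continuous_parametric_integral_of_continuous
    (f := fun (q : E × E) x => Real.fourierChar (-(inner ℝ x q.1)) • G x q.2) ?_
    (isCompact_closedBall _ _)
  have h1 := hG.cont
  have h2 := Real.continuous_fourierChar
  have h3 : Continuous fun q : (E × E) × E => G q.2 q.1.2 :=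
    hG.cont.comp (by fun_prop : Continuous fun q : (E × E) × E => (q.2, q.1.2))
  simp only [Function.uncurry_def, Circle.smul_def]
  fun_prop

theorem norm_le (κ ζ : E) : ‖partialFourier G κ ζ‖ ≤ C * l ζ * polyDecay κ := by
  refine le_trans ?_ (hG.size κ ζ)
  refine le_mul_of_one_le_right (norm_nonneg _) ?_
  exact one_le_pow₀ (by linarith [norm_nonneg κ])

set_option maxHeartbeats 1000000 in
/-- The kernel of the operator and the kernel of its symmetrization by windows differ by the
kernel of a bounded operator.  With `A` the partial Fourier transform and `F`, `H` the windows
centred at `ξ` and `k`, one writes `F * H = (F² + H² - (F - H)²) / 2`.  The averages of `A` against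
`F²` and `H²` are close to `A ξ` and `A k`, because the windows are even and second differences of
`A` are bounded; the last term is small because the windows vary slowly. -/
theorem norm_kernel_sub_le (hl : IsFreqWeight l) (ξ k : E) :
    ‖partialFourier G (ξ - k) k - ∫ ζ, partialFourier G (ξ - k) ζ *
      ((freqWindow l ξ ζ * freqWindow l k ζ : ℝ) : ℂ)‖
      ≤ C * (2 + windowVar E) * polyDecay (ξ - k) := by
  set κ := ξ - k with hκ
  set A : E → ℂ := partialFourier G κ with hA
  have hAc : Continuous A := hG.continuous_partialFourier.comp
    (by fun_prop : Continuous fun ζ : E => (κ, ζ))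
  set r := (1 + ‖κ‖) ^ 2 with hr
  have hr1 : 1 ≤ r := one_le_pow₀ (by linarith [norm_nonneg κ])
  have hr0 : 0 < r := by linarith
  -- `d` gains the factor `(1 + ‖κ‖)⁻²`, to be spent on `(F - H)²` and on `A k - A ξ`
  set d := C * polyDecay κ / r with hd
  have hC := hG.nonneg
  have hd0 : 0 ≤ d := by have := polyDecay_nonneg κ; positivity
  have hsize : ∀ ζ, ‖A ζ‖ ≤ d * l ζ := fun ζ => by
    rw [hd, div_mul_eq_mul_div, le_div_iff₀ hr0]
    exact (hG.size κ ζ).trans (le_of_eq (by ring))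
  have hsecond : ∀ ζ w, ‖w‖ ^ 2 ≤ l ζ → ‖A (ζ + w) + A (ζ - w) - 2 * A ζ‖ ≤ d := fun ζ w h => by
    rw [hd, le_div_iff₀ hr0]
    exact hG.second κ ζ w h
  have hfirst : ‖A k - A ξ‖ ≤ d * (1 + ‖κ‖) ^ 2 := by
    have := hG.first κ k ξ
    rw [← hr, hd, div_mul_cancel₀ _ hr0.ne']
    refine le_of_mul_le_mul_right (this.trans ?_) hr0
    have h2 : ‖k - ξ‖ = ‖κ‖ := by rw [hκ, ← norm_neg, neg_sub]
    rw [h2]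
    have h3 : ‖κ‖ ≤ r := by rw [hr]; nlinarith [norm_nonneg κ]
    have := polyDecay_nonneg κ
    calc C * ‖κ‖ * polyDecay κ ≤ C * r * polyDecay κ := by gcongr
      _ = _ := by ring
  -- the average of `A` over a window is close to its value at the centre
  have hav : ∀ η, ‖(∫ ζ, A ζ * (freqWindow l η ζ : ℂ) ^ 2) - A η‖ ≤ d := by
    intro η
    have e1 : (∫ ζ, A ζ * (freqWindow l η ζ : ℂ) ^ 2) - A η
        = ∫ ζ, (A ζ - A η) * (freqWindow l η ζ : ℂ) ^ 2 := by
      simp_rw [sub_mul]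
      rw [integral_sub (hl.integrable_mul_freqWindow_sq hAc η)
        (hl.integrable_mul_freqWindow_sq continuous_const η), integral_const_mul]
      have : ∫ ζ, (freqWindow l η ζ : ℂ) ^ 2 = 1 := by
        exact_mod_cast congrArg Complex.ofReal (hl.integral_freqWindow_sq η)
      rw [this, mul_one]
    rw [e1, hl.integral_mul_freqWindow_sq_symm hAc]
    have e2 : ∫ w, d * freqWindow l η (η + w) ^ 2 = d := by
      rw [integral_const_mul, integral_add_left_eq_self (fun ζ => freqWindow l η ζ ^ 2),
        hl.integral_freqWindow_sq, mul_one]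
    refine (norm_integral_le_of_norm_le
      (((hl.integrable_freqWindow_sq η).comp_add_left η).const_mul d)
      (Filter.Eventually.of_forall fun w => ?_)).trans e2.le
    rcases le_total (l η) (‖w‖ ^ 2) with hw | hw
    · have : freqWindow l η (η + w) = 0 := hl.freqWindow_eq_zero (by simpa using hw)
      simp [this]
    · rw [norm_mul, norm_pow, Complex.norm_real, Real.norm_eq_abs, sq_abs, norm_div]
      gcongr
      have := hsecond η w hw
      simp only [Complex.norm_ofNat]
      linarith
  have hvar : ‖∫ ζ, A ζ * ((freqWindow l ξ ζ - freqWindow l k ζ : ℝ) : ℂ) ^ 2‖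
      ≤ d * (windowVar E * (1 + ‖κ‖) ^ 2) := by
    refine le_trans ?_ (mul_le_mul_of_nonneg_left (hl.integral_weight_mul_sub_sq_le ξ k) hd0)
    rw [← integral_const_mul]
    refine norm_integral_le_of_norm_le ((hl.integrable_weight_mul_sub_sq ξ k).const_mul d)
      (Filter.Eventually.of_forall fun ζ => ?_)
    rw [norm_mul, norm_pow, Complex.norm_real, Real.norm_eq_abs, sq_abs, ← mul_assoc]
    gcongr
    exact hsize ζ
  have hsplit : ∫ ζ, A ζ * ((freqWindow l ξ ζ * freqWindow l k ζ : ℝ) : ℂ)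
      = (∫ ζ, A ζ * (freqWindow l ξ ζ : ℂ) ^ 2) / 2 + (∫ ζ, A ζ * (freqWindow l k ζ : ℂ) ^ 2) / 2
        - (∫ ζ, A ζ * ((freqWindow l ξ ζ - freqWindow l k ζ : ℝ) : ℂ) ^ 2) / 2 := by
    have i1 := hl.integrable_mul_freqWindow_sq hAc ξ
    have i2 := hl.integrable_mul_freqWindow_sq hAc k
    have i3 : Integrable fun ζ =>
        A ζ * ((freqWindow l ξ ζ - freqWindow l k ζ : ℝ) : ℂ) ^ 2 := by
      have h := hl.continuous_freqWindow
      refine Continuous.integrable_of_hasCompactSupport (by fun_prop) (HasCompactSupport.mul_left ?_)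
      exact ((hl.hasCompactSupport_freqWindow ξ).sub
        (hl.hasCompactSupport_freqWindow k)).comp_left (g := fun x : ℝ => (x : ℂ) ^ 2) (by simp)
    have i4 : Integrable fun ζ =>
        A ζ * (freqWindow l ξ ζ : ℂ) ^ 2 / 2 + A ζ * (freqWindow l k ζ : ℂ) ^ 2 / 2 :=
      (i1.div_const 2).add (i2.div_const 2)
    rw [← integral_div, ← integral_div, ← integral_div, ← integral_add (i1.div_const 2)
      (i2.div_const 2), ← integral_sub i4 (i3.div_const 2)]
    refine integral_congr_ae (Filter.Eventually.of_forall fun ζ => ?_)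
    simp only [Complex.ofReal_mul, Complex.ofReal_sub]
    ring
  rw [hsplit]
  set I1 := ∫ ζ, A ζ * (freqWindow l ξ ζ : ℂ) ^ 2
  set I2 := ∫ ζ, A ζ * (freqWindow l k ζ : ℂ) ^ 2
  set I3 := ∫ ζ, A ζ * ((freqWindow l ξ ζ - freqWindow l k ζ : ℝ) : ℂ) ^ 2
  have e : A k - (I1 / 2 + I2 / 2 - I3 / 2)
      = (A k - A ξ) / 2 - (I1 - A ξ) / 2 - (I2 - A k) / 2 + I3 / 2 := by ring
  have hhalf : ∀ z : ℂ, ‖z / 2‖ = ‖z‖ / 2 := fun z => by simp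
  rw [e]
  refine (norm_add_le _ _).trans ?_
  have t1 := norm_sub_le ((A k - A ξ) / 2 - (I1 - A ξ) / 2) ((I2 - A k) / 2)
  have t2 := norm_sub_le ((A k - A ξ) / 2) ((I1 - A ξ) / 2)
  simp only [hhalf] at t1 t2 ⊢
  have h1 := hav ξ
  have h2 := hav k
  have hdr : d * r = C * polyDecay κ := by rw [hd, div_mul_cancel₀ _ hr0.ne']
  have h4 : d ≤ C * polyDecay κ := by rw [← hdr]; exact le_mul_of_one_le_right hd0 hr1
  have h5 : d * (windowVar E * r) = C * polyDecay κ * windowVar E := by rw [← hdr]; ring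
  have hvarpos : 0 ≤ windowVar E := windowVar_pos.le
  have h6 : 0 ≤ C * polyDecay κ * windowVar E := by
    have := polyDecay_nonneg κ; positivity
  have h7 : 0 ≤ C * polyDecay κ := by have := polyDecay_nonneg κ; positivity
  have h8 : C * (2 + windowVar E) * polyDecay κ
      = 2 * (C * polyDecay κ) + C * polyDecay κ * windowVar E := by ring
  rw [h8]
  rw [← hr, hdr] at hfirst
  rw [h5] at hvar
  linarith

end IsOrderOne
end Garding

/-! ### The sharp Gårding inequality -/

section Garding
set_option linter.unusedSectionVars false
variable {E : Type*} [NormedAddCommGroup E] [InnerProductSpace ℝ E] [FiniteDimensional ℝ E]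
  [MeasurableSpace E] [BorelSpace E]

/-- Integrability on a product from integrable bounds on the fibres, by Tonelli. -/
theorem integrable_prod_of_fiber_bound {α β F : Type*} [MeasurableSpace α] [MeasurableSpace β]
    [NormedAddCommGroup F] {μ : Measure α} {ν : Measure β} [SFinite μ] [SFinite ν] {f : α × β → F}
    (hf : AEStronglyMeasurable f (μ.prod ν)) {g : β → ℝ} (hg : Integrable g ν)
    (h : ∀ y, ∃ b : α → ℝ, Integrable b μ ∧ (∀ x, ‖f (x, y)‖ ≤ b x) ∧ ∫ x, b x ∂μ ≤ g y) :
    Integrable f (μ.prod ν) := by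
  refine (integrable_prod_iff' hf).2 ⟨?_, ?_⟩
  · filter_upwards [hf.prod_swap.prodMk_left] with y hy
    obtain ⟨b, hb, h1, -⟩ := h y
    exact hb.mono' hy (Filter.Eventually.of_forall h1)
  · refine hg.mono' hf.norm.prod_swap.integral_prod_right' (Filter.Eventually.of_forall fun y => ?_)
    obtain ⟨b, hb, h1, h2⟩ := h y
    rw [Real.norm_of_nonneg (integral_nonneg fun x => norm_nonneg _)]
    exact (integral_mono_of_nonneg (Filter.Eventually.of_forall fun x => norm_nonneg _) hb
      (Filter.Eventually.of_forall h1)).trans h2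

/-- The weight is at least `1`, so that it can be divided out in `L²`. -/
theorem memLp_of_weight_mul {l : E → ℝ} (hl : IsFreqWeight l) {v : E → ℂ} (hv : Continuous v)
    (hv2 : MemLp (fun ξ => (l ξ : ℂ) * v ξ) 2 volume) : MemLp v 2 volume :=
  hv2.mono hv.aestronglyMeasurable (Filter.Eventually.of_forall fun ξ => by
    rw [norm_mul, Complex.norm_real, Real.norm_of_nonneg (hl.pos ξ).le]
    exact le_mul_of_one_le_left (norm_nonneg _) (by linarith [hl.large ξ]))

namespace IsOrderOne
variable {l : E → ℝ} {R C : ℝ} {G : E → E → ℂ} (hG : IsOrderOne l R C G) (hl : IsFreqWeight l)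
include hG hl

/-- The quadratic form of the operator converges absolutely, for functions with one more power of
the weight in `L²`. -/
theorem integrable_form {v : E → ℂ} (hv : Continuous v)
    (hv2 : MemLp (fun ξ => (l ξ : ℂ) * v ξ) 2 volume) (hv0 : MemLp v 2 volume) :
    Integrable (fun p : E × E => partialFourier G (p.1 - p.2) p.2 * (v p.2 * conj (v p.1)))
      (volume.prod volume) := by
  have hAc := hG.continuous_partialFourier
  refine (schur_form (w := fun κ : E => C * polyDecay κ) (integrable_polyDecay.const_mul C)
    (fun κ => mul_nonneg hG.nonneg (polyDecay_nonneg κ)) (fun κ => by rw [polyDecay_neg])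
    hv2 hv0 ?_ fun p => ?_).1
  · exact (by fun_prop : Continuous _).aestronglyMeasurable
  · rw [norm_mul, norm_mul, RCLike.norm_conj, norm_mul, Complex.norm_real,
      Real.norm_of_nonneg (hl.pos _).le]
    calc _ ≤ C * l p.2 * polyDecay (p.1 - p.2) * (‖v p.2‖ * ‖v p.1‖) := by
          gcongr; exact hG.norm_le _ _
      _ = _ := by ring

/-- Positivity of the symmetrized form, for one position `ζ` of the window: it is the integral over
the space of the nonnegative function `l ζ - c + Re G(x, ζ)`, multiplied by the square of the
modulus of the inverse Fourier transform of the windowed function. -/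
theorem symmetrized_form_nonneg {c : ℝ} (hc : ∀ x ζ, c ≤ l ζ + (G x ζ).re) {v : E → ℂ}
    (hv : Continuous v) (ζ : E) :
    0 ≤ (l ζ - c) * (∫ ξ, freqWindow l ξ ζ ^ 2 * ‖v ξ‖ ^ 2) +
      (∫ p : E × E, partialFourier G (p.1 - p.2) ζ *
        ((freqWindow l p.1 ζ * freqWindow l p.2 ζ : ℝ) : ℂ) * (v p.2 * conj (v p.1))
          ∂(volume.prod volume)).re := by
  set vz : E → ℂ := fun ξ => (freqWindow l ξ ζ : ℂ) * v ξ with hvz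
  have hF : Continuous fun ξ => freqWindow l ξ ζ :=
    hl.continuous_freqWindow.comp (by fun_prop : Continuous fun ξ : E => (ξ, ζ))
  have hvzc : Continuous vz := by fun_prop
  have hvzs : HasCompactSupport vz := by
    refine HasCompactSupport.mul_right ?_
    exact (hl.hasCompactSupport_freqWindow_left ζ).comp_left (g := fun x : ℝ => (x : ℂ)) (by simp)
  have hv1 : Integrable vz := hvzc.integrable_of_hasCompactSupport hvzs
  have hv2 : MemLp vz 2 volume := hvzc.memLp_of_hasCompactSupport hvzs
  have e1 := integral_mul_normSq_fourierInv (hG.integrable ζ) hv1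
  have e2 : ∫ ξ, freqWindow l ξ ζ ^ 2 * ‖v ξ‖ ^ 2 = ∫ x, ‖𝓕⁻ vz x‖ ^ 2 := by
    rw [Real.integral_norm_sq_fourierInv hv1 hv2]
    refine integral_congr_ae (Filter.Eventually.of_forall fun ξ => ?_)
    simp [vz, mul_pow]
  have e3 : ∫ p : E × E, partialFourier G (p.1 - p.2) ζ *
        ((freqWindow l p.1 ζ * freqWindow l p.2 ζ : ℝ) : ℂ) * (v p.2 * conj (v p.1))
          ∂(volume.prod volume) = ∫ x, G x ζ * (‖𝓕⁻ vz x‖ : ℂ) ^ 2 := by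
    rw [e1]
    refine integral_congr_ae (Filter.Eventually.of_forall fun p => ?_)
    simp only [partialFourier, vz, map_mul, Complex.conj_ofReal, Complex.ofReal_mul]
    ring
  have hm : MemLp (𝓕⁻ vz) 2 volume := by
    have := (Real.memLp_two_fourier hv1 hv2)
    have h2 : 𝓕⁻ vz = fun x => 𝓕 vz (-x) := funext fun x => Real.fourierInv_eq_fourier_neg _ _
    rw [h2]
    exact this.comp_measurePreserving (Measure.measurePreserving_neg volume)
  have hi : Integrable fun x => ‖𝓕⁻ vz x‖ ^ 2 := hm.integrable_norm_pow (by norm_num)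
  obtain ⟨B, hB⟩ := (hG.hasCompactSupport ζ).exists_bound_of_continuous
    (hG.cont.comp (by fun_prop : Continuous fun x : E => (x, ζ)))
  have hGi : Integrable fun x => G x ζ * (‖𝓕⁻ vz x‖ : ℂ) ^ 2 := by
    have h3 : Integrable fun x => ((‖𝓕⁻ vz x‖ ^ 2 : ℝ) : ℂ) := hi.ofReal
    have h4 := h3.bdd_mul (c := B) (f := fun x => G x ζ)
      ((hG.integrable ζ).1) (Filter.Eventually.of_forall hB)
    simpa using h4
  have e4 : (∫ x, G x ζ * (‖𝓕⁻ vz x‖ : ℂ) ^ 2).re = ∫ x, (G x ζ).re * ‖𝓕⁻ vz x‖ ^ 2 := by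
    have := integral_re hGi
    simp only [RCLike.re_eq_complex_re] at this
    rw [← this]
    refine integral_congr_ae (Filter.Eventually.of_forall fun x => ?_)
    simp only
    rw [← Complex.ofReal_pow, Complex.re_mul_ofReal]
  have hGr : Integrable fun x => (G x ζ).re * ‖𝓕⁻ vz x‖ ^ 2 := by
    refine hGi.re.congr (Filter.Eventually.of_forall fun x => ?_)
    simp only [RCLike.re_eq_complex_re]
    rw [← Complex.ofReal_pow, Complex.re_mul_ofReal]
  rw [e3, e4, e2, ← integral_const_mul, ← integral_add (hi.const_mul _) hGr]
  refine integral_nonneg fun x => ?_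
  have := hc x ζ
  rw [← add_mul]
  exact mul_nonneg (by linarith) (sq_nonneg _)

set_option maxHeartbeats 1000000 in
/-- The sharp Gårding inequality for the symbol `l + G`, in terms of the Fourier transform `v` of the
function: if the real part of the symbol is at least `c`, then so is that of the quadratic form, up
to a constant that depends only on the symbol estimates.  The forms with the kernel symmetrized by
windows are integrated over the position `ζ` of the window; their sum is nonnegative, and it differs
from the form of the operator by a bounded form. -/
theorem sharp_garding {c : ℝ} (hc : ∀ x ζ, c ≤ l ζ + (G x ζ).re) {v : E → ℂ}
    (hv : Continuous v) (hv2 : MemLp (fun ξ => (l ξ : ℂ) * v ξ) 2 volume) :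
    (c - (20 + 2 * (C * (2 + windowVar E)) * ∫ κ : E, polyDecay κ)) * ∫ ξ, ‖v ξ‖ ^ 2 ≤
      (∫ ξ, l ξ * ‖v ξ‖ ^ 2) +
        (∫ p : E × E, partialFourier G (p.1 - p.2) p.2 * (v p.2 * conj (v p.1))
          ∂(volume.prod volume)).re := by
  have hlc := hl.continuous
  have hFc := hl.continuous_freqWindow
  have hAc := hG.continuous_partialFourier
  have hC := hG.nonneg
  have hl1 : ∀ ξ, 1 ≤ l ξ := fun ξ => by linarith [hl.large ξ]
  have hnorm : ∀ ξ, ‖(l ξ : ℂ) * v ξ‖ = l ξ * ‖v ξ‖ := fun ξ => by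
    rw [norm_mul, Complex.norm_real, Real.norm_of_nonneg (hl.pos ξ).le]
  have hv0 : MemLp v 2 volume := memLp_of_weight_mul hl hv hv2
  have hi : Integrable fun ξ => ‖v ξ‖ ^ 2 := hv0.integrable_norm_pow (by norm_num)
  have hi2 : Integrable fun ξ => ‖(l ξ : ℂ) * v ξ‖ ^ 2 := hv2.integrable_norm_pow (by norm_num)
  have hil : Integrable fun ξ => l ξ * ‖v ξ‖ ^ 2 := by
    refine hi2.mono' (by fun_prop) (Filter.Eventually.of_forall fun ξ => ?_)
    rw [hnorm, Real.norm_of_nonneg (mul_nonneg (hl.pos ξ).le (sq_nonneg _)), mul_pow, sq (l ξ)]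
    gcongr
    exact le_mul_of_one_le_left (hl.pos ξ).le (hl1 ξ)
  have hw : Integrable fun κ : E => C * polyDecay κ := integrable_polyDecay.const_mul C
  have hw0 : ∀ κ : E, 0 ≤ C * polyDecay κ := fun κ => mul_nonneg hC (polyDecay_nonneg κ)
  have hwe : ∀ κ : E, C * polyDecay (-κ) = C * polyDecay κ := fun κ => by rw [polyDecay_neg]
  -- the part of the symmetrized form that comes from `l ζ - c`
  set D : E × E → ℝ := fun q => (l q.1 - c) * (freqWindow l q.2 q.1 ^ 2 * ‖v q.2‖ ^ 2) with hD
  have hDi : Integrable D (volume.prod volume) := by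
    refine integrable_prod_of_fiber_bound (by fun_prop : Continuous D).aestronglyMeasurable
      (g := fun ξ => 2 * (l ξ * ‖v ξ‖ ^ 2) + |c| * ‖v ξ‖ ^ 2)
      ((hil.const_mul 2).add (hi.const_mul |c|)) fun ξ => ?_
    have h1 := ((hl.integrable_weight_mul_freqWindow_sq ξ).add
      ((hl.integrable_freqWindow_sq ξ).const_mul |c|)).mul_const (‖v ξ‖ ^ 2)
    refine ⟨_, h1, fun ζ => ?_, ?_⟩
    · simp only [hD, norm_mul, norm_pow, Real.norm_eq_abs, sq_abs, abs_norm, Pi.add_apply]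
      rw [← mul_assoc, ← add_mul]
      gcongr
      refine (abs_sub _ _).trans ?_
      rw [abs_of_pos (hl.pos ζ)]
    · simp only [Pi.add_apply]
      rw [integral_mul_const, integral_add (hl.integrable_weight_mul_freqWindow_sq ξ)
        ((hl.integrable_freqWindow_sq ξ).const_mul _), integral_const_mul,
        hl.integral_freqWindow_sq, mul_one, add_mul, ← mul_assoc]
      gcongr
      exact hl.integral_weight_mul_freqWindow_sq_le ξ
  -- the part of the symmetrized form that comes from `G`
  set K : E × (E × E) → ℂ := fun q => partialFourier G (q.2.1 - q.2.2) q.1 *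
    ((freqWindow l q.2.1 q.1 * freqWindow l q.2.2 q.1 : ℝ) : ℂ) * (v q.2.2 * conj (v q.2.1)) with hK
  have hKi : Integrable K (volume.prod (volume.prod volume)) := by
    have hg : Integrable (fun p : E × E => ((C * polyDecay (p.1 - p.2) *
        (‖(l p.2 : ℂ) * v p.2‖ * ‖(l p.1 : ℂ) * v p.1‖) : ℝ) : ℂ)) (volume.prod volume) := by
      refine (schur_form hw hw0 hwe hv2 hv2 ?_ fun p => ?_).1
      · have := continuous_polyDecay (E := E)
        exact Continuous.aestronglyMeasurable (by fun_prop)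
      · rw [Complex.norm_real, Real.norm_of_nonneg]
        have := hw0 (p.1 - p.2)
        positivity
    have hKc : Continuous K := by
      have a1 : Continuous fun q : E × (E × E) => partialFourier G (q.2.1 - q.2.2) q.1 :=
        hAc.comp (by fun_prop : Continuous fun q : E × (E × E) => (q.2.1 - q.2.2, q.1))
      have a2 : Continuous fun q : E × (E × E) => freqWindow l q.2.1 q.1 :=
        hFc.comp (by fun_prop : Continuous fun q : E × (E × E) => (q.2.1, q.1))
      have a3 : Continuous fun q : E × (E × E) => freqWindow l q.2.2 q.1 :=
        hFc.comp (by fun_prop : Continuous fun q : E × (E × E) => (q.2.2, q.1))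
      fun_prop
    refine integrable_prod_of_fiber_bound hKc.aestronglyMeasurable
      (g := fun p : E × E => C * polyDecay (p.1 - p.2) *
        (‖(l p.2 : ℂ) * v p.2‖ * ‖(l p.1 : ℂ) * v p.1‖)) ?_ fun p => ?_
    · simpa using hg.re
    have h1 := ((hl.integrable_weight_mul_freqWindow_sq p.1).add
      (hl.integrable_weight_mul_freqWindow_sq p.2)).const_mul
        (C * polyDecay (p.1 - p.2) * (‖v p.2‖ * ‖v p.1‖) / 2)
    refine ⟨_, h1, fun ζ => ?_, ?_⟩
    · simp only [hK, norm_mul, RCLike.norm_conj, Complex.norm_real, Pi.add_apply, Real.norm_eq_abs,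
        Complex.ofReal_mul]
      set f := freqWindow l p.1 ζ
      set f' := freqWindow l p.2 ζ
      have h2 : |f| * |f'| ≤ (f ^ 2 + f' ^ 2) / 2 := by
        rw [← sq_abs f, ← sq_abs f']; nlinarith [sq_nonneg (|f| - |f'|)]
      calc _ ≤ C * l ζ * polyDecay (p.1 - p.2) * ((f ^ 2 + f' ^ 2) / 2) *
            (‖v p.2‖ * ‖v p.1‖) := by
            have := hl.pos ζ
            have := polyDecay_nonneg (p.1 - p.2)
            gcongr
            exact hG.norm_le _ _
        _ = _ := by ring
    · simp only [Pi.add_apply]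
      rw [integral_const_mul, integral_add (hl.integrable_weight_mul_freqWindow_sq p.1)
        (hl.integrable_weight_mul_freqWindow_sq p.2), hnorm, hnorm]
      have b1 := hl.integral_weight_mul_freqWindow_sq_le p.1
      have b2 := hl.integral_weight_mul_freqWindow_sq_le p.2
      have b3 : l p.1 + l p.2 ≤ l p.1 * l p.2 := by
        nlinarith [hl.large p.1, hl.large p.2]
      have := hw0 (p.1 - p.2)
      calc _ ≤ C * polyDecay (p.1 - p.2) * (‖v p.2‖ * ‖v p.1‖) / 2 * (2 * (l p.1 * l p.2)) := by
            gcongr; linarith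
        _ = _ := by ring
  -- positivity, one position of the window at a time
  have hP : 0 ≤ (∫ ζ, ∫ ξ, D (ζ, ξ)) + (∫ ζ, ∫ p, K (ζ, p) ∂(volume.prod volume)).re := by
    have h1 := integral_re hKi.integral_prod_left
    simp only [RCLike.re_eq_complex_re] at h1
    have h2 : Integrable fun ζ => (∫ p, K (ζ, p) ∂(volume.prod volume)).re :=
      hKi.integral_prod_left.re
    rw [← h1, ← integral_add hDi.integral_prod_left h2]
    refine integral_nonneg fun ζ => ?_
    have := hG.symmetrized_form_nonneg hl hc hv ζ
    simp only [hD, hK, integral_const_mul]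
    exact this
  have hD2 : ∫ ζ, ∫ ξ, D (ζ, ξ) ≤ ∫ ξ, (l ξ + 20 - c) * ‖v ξ‖ ^ 2 := by
    rw [integral_integral_swap hDi]
    refine integral_mono hDi.integral_prod_right ?_ fun ξ => ?_
    · have := hil.add (hi.const_mul (20 - c))
      refine this.congr (Filter.Eventually.of_forall fun ξ => ?_)
      simp only [Pi.add_apply]; ring
    · have e : ∫ ζ, D (ζ, ξ) = ((∫ ζ, l ζ * freqWindow l ξ ζ ^ 2) - c) * ‖v ξ‖ ^ 2 := by
        have : ∀ ζ, D (ζ, ξ) = (l ζ * freqWindow l ξ ζ ^ 2 - c * freqWindow l ξ ζ ^ 2) * ‖v ξ‖ ^ 2 :=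
          fun ζ => by simp only [hD]; ring
        simp_rw [this]
        rw [integral_mul_const, integral_sub (hl.integrable_weight_mul_freqWindow_sq ξ)
          ((hl.integrable_freqWindow_sq ξ).const_mul _), integral_const_mul,
          hl.integral_freqWindow_sq, mul_one]
      simp only [e]
      gcongr
      exact hl.integral_weight_mul_freqWindow_sq_le_add ξ
  set k0 : E × E → ℂ := fun p => partialFourier G (p.1 - p.2) p.2 * (v p.2 * conj (v p.1)) with hk0
  have hk0i : Integrable k0 (volume.prod volume) := hG.integrable_form hl hv hv2 hv0
  set k1 : E × E → ℂ := fun p => ∫ ζ, K (ζ, p) with hk1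
  have hk1i : Integrable k1 (volume.prod volume) := hKi.integral_prod_right
  have hk1e : ∀ p, k1 p = (∫ ζ, partialFourier G (p.1 - p.2) ζ *
      ((freqWindow l p.1 ζ * freqWindow l p.2 ζ : ℝ) : ℂ)) * (v p.2 * conj (v p.1)) := fun p => by
    simp only [hk1, hK, integral_mul_const]
  -- the error is a bounded form, by the Schur test
  have hdiff : ‖∫ p, (k0 p - k1 p) ∂(volume.prod volume)‖ ≤
      2 * (C * (2 + windowVar E)) * (∫ κ : E, polyDecay κ) * ∫ ξ, ‖v ξ‖ ^ 2 := by
    have := (schur_form (w := fun κ : E => C * (2 + windowVar E) * polyDecay κ)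
      (integrable_polyDecay.const_mul _)
      (fun κ => by have := polyDecay_nonneg κ; have := windowVar_pos (E := E); positivity)
      (fun κ => by rw [polyDecay_neg]) hv0 hv0 (hk0i.sub hk1i).1 fun p => ?_).2
    · refine this.trans (le_of_eq ?_)
      rw [integral_const_mul]; ring
    · rw [Pi.sub_apply, hk1e, hk0, ← sub_mul, norm_mul, norm_mul, RCLike.norm_conj]
      gcongr
      exact hG.norm_kernel_sub_le hl _ _
  have hsplit : (∫ p, k0 p ∂(volume.prod volume)).re = (∫ p, (k0 p - k1 p) ∂(volume.prod volume)).re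
      + (∫ ζ, ∫ p, K (ζ, p) ∂(volume.prod volume)).re := by
    have hs : ∫ ζ, ∫ p, K (ζ, p) ∂(volume.prod volume) = ∫ p, k1 p ∂(volume.prod volume) :=
      integral_integral_swap (f := fun ζ p => K (ζ, p)) hKi
    rw [integral_sub hk0i hk1i, hs, Complex.sub_re]
    ring
  have hre := (abs_le.1 ((Complex.abs_re_le_norm _).trans hdiff)).1
  have hD3 : ∫ ξ, (l ξ + 20 - c) * ‖v ξ‖ ^ 2 =
      (∫ ξ, l ξ * ‖v ξ‖ ^ 2) + (20 - c) * ∫ ξ, ‖v ξ‖ ^ 2 := by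
    rw [← integral_const_mul, ← integral_add hil (hi.const_mul _)]
    refine integral_congr_ae (Filter.Eventually.of_forall fun ξ => ?_)
    simp only; ring
  rw [hsplit]
  linarith

end IsOrderOne
end Garding

/-! ### The operator on a slice -/

section SliceOperator
set_option linter.unusedSectionVars false
variable {E : Type*} [NormedAddCommGroup E] [InnerProductSpace ℝ E] [FiniteDimensional ℝ E]
  [MeasurableSpace E] [BorelSpace E]

theorem MeasureTheory.MemLp.ofReal_integral_norm_sq {α F : Type*} [MeasurableSpace α]
    [NormedAddCommGroup F] {μ : Measure α} {f : α → F} (hf : MemLp f 2 μ) :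
    ENNReal.ofReal (∫ x, ‖f x‖ ^ 2 ∂μ) = ∫⁻ x, ‖f x‖ₑ ^ 2 ∂μ := by
  rw [ofReal_integral_eq_lintegral_ofReal (hf.integrable_norm_pow (by norm_num))
    (Filter.Eventually.of_forall fun _ => sq_nonneg _)]
  refine lintegral_congr fun x => ?_
  rw [ENNReal.ofReal_pow (norm_nonneg _), ofReal_norm]

/-- The operator of symbol `1 + G / l`, for the normalization `x ↦ exp (2πi k·x)` of characters. -/
noncomputable def sliceOp (l : E → ℝ) (G : E → E → ℂ) (f : E → ℂ) (x : E) : ℂ :=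
  ∫ k, Real.fourierChar (inner ℝ k x) • ((1 + G x k / l k) * 𝓕 f k)

/-- The operator of symbol `G / l`. -/
noncomputable def sliceRem (l : E → ℝ) (G : E → E → ℂ) (f : E → ℂ) (x : E) : ℂ :=
  ∫ k, Real.fourierChar (inner ℝ k x) • (G x k * (𝓕 f k / l k))

namespace IsOrderOne
variable {l : E → ℝ} {R C : ℝ} {G : E → E → ℂ} (hG : IsOrderOne l R C G) (hl : IsFreqWeight l)
include hG hl

theorem integrable_sliceRem_integrand (f : SchwartzMap E ℂ) :
    Integrable (fun q : E × E => Real.fourierChar (inner ℝ q.2 q.1) •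
      (G q.1 q.2 * (𝓕 f q.2 / l q.2))) (volume.prod volume) := by
  have hlc := hl.continuous
  have hGc : Continuous fun q : E × E => G q.1 q.2 := hG.cont
  have hch := Real.continuous_fourierChar
  have hfc : Continuous fun k => (𝓕 f : SchwartzMap E ℂ) k := (𝓕 f).continuous
  have h1 : Integrable (fun q : E × E => (Metric.closedBall (0 : E) R).indicator
      (fun _ => C) q.1 * ‖𝓕 f q.2‖) (volume.prod volume) := by
    refine Integrable.mul_prod (f := (Metric.closedBall (0 : E) R).indicator
      (fun _ => C)) (g := fun k => ‖𝓕 f k‖) ?_ (𝓕 f).integrable.norm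
    exact (integrable_indicator_iff Metric.isClosed_closedBall.measurableSet).2
      (integrableOn_const measure_closedBall_lt_top.ne)
  refine h1.mono' ?_ (Filter.Eventually.of_forall fun q => ?_)
  · refine Continuous.aestronglyMeasurable ?_
    simp only [Circle.smul_def, smul_eq_mul]
    refine Continuous.mul (by fun_prop) (Continuous.mul hGc (Continuous.div₀ (by fun_prop)
      (by fun_prop) fun q => ?_))
    exact_mod_cast (hl.pos _).ne'
  · rw [Circle.norm_smul, norm_mul, norm_div, Complex.norm_real,
      Real.norm_of_nonneg (hl.pos _).le]
    by_cases hq : q.1 ∈ Metric.closedBall (0 : E) R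
    · rw [Set.indicator_of_mem hq]
      calc _ ≤ C * l q.2 * (‖𝓕 f q.2‖ / l q.2) := by
            have := hl.pos q.2
            gcongr
            exact hG.bdd _ _
        _ = _ := by field_simp [(hl.pos q.2).ne']
    · rw [Set.indicator_of_notMem hq]
      rw [mem_closedBall_zero_iff, not_le] at hq
      simp [hG.supp _ _ hq]

theorem sliceOp_eq (f : SchwartzMap E ℂ) (x : E) : sliceOp l G f x = f x + sliceRem l G f x := by
  have hlc := hl.continuous
  have hGc : Continuous fun k : E => G x k :=
    hG.cont.comp (by fun_prop : Continuous fun k : E => (x, k))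
  have hch := Real.continuous_fourierChar
  have hfc : Continuous fun k => (𝓕 f : SchwartzMap E ℂ) k := (𝓕 f).continuous
  have h0 : 𝓕⁻ (𝓕 (f : E → ℂ)) x = f x := by
    have := f.continuous.fourierInv_fourier_eq f.integrable
      (by rw [← SchwartzMap.fourier_coe]; exact (𝓕 f).integrable)
    rw [this]
  rw [← h0, Real.fourierInv_eq]
  unfold sliceOp sliceRem
  rw [← integral_add]
  · refine integral_congr_ae (Filter.Eventually.of_forall fun k => ?_)
    simp only [Circle.smul_def, smul_eq_mul]
    ring
  · refine (𝓕 f).integrable.norm.mono' ?_ (Filter.Eventually.of_forall fun k => ?_)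
    · rw [← SchwartzMap.fourier_coe]
      simp only [Circle.smul_def, smul_eq_mul]
      exact Continuous.aestronglyMeasurable (by fun_prop)
    · rw [Circle.norm_smul, SchwartzMap.fourier_coe]
  · refine ((𝓕 f).integrable.norm.const_mul C).mono' ?_ (Filter.Eventually.of_forall fun k => ?_)
    · rw [← SchwartzMap.fourier_coe]
      refine Continuous.aestronglyMeasurable ?_
      simp only [Circle.smul_def, smul_eq_mul]
      refine Continuous.mul (by fun_prop) (Continuous.mul hGc (Continuous.div₀ (by fun_prop)
        (by fun_prop) fun q => ?_))
      exact_mod_cast (hl.pos _).ne'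
    · rw [Circle.norm_smul, norm_mul, norm_div, Complex.norm_real,
        Real.norm_of_nonneg (hl.pos _).le, SchwartzMap.fourier_coe]
      calc _ ≤ C * l k * (‖𝓕 (f : E → ℂ) k‖ / l k) := by
            have := hl.pos k
            gcongr
            exact hG.bdd _ _
        _ = _ := by field_simp [(hl.pos k).ne']

theorem integrable_sliceRem (f : SchwartzMap E ℂ) : Integrable (sliceRem l G f) :=
  (hG.integrable_sliceRem_integrand hl f).integral_prod_left

theorem memLp_sliceRem (f : SchwartzMap E ℂ) : MemLp (sliceRem l G f) 2 volume := by
  have hi := hG.integrable_sliceRem hl f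
  rw [memLp_two_iff_integrable_sq_norm hi.1]
  have hb : ∀ x, ‖sliceRem l G f x‖ ≤ C * ∫ k, ‖𝓕 f k‖ := by
    intro x
    rw [← integral_const_mul]
    refine norm_integral_le_of_norm_le ((𝓕 f).integrable.norm.const_mul C)
      (Filter.Eventually.of_forall fun k => ?_)
    rw [Circle.norm_smul, norm_mul, norm_div, Complex.norm_real,
        Real.norm_of_nonneg (hl.pos _).le, SchwartzMap.fourier_coe]
    calc _ ≤ C * l k * (‖𝓕 (f : E → ℂ) k‖ / l k) := by
          have := hl.pos k
          gcongr
          exact hG.bdd _ _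
      _ = _ := by field_simp [(hl.pos k).ne']
  refine (hi.norm.const_mul (C * ∫ k, ‖𝓕 f k‖)).mono' (hi.1.norm.pow 2)
    (Filter.Eventually.of_forall fun x => ?_)
  rw [norm_pow, norm_norm, sq]
  gcongr
  exact hb x

/-- On the Fourier side the operator acts by the kernel given by the partial Fourier transform of its
symbol. -/
theorem fourier_sliceRem (f : SchwartzMap E ℂ) (ξ : E) :
    𝓕 (sliceRem l G f) ξ = ∫ k, partialFourier G (ξ - k) k * (𝓕 f k / l k) := by
  have hi := hG.integrable_sliceRem_integrand hl f
  set Φ : E → E → ℂ := fun x k => Real.fourierChar (-(inner ℝ x (ξ - k))) •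
    (G x k * (𝓕 f k / l k)) with hΦ
  have hch := Real.continuous_fourierChar
  have e0 : ∀ x k, Φ x k = (Real.fourierChar (-(inner ℝ x ξ)) : ℂ) *
      (Real.fourierChar (inner ℝ k x) • (G x k * (𝓕 f k / l k))) := by
    intro x k
    have : -(inner ℝ x (ξ - k)) = -(inner ℝ x ξ) + inner ℝ k x := by
      rw [inner_sub_right, real_inner_comm x k]; ring
    simp only [hΦ, this, Circle.smul_def, AddChar.map_add_eq_mul, Circle.coe_mul, smul_eq_mul]
    ring
  have hΦi : Integrable (Function.uncurry Φ) (volume.prod volume) := by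
    have : Function.uncurry Φ = fun q : E × E => (Real.fourierChar (-(inner ℝ q.1 ξ)) : ℂ) *
      (Real.fourierChar (inner ℝ q.2 q.1) • (G q.1 q.2 * (𝓕 f q.2 / l q.2))) :=
      funext fun q => e0 q.1 q.2
    rw [this]
    refine hi.bdd_mul (c := 1) ?_ (Filter.Eventually.of_forall fun q => by simp [Circle.norm_coe])
    exact (by fun_prop : Continuous _).aestronglyMeasurable
  have e1 : 𝓕 (sliceRem l G f) ξ = ∫ x, ∫ k, Φ x k := by
    rw [Real.fourier_eq]
    refine integral_congr_ae (Filter.Eventually.of_forall fun x => ?_)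
    simp only [e0, integral_const_mul, Circle.smul_def, smul_eq_mul, sliceRem, SchwartzMap.fourier_coe]
  rw [e1, integral_integral_swap hΦi]
  refine integral_congr_ae (Filter.Eventually.of_forall fun k => ?_)
  simp only [partialFourier, Real.fourier_eq]
  rw [← integral_mul_const]
  refine integral_congr_ae (Filter.Eventually.of_forall fun x => ?_)
  simp only [hΦ, Circle.smul_def, smul_eq_mul]
  ring

theorem memLp_sliceOp (f : SchwartzMap E ℂ) : MemLp (sliceOp l G f) 2 volume := by
  rw [show sliceOp l G f = (f : E → ℂ) + sliceRem l G f from funext (hG.sliceOp_eq hl f)]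
  exact (f.memLp 2).add (hG.memLp_sliceRem hl f)

/-- `L²` boundedness of the operator, with a constant depending only on the symbol estimates. -/
theorem integral_sliceOp_sq_le (f : SchwartzMap E ℂ) :
    ∫ x, ‖sliceOp l G f x‖ ^ 2 ≤
      (2 + 2 * (C * ∫ κ : E, polyDecay κ) ^ 2) * ∫ x, ‖f x‖ ^ 2 := by
  have hr1 := hG.integrable_sliceRem hl f
  have hr2 := hG.memLp_sliceRem hl f
  have hf2 : MemLp f 2 volume := f.memLp 2
  have hF2 : MemLp (𝓕 (f : E → ℂ)) 2 volume := Real.memLp_two_fourier f.integrable hf2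
  have hir : Integrable fun x => ‖sliceRem l G f x‖ ^ 2 := hr2.integrable_norm_pow (by norm_num)
  have hif : Integrable fun x => ‖f x‖ ^ 2 := hf2.integrable_norm_pow (by norm_num)
  have hC := hG.nonneg
  have hint0 : 0 ≤ ∫ κ : E, polyDecay κ := integral_nonneg polyDecay_nonneg
  have hpd := continuous_polyDecay (E := E)
  have hFc : Continuous (𝓕 (f : E → ℂ)) := Real.continuous_fourier_of_integrable f.integrable
  have hrem : ∫ x, ‖sliceRem l G f x‖ ^ 2 ≤ (C * ∫ κ : E, polyDecay κ) ^ 2 * ∫ x, ‖f x‖ ^ 2 := by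
    rw [← Real.integral_norm_sq_fourier hr1 hr2, ← Real.integral_norm_sq_fourier f.integrable hf2]
    have hpt : ∀ ξ, ‖𝓕 (sliceRem l G f) ξ‖ₑ ≤
        ∫⁻ k, ENNReal.ofReal (C * polyDecay (ξ - k)) * ‖𝓕 (f : E → ℂ) k‖ₑ := by
      intro ξ
      rw [hG.fourier_sliceRem hl]
      refine (enorm_integral_le_lintegral_enorm _).trans (lintegral_mono fun k => ?_)
      rw [← ofReal_norm, ← ofReal_norm, ← ENNReal.ofReal_mul
        (mul_nonneg hC (polyDecay_nonneg _))]
      refine ENNReal.ofReal_le_ofReal ?_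
      rw [norm_mul, norm_div, Complex.norm_real, Real.norm_of_nonneg (hl.pos _).le,
        SchwartzMap.fourier_coe]
      calc _ ≤ C * l k * polyDecay (ξ - k) * (‖𝓕 (f : E → ℂ) k‖ / l k) := by
            have := hl.pos k
            gcongr
            exact hG.norm_le _ _
        _ = _ := by field_simp [(hl.pos k).ne']
    rw [← ENNReal.ofReal_le_ofReal_iff (by positivity),
      (Real.memLp_two_fourier hr1 hr2).ofReal_integral_norm_sq, ENNReal.ofReal_mul (by positivity),
      hF2.ofReal_integral_norm_sq]
    refine (lintegral_mono fun ξ => pow_le_pow_left₀ (by positivity) (hpt ξ) 2).trans ?_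
    refine (lintegral_convolution_sq_le (w := fun κ => ENNReal.ofReal (C * polyDecay κ))
      (a := fun k => ‖𝓕 (f : E → ℂ) k‖ₑ) (by fun_prop) (by fun_prop)).trans (le_of_eq ?_)
    rw [← ofReal_integral_eq_lintegral_ofReal (integrable_polyDecay.const_mul C)
      (Filter.Eventually.of_forall fun κ => mul_nonneg hC (polyDecay_nonneg κ)),
      integral_const_mul, ENNReal.ofReal_pow (by positivity)]
  have h1 : ∫ x, ‖sliceOp l G f x‖ ^ 2 ≤ ∫ x, (2 * ‖f x‖ ^ 2 + 2 * ‖sliceRem l G f x‖ ^ 2) := by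
    refine integral_mono ((hG.memLp_sliceOp hl f).integrable_norm_pow (by norm_num))
      ((hif.const_mul 2).add (hir.const_mul 2)) fun x => ?_
    simp only [hG.sliceOp_eq hl f]
    have := norm_add_le (f x) (sliceRem l G f x)
    calc _ ≤ (‖f x‖ + ‖sliceRem l G f x‖) ^ 2 := by gcongr
      _ ≤ _ := by nlinarith [sq_nonneg (‖f x‖ - ‖sliceRem l G f x‖)]
  rw [integral_add (hif.const_mul 2) (hir.const_mul 2), integral_const_mul,
    integral_const_mul] at h1
  linarith

/-- The operator controls the norm of order `-1`.  With `v` the Fourier transform of `f` divided by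
the weight, the pairing of `v` with the Fourier transform of the image of `f` is the quadratic form
of the symbol `l + G` of order one at `v`, to which the sharp Gårding inequality applies. -/
theorem integral_fourier_div_sq_le (f : SchwartzMap E ℂ) {c : ℝ}
    (hc : ∀ x ζ, c ≤ l ζ + (G x ζ).re)
    (hcC : 20 + 2 * (C * (2 + windowVar E)) * (∫ κ : E, polyDecay κ) ≤ c / 2) :
    (c / 2) ^ 2 * ∫ ξ, ‖𝓕 (f : E → ℂ) ξ‖ ^ 2 / l ξ ^ 2 ≤ ∫ x, ‖sliceOp l G f x‖ ^ 2 := by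
  have hlc := hl.continuous
  have hl0 : ∀ ξ, (l ξ : ℂ) ≠ 0 := fun ξ => by exact_mod_cast (hl.pos ξ).ne'
  have hr1 := hG.integrable_sliceRem hl f
  have hr2 := hG.memLp_sliceRem hl f
  have hf2 : MemLp f 2 volume := f.memLp 2
  have hFc : Continuous (𝓕 (f : E → ℂ)) := Real.continuous_fourier_of_integrable f.integrable
  set T : E → ℂ := sliceOp l G f with hT
  have hTe : T = (f : E → ℂ) + sliceRem l G f := funext (hG.sliceOp_eq hl f)
  have hT1 : Integrable T := by rw [hTe]; exact f.integrable.add hr1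
  have hT2 : MemLp T 2 volume := hG.memLp_sliceOp hl f
  have hFT2 := Real.memLp_two_fourier hT1 hT2
  set v : E → ℂ := fun ξ => 𝓕 (f : E → ℂ) ξ / l ξ with hv
  have hvc : Continuous v := Continuous.div₀ hFc (by fun_prop) hl0
  have hlv : (fun ξ => (l ξ : ℂ) * v ξ) = 𝓕 (f : E → ℂ) := funext fun ξ => by
    simp only [hv]; rw [mul_div_cancel₀ _ (hl0 ξ)]
  have hv2 : MemLp (fun ξ => (l ξ : ℂ) * v ξ) 2 volume := by
    rw [hlv]; exact Real.memLp_two_fourier f.integrable hf2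
  have hv0 : MemLp v 2 volume := memLp_of_weight_mul hl hvc hv2
  have hvi : Integrable fun ξ => ‖v ξ‖ ^ 2 := hv0.integrable_norm_pow (by norm_num)
  have hTi : Integrable fun ξ => ‖𝓕 T ξ‖ ^ 2 := hFT2.integrable_norm_pow (by norm_num)
  have hFTe : ∀ ξ, 𝓕 T ξ = l ξ * v ξ + ∫ k, partialFourier G (ξ - k) k * v k := by
    intro ξ
    have h1 : 𝓕 T ξ = 𝓕 (f : E → ℂ) ξ + 𝓕 (sliceRem l G f) ξ := by
      rw [hTe]
      simp only [Real.fourier_eq, Pi.add_apply, smul_add]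
      exact integral_add ((Real.fourierIntegral_convergent_iff ξ).2 f.integrable)
        ((Real.fourierIntegral_convergent_iff ξ).2 hr1)
    rw [h1, hG.fourier_sliceRem hl, ← congrFun hlv ξ]
    simp only [hv, SchwartzMap.fourier_coe]
  have hform := hG.integrable_form hl hvc hv2 hv0
  have hlvi : Integrable fun ξ => l ξ * ‖v ξ‖ ^ 2 := by
    have := hv2.integrable_mul hv0.star
    refine this.norm.congr (Filter.Eventually.of_forall fun ξ => ?_)
    simp only [Pi.mul_apply, Pi.star_apply, norm_mul, norm_star, Complex.norm_real,
      Real.norm_of_nonneg (hl.pos ξ).le]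
    ring
  -- the pairing of the image of `f` with `v` is the quadratic form of `l + G`
  have hpair : (∫ ξ, 𝓕 T ξ * conj (v ξ)).re = (∫ ξ, l ξ * ‖v ξ‖ ^ 2) +
      (∫ p : E × E, partialFourier G (p.1 - p.2) p.2 * (v p.2 * conj (v p.1))
          ∂(volume.prod volume)).re := by
    rw [integral_prod _ hform]
    have e1 : ∀ ξ, 𝓕 T ξ * conj (v ξ) = ((l ξ * ‖v ξ‖ ^ 2 : ℝ) : ℂ) +
        ∫ k, partialFourier G (ξ - k) k * (v k * conj (v ξ)) := by
      intro ξ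
      rw [hFTe, add_mul, ← integral_mul_const, mul_assoc, Complex.mul_conj']
      simp only [mul_assoc, Complex.ofReal_mul, Complex.ofReal_pow]
    simp_rw [e1]
    have h2 : Integrable fun ξ => ∫ k, partialFourier G (ξ - k) k * (v k * conj (v ξ)) :=
      hform.integral_prod_left
    have h1 : Integrable fun ξ => ((l ξ * ‖v ξ‖ ^ 2 : ℝ) : ℂ) := hlvi.ofReal
    rw [integral_add h1 h2, Complex.add_re, integral_complex_ofReal, Complex.ofReal_re]
  have hgard := hG.sharp_garding hl hc hvc hv2
  rw [← hpair] at hgard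
  have hvn : 0 ≤ ∫ ξ, ‖v ξ‖ ^ 2 := integral_nonneg fun _ => sq_nonneg _
  have hwp := windowVar_pos (E := E)
  have hint0 : 0 ≤ ∫ κ : E, polyDecay κ := integral_nonneg polyDecay_nonneg
  have hC := hG.nonneg
  have hc0 : 0 < c / 2 := by
    have : 0 ≤ 2 * (C * (2 + windowVar E)) * (∫ κ : E, polyDecay κ) := by positivity
    linarith
  have hyoung : (∫ ξ, 𝓕 T ξ * conj (v ξ)).re ≤
      (c / 2) / 2 * (∫ ξ, ‖v ξ‖ ^ 2) + (1 / (2 * (c / 2))) * ∫ ξ, ‖𝓕 T ξ‖ ^ 2 := by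
    refine (Complex.re_le_norm _).trans ?_
    rw [← integral_const_mul, ← integral_const_mul,
      ← integral_add (hvi.const_mul _) (hTi.const_mul _)]
    refine norm_integral_le_of_norm_le ((hvi.const_mul _).add (hTi.const_mul _))
      (Filter.Eventually.of_forall fun ξ => ?_)
    rw [norm_mul, RCLike.norm_conj]
    have := sq_nonneg ((c / 2) * ‖v ξ‖ - ‖𝓕 T ξ‖)
    rw [show (c / 2) / 2 * ‖v ξ‖ ^ 2 + (1 / (2 * (c / 2))) * ‖𝓕 T ξ‖ ^ 2
      = (1 / (2 * (c / 2))) * ((c / 2) ^ 2 * ‖v ξ‖ ^ 2 + ‖𝓕 T ξ‖ ^ 2) by field_simp]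
    rw [one_div, inv_mul_eq_div, le_div_iff₀ (by positivity)]
    nlinarith
  have hplanch := Real.integral_norm_sq_fourier hT1 hT2
  have hve : ∀ ξ, ‖𝓕 (f : E → ℂ) ξ‖ ^ 2 / l ξ ^ 2 = ‖v ξ‖ ^ 2 := fun ξ => by
    simp only [hv, norm_div, Complex.norm_real, Real.norm_of_nonneg (hl.pos ξ).le, div_pow]
  simp_rw [hve]
  rw [← hplanch]
  have h3 : (c / 2) * ∫ ξ, ‖v ξ‖ ^ 2 ≤ (∫ ξ, 𝓕 T ξ * conj (v ξ)).re := by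
    refine le_trans ?_ hgard
    gcongr
    linarith
  have h4 : (c / 2) / 2 * (∫ ξ, ‖v ξ‖ ^ 2) ≤ (1 / (2 * (c / 2))) * ∫ ξ, ‖𝓕 T ξ‖ ^ 2 := by linarith
  rw [one_div, inv_mul_eq_div, le_div_iff₀ (by positivity)] at h4
  linarith

end IsOrderOne
end SliceOperator

/-! ### Fourier decay and differences of smooth functions -/

section SymbolBounds
set_option linter.unusedSectionVars false
variable {E : Type*} [NormedAddCommGroup E] [InnerProductSpace ℝ E] [FiniteDimensional ℝ E]
  [MeasurableSpace E] [BorelSpace E]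

/-- Decay of the Fourier transform of a smooth function supported in a ball. -/
theorem exists_fourier_decay (E : Type*) [NormedAddCommGroup E] [InnerProductSpace ℝ E]
    [FiniteDimensional ℝ E] [MeasurableSpace E] [BorelSpace E] (R : ℝ) :
    ∃ D : ℝ, 0 ≤ D ∧ ∀ (f : E → ℂ) (B : ℝ), ContDiff ℝ ∞ f → (∀ x, R < ‖x‖ → f x = 0) →
      (∀ i ≤ finrank ℝ E + 3, ∀ x, ‖iteratedFDeriv ℝ i f x‖ ≤ B) →
      ∀ κ, ‖𝓕 f κ‖ * (1 + ‖κ‖) ^ 2 ≤ D * B * polyDecay κ := by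
  set N := finrank ℝ E + 3 with hN
  set vol := volume.real (Metric.closedBall (0 : E) R) with hvol
  have hvol0 : 0 ≤ vol := measureReal_nonneg
  refine ⟨2 ^ N * (vol + 2 ^ N * ((N + 1) * vol)), by positivity, fun f B hf hs hB κ => ?_⟩
  have hB0 : 0 ≤ B := (norm_nonneg _).trans (hB 0 (Nat.zero_le _) 0)
  have hsupp : tsupport f ⊆ Metric.closedBall (0 : E) R := by
    refine closure_minimal (fun x hx => ?_) Metric.isClosed_closedBall
    rw [mem_closedBall_zero_iff]
    by_contra h
    exact hx (hs x (not_le.1 h))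
  have hcs : HasCompactSupport f :=
    HasCompactSupport.of_support_subset_isCompact (isCompact_closedBall (0 : E) R)
      ((subset_tsupport f).trans hsupp)
  have hDs : ∀ i x, x ∉ Metric.closedBall (0 : E) R → iteratedFDeriv ℝ i f x = 0 := by
    intro i x hx
    by_contra h
    exact hx (hsupp (support_iteratedFDeriv_subset i (𝕜 := ℝ) h))
  have hcont : ∀ i, Continuous fun x => iteratedFDeriv ℝ i f x := fun i =>
    hf.continuous_iteratedFDeriv (by exact_mod_cast le_top)
  have hint : ∀ i, Integrable fun x => ‖iteratedFDeriv ℝ i f x‖ := fun i =>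
    ((hcont i).integrable_of_hasCompactSupport (hcs.iteratedFDeriv i)).norm
  have hval : ∀ i ≤ N, ∫ x, ‖iteratedFDeriv ℝ i f x‖ ≤ vol * B := by
    intro i hi
    have hind : Integrable ((Metric.closedBall (0 : E) R).indicator fun _ => B) :=
      (integrable_indicator_iff Metric.isClosed_closedBall.measurableSet).2
        (integrableOn_const measure_closedBall_lt_top.ne)
    calc ∫ x, ‖iteratedFDeriv ℝ i f x‖
        ≤ ∫ x, (Metric.closedBall (0 : E) R).indicator (fun _ => B) x := by
          refine integral_mono (hint i) hind fun x => ?_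
          by_cases hx : x ∈ Metric.closedBall (0 : E) R
          · rw [Set.indicator_of_mem hx]; exact hB i hi x
          · rw [Set.indicator_of_notMem hx, hDs i x hx, norm_zero]
      _ = vol * B := by
          rw [integral_indicator Metric.isClosed_closedBall.measurableSet, setIntegral_const,
            smul_eq_mul]
  have hbound : ∀ n ≤ N, ‖κ‖ ^ n * ‖𝓕 f κ‖ ≤ 2 ^ n * ((n + 1) * (vol * B)) := by
    intro n hn
    have := Real.pow_mul_norm_iteratedFDeriv_fourier_le (K := 0) (N := ⊤) (f := f) (by simpa using hf)
      (fun k n hk _ => by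
        have : k = 0 := by simpa using hk
        subst this
        simpa using hint n) (k := 0) (n := n) (by simp) (by simp) κ
    simp only [norm_iteratedFDeriv_zero, pow_zero, one_mul] at this
    refine this.trans ?_
    have e : ∑ p ∈ Finset.range (0 + 1) ×ˢ Finset.range (n + 1),
        ∫ v : E, ‖v‖ ^ p.1 * ‖iteratedFDeriv ℝ p.2 f v‖ ≤ (n + 1) * (vol * B) := by
      rw [Finset.sum_product]
      simp only [zero_add, Finset.range_one, Finset.sum_singleton, pow_zero, one_mul]
      refine (Finset.sum_le_card_nsmul _ _ (vol * B) fun i hi => hval i ?_).trans (le_of_eq ?_)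
      · have := Finset.mem_range.1 hi; omega
      · rw [Finset.card_range, nsmul_eq_mul]; push_cast; ring
    norm_num at e ⊢
    gcongr
  have h0 := hbound 0 (Nat.zero_le _)
  have hn := hbound N le_rfl
  have hpow : (1 + ‖κ‖) ^ N ≤ 2 ^ N * (1 + ‖κ‖ ^ N) := by
    have hk := norm_nonneg κ
    rcases le_total ‖κ‖ 1 with h | h
    · calc (1 + ‖κ‖) ^ N ≤ 2 ^ N := by gcongr; linarith
        _ ≤ _ := by
          have : 0 ≤ ‖κ‖ ^ N := by positivity
          nlinarith [pow_pos (two_pos : (0:ℝ) < 2) N]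
    · calc (1 + ‖κ‖) ^ N ≤ (2 * ‖κ‖) ^ N := by gcongr; linarith
        _ = 2 ^ N * ‖κ‖ ^ N := mul_pow _ _ _
        _ ≤ _ := by gcongr; linarith
  unfold polyDecay
  rw [← div_eq_mul_inv, le_div_iff₀ (by positivity), mul_assoc, ← pow_add,
    show 2 + (finrank ℝ E + 1) = N by omega]
  calc ‖𝓕 f κ‖ * (1 + ‖κ‖) ^ N ≤ ‖𝓕 f κ‖ * (2 ^ N * (1 + ‖κ‖ ^ N)) := by gcongr
    _ = 2 ^ N * (‖κ‖ ^ 0 * ‖𝓕 f κ‖ + ‖κ‖ ^ N * ‖𝓕 f κ‖) := by ring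
    _ ≤ 2 ^ N * (2 ^ 0 * (((0 : ℕ) + 1) * (vol * B)) + 2 ^ N * ((N + 1) * (vol * B))) := by gcongr
    _ = _ := by push_cast; ring

/-- First and second differences of a derivative of a smooth function, along a vector `w`, are
controlled by the next two derivatives on a convex set. -/
theorem norm_iteratedFDeriv_differences_le {V F : Type*} [NormedAddCommGroup V] [NormedSpace ℝ V]
    [NormedAddCommGroup F] [NormedSpace ℝ F] {h : V → F} (hh : ContDiff ℝ ∞ h) {U : Set V}
    (hU : Convex ℝ U) {M : ℝ} {i : ℕ} (h1 : ∀ q ∈ U, ‖iteratedFDeriv ℝ (i + 1) h q‖ ≤ M)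
    (h2 : ∀ q ∈ U, ‖iteratedFDeriv ℝ (i + 2) h q‖ ≤ M) {q w : V} (hq : q ∈ U) (hq1 : q + w ∈ U)
    (hq2 : q - w ∈ U) :
    ‖iteratedFDeriv ℝ i h (q + w) - iteratedFDeriv ℝ i h q‖ ≤ M * ‖w‖ ∧
    ‖iteratedFDeriv ℝ i h (q + w) + iteratedFDeriv ℝ i h (q - w) - (2 : ℝ) • iteratedFDeriv ℝ i h q‖
      ≤ 2 * M * ‖w‖ ^ 2 := by
  have hdiff : ∀ j, Differentiable ℝ (iteratedFDeriv ℝ j h) := fun j =>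
    hh.differentiable_iteratedFDeriv (by exact_mod_cast WithTop.coe_lt_top _)
  have hlip : ∀ j, (∀ q ∈ U, ‖iteratedFDeriv ℝ (j + 1) h q‖ ≤ M) → ∀ x ∈ U, ∀ y ∈ U,
      ‖iteratedFDeriv ℝ j h y - iteratedFDeriv ℝ j h x‖ ≤ M * ‖y - x‖ := by
    intro j hj x hx y hy
    refine hU.norm_image_sub_le_of_norm_fderiv_le (𝕜 := ℝ) (fun z _ => hdiff j z)
      (fun z hz => ?_) hx hy
    rw [norm_fderiv_iteratedFDeriv]
    exact hj z hz
  refine ⟨by simpa using hlip i h1 q hq (q + w) hq1, ?_⟩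
  set J := iteratedFDeriv ℝ i h
  have hfd : ∀ x ∈ U, ∀ y ∈ U, ‖fderiv ℝ J y - fderiv ℝ J x‖ ≤ M * ‖y - x‖ := by
    intro x hx y hy
    have := hlip (i + 1) h2 x hx y hy
    rw [iteratedFDeriv_succ_eq_comp_left, Function.comp_apply, Function.comp_apply, ← dist_eq_norm,
      LinearIsometryEquiv.dist_map, dist_eq_norm] at this
    exact this
  have hmem : ∀ t ∈ Set.Icc (0 : ℝ) 1, q + t • w ∈ U ∧ q - t • w ∈ U := by
    intro t ht
    have hseg : ∀ y, q + y ∈ U → q + t • y ∈ U := fun y hy => by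
      have := hU hq hy (sub_nonneg.2 ht.2) ht.1 (by ring)
      convert this using 1
      module
    refine ⟨hseg w hq1, ?_⟩
    have := hseg (-w) (by rwa [← sub_eq_add_neg])
    rwa [smul_neg, ← sub_eq_add_neg] at this
  set φ : ℝ → _ := fun t => J (q + t • w) + J (q - t • w) with hφ
  have hφd : ∀ t, HasDerivAt φ (fderiv ℝ J (q + t • w) w + fderiv ℝ J (q - t • w) (-w)) t := by
    intro t
    have a1 : HasDerivAt (fun t : ℝ => q + t • w) w t := by
      simpa using ((hasDerivAt_id t).smul_const w).const_add q
    have a2 : HasDerivAt (fun t : ℝ => q - t • w) (-w) t := by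
      simpa using ((hasDerivAt_id t).smul_const w).const_sub q
    exact ((hdiff i _).hasFDerivAt.comp_hasDerivAt t a1).add
      ((hdiff i _).hasFDerivAt.comp_hasDerivAt t a2)
  have hM : 0 ≤ M := (norm_nonneg _).trans (h1 q hq)
  have := (convex_Icc (0 : ℝ) 1).norm_image_sub_le_of_norm_hasDerivWithin_le (f := φ)
    (C := 2 * M * ‖w‖ ^ 2)
    (fun t _ => (hφd t).hasDerivWithinAt) (fun t ht => ?_) (Set.left_mem_Icc.2 zero_le_one)
    (Set.right_mem_Icc.2 zero_le_one)
  · simp only [hφ, one_smul, zero_smul, add_zero, sub_zero, norm_one, mul_one] at this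
    rwa [two_smul]
  · obtain ⟨m1, m2⟩ := hmem t ht
    rw [map_neg, ← sub_eq_add_neg, ← sub_apply]
    refine (ContinuousLinearMap.le_opNorm _ _).trans ?_
    have := hfd _ m2 _ m1
    have e : q + t • w - (q - t • w) = (2 * t) • w := by module
    rw [e, norm_smul, Real.norm_of_nonneg (by linarith [ht.1])] at this
    calc _ ≤ M * (2 * t * ‖w‖) * ‖w‖ := by gcongr
      _ ≤ M * (2 * 1 * ‖w‖) * ‖w‖ := by gcongr; exact ht.2
      _ = _ := by ring

/-- Derivatives in the first variable only. -/
theorem iteratedFDeriv_prodMk_left {V W F : Type*} [NormedAddCommGroup V] [NormedSpace ℝ V]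
    [NormedAddCommGroup W] [NormedSpace ℝ W] [NormedAddCommGroup F] [NormedSpace ℝ F]
    {h : V × W → F} (hh : ContDiff ℝ ∞ h) (i : ℕ) (x : V) (ζ : W) :
    iteratedFDeriv ℝ i (fun x => h (x, ζ)) x
      = (iteratedFDeriv ℝ i h (x, ζ)).compContinuousLinearMap
          fun _ => ContinuousLinearMap.inl ℝ V W := by
  have e : (fun x => h (x, ζ)) = (fun q => h (q + (0, ζ))) ∘ ContinuousLinearMap.inl ℝ V W := by
    funext x; simp
  rw [e, ContinuousLinearMap.iteratedFDeriv_comp_right (n := ∞) _ (by fun_prop) _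
    (by exact_mod_cast le_top), iteratedFDeriv_comp_add_right]
  simp

end SymbolBounds

section SymbolBounds
set_option linter.unusedSectionVars false
variable {E : Type*} [NormedAddCommGroup E] [InnerProductSpace ℝ E] [FiniteDimensional ℝ E]
  [MeasurableSpace E] [BorelSpace E]

theorem fourier_sub_of_integrable {f g : E → ℂ} (hf : Integrable f) (hg : Integrable g) (κ : E) :
    𝓕 (fun x => f x - g x) κ = 𝓕 f κ - 𝓕 g κ := by
  simp only [Real.fourier_eq, smul_sub]
  exact integral_sub ((Real.fourierIntegral_convergent_iff κ).2 hf)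
    ((Real.fourierIntegral_convergent_iff κ).2 hg)

theorem fourier_add_of_integrable {f g : E → ℂ} (hf : Integrable f) (hg : Integrable g) (κ : E) :
    𝓕 (fun x => f x + g x) κ = 𝓕 f κ + 𝓕 g κ := by
  simp only [Real.fourier_eq, smul_add]
  exact integral_add ((Real.fourierIntegral_convergent_iff κ).2 hf)
    ((Real.fourierIntegral_convergent_iff κ).2 hg)

theorem fourier_const_mul' (c : ℂ) (f : E → ℂ) (κ : E) :
    𝓕 (fun x => c * f x) κ = c * 𝓕 f κ := by
  simp only [Real.fourier_eq, Circle.smul_def, smul_eq_mul, ← integral_const_mul]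
  refine integral_congr_ae (Filter.Eventually.of_forall fun x => ?_)
  simp only; ring

/-- The partial Fourier transform of a smooth function `h`, supported in a ball in the first
variable: size, first and second differences in the second variable near a point. -/
theorem partialFourier_differences_le {R D : ℝ}
    (hD : ∀ (f : E → ℂ) (B : ℝ), ContDiff ℝ ∞ f → (∀ x, R < ‖x‖ → f x = 0) →
      (∀ i ≤ finrank ℝ E + 3, ∀ x, ‖iteratedFDeriv ℝ i f x‖ ≤ B) →
      ∀ κ, ‖𝓕 f κ‖ * (1 + ‖κ‖) ^ 2 ≤ D * B * polyDecay κ)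
    {h : E × E → ℂ} (hh : ContDiff ℝ ∞ h) (hs : ∀ x ζ, R < ‖x‖ → h (x, ζ) = 0) {ζ₀ : E} {M : ℝ}
    (hM : ∀ i ≤ finrank ℝ E + 5, ∀ x, ∀ ζ ∈ Metric.closedBall ζ₀ (1 / 2),
      ‖iteratedFDeriv ℝ i h (x, ζ)‖ ≤ M) (κ : E) :
    ‖partialFourier (fun x ζ => h (x, ζ)) κ ζ₀‖ * (1 + ‖κ‖) ^ 2 ≤ D * M * polyDecay κ ∧
    ∀ w, ‖w‖ ≤ 1 / 2 →
      ‖partialFourier (fun x ζ => h (x, ζ)) κ (ζ₀ + w)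
        - partialFourier (fun x ζ => h (x, ζ)) κ ζ₀‖ * (1 + ‖κ‖) ^ 2
          ≤ D * (M * ‖w‖) * polyDecay κ ∧
      ‖partialFourier (fun x ζ => h (x, ζ)) κ (ζ₀ + w)
        + partialFourier (fun x ζ => h (x, ζ)) κ (ζ₀ - w)
        - 2 * partialFourier (fun x ζ => h (x, ζ)) κ ζ₀‖ * (1 + ‖κ‖) ^ 2
          ≤ D * (2 * M * ‖w‖ ^ 2) * polyDecay κ := by
  set A := fun ζ => partialFourier (fun x ζ => h (x, ζ)) κ ζ with hA
  have hsm : ∀ ζ, ContDiff ℝ ∞ fun x => h (x, ζ) := fun ζ => by fun_prop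
  have hint : ∀ ζ, Integrable fun x => h (x, ζ) := fun ζ => by
    refine (hsm ζ).continuous.integrable_of_hasCompactSupport ?_
    refine HasCompactSupport.of_support_subset_isCompact (isCompact_closedBall (0 : E) R)
      fun x hx => ?_
    rw [mem_closedBall_zero_iff]
    by_contra h
    exact hx (hs x ζ (not_le.1 h))
  have hsmi : ∀ (i : ℕ) ζ x, ContDiffAt ℝ i (fun x => h (x, ζ)) x := fun i ζ x =>
    ((hsm ζ).of_le (by exact_mod_cast le_top)).contDiffAt
  have hinl : ∀ (i : ℕ) (T : ContinuousMultilinearMap ℝ (fun _ : Fin i => E × E) ℂ),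
      ‖T.compContinuousLinearMap fun _ => ContinuousLinearMap.inl ℝ E E‖ ≤ ‖T‖ := fun i T => by
    refine (ContinuousMultilinearMap.norm_compContinuousLinearMap_le _ _).trans ?_
    refine mul_le_of_le_one_right (norm_nonneg _) (Finset.prod_le_one (fun _ _ => norm_nonneg _)
      fun _ _ => ContinuousLinearMap.norm_inl_le_one _ _ _)
  have hmem0 : ζ₀ ∈ Metric.closedBall ζ₀ (1 / 2) := Metric.mem_closedBall_self (by norm_num)
  refine ⟨?_, fun w hw => ?_⟩
  · refine hD _ M (hsm ζ₀) (fun x hx => hs x _ hx) (fun i hi x => ?_) κ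
    rw [iteratedFDeriv_prodMk_left hh]
    exact (hinl i _).trans (hM i (by omega) x ζ₀ hmem0)
  have hp : ζ₀ + w ∈ Metric.closedBall ζ₀ (1 / 2) := by
    rw [Metric.mem_closedBall, dist_eq_norm]; simpa using hw
  have hm : ζ₀ - w ∈ Metric.closedBall ζ₀ (1 / 2) := by
    rw [Metric.mem_closedBall, dist_eq_norm]; simpa using hw
  have key : ∀ i ≤ finrank ℝ E + 3, ∀ x : E, _ := fun i hi x =>
    norm_iteratedFDeriv_differences_le hh
      (U := (Set.univ : Set E) ×ˢ Metric.closedBall ζ₀ (1 / 2))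
      (convex_univ.prod (convex_closedBall _ _)) (M := M) (i := i)
      (fun q hq => hM (i + 1) (by omega) q.1 q.2 hq.2)
      (fun q hq => hM (i + 2) (by omega) q.1 q.2 hq.2)
      (q := (x, ζ₀)) (w := (0, w)) ⟨trivial, hmem0⟩ ⟨trivial, hp⟩ ⟨trivial, hm⟩
  have hw' : ‖((0, w) : E × E)‖ = ‖w‖ := by simp [Prod.norm_def]
  constructor
  · have e : A (ζ₀ + w) - A ζ₀ = 𝓕 (fun x => h (x, ζ₀ + w) - h (x, ζ₀)) κ :=
      (fourier_sub_of_integrable (hint _) (hint _) κ).symm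
    rw [show partialFourier (fun x ζ => h (x, ζ)) κ (ζ₀ + w)
      - partialFourier (fun x ζ => h (x, ζ)) κ ζ₀ = A (ζ₀ + w) - A ζ₀ from rfl, e]
    refine hD _ _ (by fun_prop) (fun x hx => by rw [hs _ _ hx, hs _ _ hx, sub_zero])
      (fun i hi x => ?_) κ
    have h1 := (key i hi x).1
    simp only [Prod.mk_add_mk, add_zero, hw'] at h1
    have e2 : iteratedFDeriv ℝ i (fun x => h (x, ζ₀ + w) - h (x, ζ₀)) x
        = (iteratedFDeriv ℝ i h (x, ζ₀ + w) - iteratedFDeriv ℝ i h (x, ζ₀)).compContinuousLinearMap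
          fun _ => ContinuousLinearMap.inl ℝ E E := by
      rw [fun_iteratedFDeriv_sub_apply (hsmi i _ x) (hsmi i _ x), iteratedFDeriv_prodMk_left hh,
        iteratedFDeriv_prodMk_left hh]
      rfl
    rw [e2]
    exact (hinl i _).trans h1
  · have e : A (ζ₀ + w) + A (ζ₀ - w) - 2 * A ζ₀
        = 𝓕 (fun x => (h (x, ζ₀ + w) + h (x, ζ₀ - w)) - 2 * h (x, ζ₀)) κ := by
      have i1 : Integrable fun x => h (x, ζ₀ + w) + h (x, ζ₀ - w) := (hint _).add (hint _)
      rw [fourier_sub_of_integrable i1 ((hint _).const_mul 2), fourier_const_mul',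
        fourier_add_of_integrable (hint _) (hint _)]
      rfl
    rw [show partialFourier (fun x ζ => h (x, ζ)) κ (ζ₀ + w)
        + partialFourier (fun x ζ => h (x, ζ)) κ (ζ₀ - w)
        - 2 * partialFourier (fun x ζ => h (x, ζ)) κ ζ₀ = A (ζ₀ + w) + A (ζ₀ - w) - 2 * A ζ₀
      from rfl, e]
    refine hD _ _ (by fun_prop) (fun x hx => by rw [hs _ _ hx, hs _ _ hx, hs _ _ hx]; simp)
      (fun i hi x => ?_) κ
    have h1 := (key i hi x).2
    simp only [Prod.mk_add_mk, Prod.mk_sub_mk, sub_zero, add_zero, hw'] at h1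
    have e2 : iteratedFDeriv ℝ i (fun x => (h (x, ζ₀ + w) + h (x, ζ₀ - w)) - 2 * h (x, ζ₀)) x
        = (iteratedFDeriv ℝ i h (x, ζ₀ + w) + iteratedFDeriv ℝ i h (x, ζ₀ - w)
            - (2 : ℝ) • iteratedFDeriv ℝ i h (x, ζ₀)).compContinuousLinearMap
          fun _ => ContinuousLinearMap.inl ℝ E E := by
      have e3 : (fun x => (h (x, ζ₀ + w) + h (x, ζ₀ - w)) - 2 * h (x, ζ₀))
          = fun x => (h (x, ζ₀ + w) + h (x, ζ₀ - w)) - (2 : ℝ) • h (x, ζ₀) := by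
        funext x; simp
      rw [e3, fun_iteratedFDeriv_sub_apply ((hsmi i _ x).add (hsmi i _ x))
        ((hsmi i _ x).const_smul _), fun_iteratedFDeriv_add_apply (hsmi i _ x) (hsmi i _ x),
        iteratedFDeriv_const_smul_apply' (hsmi i _ x), iteratedFDeriv_prodMk_left hh,
        iteratedFDeriv_prodMk_left hh, iteratedFDeriv_prodMk_left hh]
      rfl
    rw [e2]
    exact (hinl i _).trans h1

end SymbolBounds

/-! ### Homogeneous symbols with compact support -/

namespace WRClass
variable {m n p : ℕ}

theorem lam_nonneg (X : Phase m) : 0 ≤ lam X := Real.sqrt_nonneg _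

theorem lam_sq (X : Phase m) : lam X ^ 2 = gam X ^ 2 + ‖cov X‖ ^ 2 :=
  Real.sq_sqrt (by positivity)

theorem lam_pos {X : Phase m} (hX : X ∈ XX m) : 0 < lam X := by
  refine Real.sqrt_pos.2 ?_
  by_contra h
  have h1 : gam X ^ 2 = 0 := by nlinarith [sq_nonneg (gam X), sq_nonneg ‖cov X‖]
  have h2 : ‖cov X‖ ^ 2 = 0 := by nlinarith [sq_nonneg (gam X), sq_nonneg ‖cov X‖]
  exact hX.2.2 ⟨norm_eq_zero.1 (pow_eq_zero_iff (two_ne_zero) |>.1 h2),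
    pow_eq_zero_iff (two_ne_zero) |>.1 h1⟩

theorem mem_XX_of_lam_pos {X : Phase m} (h1 : 0 ≤ xd X) (h2 : 0 ≤ gam X) (h3 : 0 < lam X) :
    X ∈ XX m := by
  refine ⟨h1, h2, fun h => ?_⟩
  have := lam_sq X
  rw [h.1, h.2] at this
  simp at this
  exact h3.ne' this

theorem lam_dil {r : ℝ} (hr : 0 ≤ r) (X : Phase m) : lam (dil r X) = r * lam X := by
  unfold lam
  rw [← Real.sqrt_sq hr, ← Real.sqrt_mul (sq_nonneg r)]
  congr 1
  simp only [dil, gam, cov, norm_smul, Real.norm_eq_abs, abs_of_nonneg hr, Real.sqrt_sq hr]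
  ring

theorem dil_dil (r s : ℝ) (X : Phase m) : dil r (dil s X) = dil (r * s) X := by
  simp [dil, tan, xd, cov, gam, smul_smul, mul_assoc]

theorem dil_one (X : Phase m) : dil 1 X = X := by
  simp [dil, tan, xd, cov, gam]

theorem dil_mem_XX {r : ℝ} (hr : 0 < r) {X : Phase m} (hX : X ∈ XX m) : dil r X ∈ XX m :=
  mem_XX_of_lam_pos hX.1 (mul_nonneg hr.le hX.2.1)
    (by rw [lam_dil hr.le]; exact mul_pos hr (lam_pos hX))

theorem continuous_lam : Continuous (lam : Phase m → ℝ) := by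
  unfold lam gam cov; fun_prop

theorem continuous_dil : Continuous fun q : ℝ × Phase m => dil q.1 q.2 := by
  unfold dil tan xd cov gam; fun_prop

/-- The point of the unit sphere of frequencies on the ray of `X`. -/
noncomputable def toSphere (X : Phase m) : Phase m := dil (lam X)⁻¹ X

theorem toSphere_mem_XS {X : Phase m} (hX : X ∈ XX m) : toSphere X ∈ XS m := by
  have h := lam_pos hX
  refine ⟨dil_mem_XX (inv_pos.2 h) hX, ?_⟩
  rw [toSphere, lam_dil (inv_pos.2 h).le, inv_mul_cancel₀ h.ne']

theorem dil_lam_toSphere {X : Phase m} (hX : 0 < lam X) : dil (lam X) (toSphere X) = X := by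
  rw [toSphere, dil_dil, mul_inv_cancel₀ hX.ne', dil_one]

theorem continuousAt_toSphere {X : Phase m} (hX : 0 < lam X) :
    ContinuousAt (toSphere : Phase m → Phase m) X := by
  unfold toSphere
  exact continuous_dil.continuousAt.comp
    ((continuous_lam.continuousAt.inv₀ hX.ne').prodMk continuousAt_id)

theorem isClosed_XS : IsClosed (XS m) := by
  have : XS m = {X | 0 ≤ xd X} ∩ {X | 0 ≤ gam X} ∩ {X | lam X = 1} := by
    ext X
    constructor
    · exact fun h => ⟨⟨h.1.1, h.1.2.1⟩, h.2⟩
    · exact fun h => ⟨mem_XX_of_lam_pos h.1.1 h.1.2 (by rw [h.2]; exact one_pos), h.2⟩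
  rw [this]
  unfold xd gam
  exact ((isClosed_le (by fun_prop) (by fun_prop)).inter (isClosed_le (by fun_prop)
    (by fun_prop))).inter (isClosed_eq continuous_lam continuous_const)

/-- Derivatives within `𝕏` are well defined up to the boundary. -/
theorem uniqueDiffOn_XX : UniqueDiffOn ℝ (XX m) := by
  have h1 : UniqueDiffOn ℝ ((Set.univ : Set (Tan m)) ×ˢ (Set.Ici (0 : ℝ) ×ˢ
      ((Set.univ : Set (Tan m)) ×ˢ Set.Ici (0 : ℝ)))) :=
    uniqueDiffOn_univ.prod ((uniqueDiffOn_Ici 0).prod (uniqueDiffOn_univ.prod (uniqueDiffOn_Ici 0)))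
  have h2 := h1.inter (isOpen_lt continuous_const (continuous_lam (m := m)) :
    IsOpen {X : Phase m | 0 < lam X})
  convert h2 using 1
  ext X
  constructor
  · exact fun h => ⟨⟨trivial, h.1, trivial, h.2.1⟩, lam_pos h⟩
  · exact fun h => mem_XX_of_lam_pos h.1.2.1 h.1.2.2.2 h.2

/-- Smooth symbols of order one, homogeneous on `𝕏`, supported over the unit sphere of frequencies
in a compact set. -/
structure IsCompactSymbol (G : Phase m → ℂ) : Prop where
  smooth : ContDiffOn ℝ ∞ G (XX m)
  homog : IsHomog 1 (XX m) G
  supp : ∃ K : Set (Phase m), IsCompact K ∧ ∀ X ∈ XS m, X ∉ K → G X = 0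

namespace IsCompactSymbol
variable {G : Phase m → ℂ} (hG : IsCompactSymbol G)
include hG

theorem eq_lam_mul {X : Phase m} (hX : X ∈ XX m) : G X = lam X * G (toSphere X) := by
  have h := hG.homog _ (toSphere_mem_XS hX).1 (lam X) (lam_pos hX)
  rw [dil_lam_toSphere (lam_pos hX)] at h
  rw [h, pow_one, Complex.real_smul]

/-- The derivatives are bounded near the unit sphere of frequencies, up to the boundary, because
the support meets this region in a compact set. -/
theorem exists_deriv_bound (N : ℕ) : ∃ M : ℝ, ∀ i ≤ N, ∀ X ∈ XX m, 1 / 2 ≤ lam X → lam X ≤ 2 →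
    ‖iteratedFDerivWithin ℝ i G (XX m) X‖ ≤ M := by
  obtain ⟨K, hK, hKs⟩ := hG.supp
  set C1 : Set (Phase m) := (fun q : ℝ × Phase m => dil q.1 q.2) ''
    (Set.Icc (1 / 2 : ℝ) 2 ×ˢ (K ∩ XS m)) with hC1
  have hC1c : IsCompact C1 :=
    (isCompact_Icc.prod (hK.inter_right isClosed_XS)).image continuous_dil
  have hC1s : C1 ⊆ XX m := by
    rintro _ ⟨⟨r, Y⟩, ⟨hr, hY⟩, rfl⟩
    exact dil_mem_XX (by have := hr.1; dsimp at this; linarith) hY.2.1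
  have hb : ∀ i : ℕ, ∃ M : ℝ, ∀ X ∈ C1, ‖iteratedFDerivWithin ℝ i G (XX m) X‖ ≤ M := fun i =>
    hC1c.exists_bound_of_continuousOn ((hG.smooth.continuousOn_iteratedFDerivWithin
      (by exact_mod_cast le_top) uniqueDiffOn_XX).mono hC1s)
  choose M hM using hb
  refine ⟨∑ i ∈ Finset.range (N + 1), |M i|, fun i hi X hX h1 h2 => ?_⟩
  by_cases hXC : toSphere X ∈ K
  · have hX1 : X ∈ C1 := ⟨(lam X, toSphere X), ⟨⟨h1, h2⟩, hXC, toSphere_mem_XS hX⟩,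
      dil_lam_toSphere (lam_pos hX)⟩
    exact ((hM i X hX1).trans (le_abs_self _)).trans
      (Finset.single_le_sum (f := fun i => |M i|) (fun j _ => abs_nonneg _)
        (Finset.mem_range.2 (by omega)))
  · have hev : G =ᶠ[nhdsWithin X (XX m)] fun _ => 0 := by
      have : ∀ᶠ Y in nhdsWithin X (XX m), toSphere Y ∈ Kᶜ :=
        (continuousAt_toSphere (lam_pos hX)).continuousWithinAt.eventually
          (hK.isClosed.isOpen_compl.mem_nhds hXC)
      filter_upwards [this, self_mem_nhdsWithin] with Y hY hYX
      rw [hG.eq_lam_mul hYX, hKs _ (toSphere_mem_XS hYX) hY, mul_zero]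
    rw [hev.iteratedFDerivWithin_eq (hev.self_of_nhdsWithin hX)]
    rw [show (fun _ : Phase m => (0 : ℂ)) = 0 from rfl, iteratedFDerivWithin_zero]
    simp only [Pi.zero_apply, norm_zero]
    positivity

end IsCompactSymbol

/-- The weight `λ` as a function of the dual variable `k`, with `ξ = 2πk`. -/
noncomputable def freqWeight (γ : ℝ) (k : Tan m) : ℝ := √(γ ^ 2 + ‖(2 * Real.pi) • k‖ ^ 2)

theorem lam_mk (x : Tan m) (r : ℝ) (k : Tan m) (γ : ℝ) :
    lam ((x, r, (2 * Real.pi) • k, γ) : Phase m) = freqWeight γ k := rfl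

theorem isFreqWeight_freqWeight {γ : ℝ} (hγ : 200 ≤ γ) :
    IsFreqWeight (freqWeight γ : Tan m → ℝ) := by
  have hsq : ∀ k : Tan m, freqWeight γ k ^ 2 = γ ^ 2 + (2 * Real.pi) ^ 2 * ‖k‖ ^ 2 := fun k => by
    rw [freqWeight, Real.sq_sqrt (by positivity), norm_smul, mul_pow, Real.norm_eq_abs, sq_abs]
  have h0 : ∀ k : Tan m, 0 ≤ freqWeight γ k := fun k => Real.sqrt_nonneg _
  have hpi : 2 * Real.pi ≤ 6.2832 := by linarith [Real.pi_lt_d4]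
  have hpi0 := Real.pi_pos
  have hlarge : ∀ k : Tan m, 200 ≤ freqWeight γ k := fun k =>
    Real.le_sqrt_of_sq_le (by nlinarith [sq_nonneg ‖(2 * Real.pi) • k‖])
  have hpi2 : (2 * Real.pi) ^ 2 ≤ 40 := by nlinarith
  refine ⟨hlarge, fun ξ k => ?_, fun ξ w hw => ?_⟩
  · have e : |‖ξ‖ ^ 2 - ‖k‖ ^ 2| ≤ ‖ξ - k‖ * (‖ξ‖ + ‖k‖) := by
      rw [show ‖ξ‖ ^ 2 - ‖k‖ ^ 2 = (‖ξ‖ - ‖k‖) * (‖ξ‖ + ‖k‖) by ring, abs_mul,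
        abs_of_nonneg (by positivity : 0 ≤ ‖ξ‖ + ‖k‖)]
      gcongr
      exact abs_norm_sub_norm_le _ _
    have hge : ∀ k : Tan m, 2 * Real.pi * ‖k‖ ≤ freqWeight γ k := fun k =>
      Real.le_sqrt_of_sq_le (by rw [norm_smul, Real.norm_of_nonneg (by positivity)]; nlinarith)
    have hs : 0 < freqWeight γ ξ + freqWeight γ k := by linarith [hlarge ξ, hlarge k]
    refine le_of_mul_le_mul_right ?_ hs
    rw [← abs_of_pos hs, ← abs_mul, abs_of_pos hs, show (freqWeight γ ξ - freqWeight γ k) *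
      (freqWeight γ ξ + freqWeight γ k) = freqWeight γ ξ ^ 2 - freqWeight γ k ^ 2 by ring, hsq, hsq,
      show γ ^ 2 + (2 * Real.pi) ^ 2 * ‖ξ‖ ^ 2 - (γ ^ 2 + (2 * Real.pi) ^ 2 * ‖k‖ ^ 2)
        = (2 * Real.pi) ^ 2 * (‖ξ‖ ^ 2 - ‖k‖ ^ 2) by ring, abs_mul, abs_of_nonneg (by positivity)]
    calc (2 * Real.pi) ^ 2 * |‖ξ‖ ^ 2 - ‖k‖ ^ 2|
        ≤ (2 * Real.pi) ^ 2 * (‖ξ - k‖ * (‖ξ‖ + ‖k‖)) := by gcongr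
      _ = 2 * Real.pi * ‖ξ - k‖ * (2 * Real.pi * ‖ξ‖ + 2 * Real.pi * ‖k‖) := by ring
      _ ≤ 7 * ‖ξ - k‖ * (freqWeight γ ξ + freqWeight γ k) := by
          have := hge ξ; have := hge k
          gcongr
          linarith
  · have hp := parallelogram_law_with_norm ℝ ξ w
    set a := freqWeight γ (ξ + w) with ha
    set b := freqWeight γ (ξ - w) with hb
    set c := freqWeight γ ξ with hc
    have hab : a ^ 2 + b ^ 2 = 2 * c ^ 2 + 2 * (2 * Real.pi) ^ 2 * ‖w‖ ^ 2 := by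
      rw [ha, hb, hc, hsq, hsq, hsq]; nlinarith
    have hc0 := hlarge ξ
    have h1 : (a + b) ^ 2 ≤ (2 * c + 40) ^ 2 := by
      have h2 : (2 * Real.pi) ^ 2 * ‖w‖ ^ 2 ≤ 40 * c := by gcongr
      nlinarith [sq_nonneg (a - b)]
    exact (abs_le_of_sq_le_sq' h1 (by linarith)).2

end WRClass

/-! ### Symbol estimates on slices -/

namespace WRClass
variable {m n p : ℕ}

theorem sliceMap_mem_XX {r γ : ℝ} (hr : 0 ≤ r) (hγ : 0 < γ) (x ζ : Tan m) :
    ((x, r, ζ, γ) : Phase m) ∈ XX m := ⟨hr, hγ.le, fun h => hγ.ne' h.2⟩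

theorem norm_iteratedFDeriv_sliceMap_le (r γ : ℝ) (i : ℕ) (hi : 1 ≤ i) (q : Tan m × Tan m) :
    ‖iteratedFDeriv ℝ i (fun q : Tan m × Tan m => ((q.1, r, q.2, γ) : Phase m)) q‖ ≤ 1 ^ i := by
  set L : Tan m × Tan m →L[ℝ] Phase m :=
    (ContinuousLinearMap.fst ℝ _ _).prod ((0 : Tan m × Tan m →L[ℝ] ℝ).prod
      ((ContinuousLinearMap.snd ℝ _ _).prod 0)) with hL
  have hfd : fderiv ℝ (fun q : Tan m × Tan m => ((q.1, r, q.2, γ) : Phase m)) = fun _ => L := by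
    funext q
    exact (hasFDerivAt_fst.prodMk ((hasFDerivAt_const r q).prodMk
      (hasFDerivAt_snd.prodMk (hasFDerivAt_const γ q)))).fderiv
  obtain ⟨j, rfl⟩ : ∃ j, i = j + 1 := ⟨i - 1, by omega⟩
  rw [← norm_iteratedFDeriv_fderiv, hfd, one_pow]
  rcases Nat.eq_zero_or_pos j with rfl | hj
  · rw [norm_iteratedFDeriv_zero]
    refine ContinuousLinearMap.opNorm_le_bound _ zero_le_one fun q => ?_
    rw [one_mul]
    simp [hL, Prod.norm_def]
  · rw [iteratedFDeriv_const_of_ne (by omega)]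
    simp

namespace IsCompactSymbol
variable {G : Phase m → ℂ} (hG : IsCompactSymbol G)
include hG

theorem contDiff_slice {r γ : ℝ} (hr : 0 ≤ r) (hγ : 0 < γ) :
    ContDiff ℝ ∞ fun q : Tan m × Tan m => G (q.1, r, q.2, γ) :=
  contDiffOn_univ.1 (hG.smooth.comp (f := fun q : Tan m × Tan m => ((q.1, r, q.2, γ) : Phase m))
    (by fun_prop) fun q _ => sliceMap_mem_XX hr hγ q.1 q.2)

theorem exists_slice_bound (N : ℕ) : ∃ M : ℝ, 0 ≤ M ∧ ∀ r γ : ℝ, 0 ≤ r → 0 < γ → ∀ i ≤ N,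
    ∀ x ζ : Tan m, 1 / 2 ≤ lam ((x, r, ζ, γ) : Phase m) → lam ((x, r, ζ, γ) : Phase m) ≤ 2 →
    ‖iteratedFDeriv ℝ i (fun q : Tan m × Tan m => G (q.1, r, q.2, γ)) (x, ζ)‖ ≤ M := by
  obtain ⟨M, hM⟩ := hG.exists_deriv_bound N
  refine ⟨N.factorial * |M|, by positivity, fun r γ hr hγ i hi x ζ h1 h2 => ?_⟩
  have hmem := sliceMap_mem_XX (m := m) hr hγ
  have := norm_iteratedFDerivWithin_comp_le (𝕜 := ℝ) (g := G)
    (f := fun q : Tan m × Tan m => ((q.1, r, q.2, γ) : Phase m)) (n := i) (N := ∞) (s := Set.univ)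
    (t := XX m) (x := (x, ζ)) hG.smooth (by fun_prop) (by exact_mod_cast le_top)
    uniqueDiffOn_XX uniqueDiffOn_univ (fun q _ => hmem q.1 q.2) (Set.mem_univ _)
    (C := |M|) (D := 1) (fun j hj => (hM j (hj.trans hi) _ (hmem x ζ) h1 h2).trans (le_abs_self _))
    (fun j hj _ => by
      rw [iteratedFDerivWithin_univ]; exact norm_iteratedFDeriv_sliceMap_le r γ j hj _)
  rw [iteratedFDerivWithin_univ, one_pow, mul_one] at this
  refine this.trans ?_
  gcongr

/-- A compact support over the unit sphere of frequencies bounds the tangential variables, which the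
dilations leave fixed. -/
theorem exists_support_radius : ∃ R : ℝ, ∀ X ∈ XX m, R < ‖tan X‖ → G X = 0 := by
  obtain ⟨K, hK, hKs⟩ := hG.supp
  obtain ⟨R, hR⟩ := hK.isBounded.exists_norm_le
  refine ⟨R, fun X hX h => ?_⟩
  rw [hG.eq_lam_mul hX, hKs _ (toSphere_mem_XS hX) fun hmem => ?_, mul_zero]
  have h1 := hR _ hmem
  have h2 : ‖tan X‖ ≤ ‖toSphere X‖ := norm_fst_le (toSphere X)
  linarith

/-- Homogeneity, on the slices. -/
theorem scale {c : ℝ} (hc : 0 < c) {r γ : ℝ} (hr : 0 ≤ r) (hγ : 0 < γ) (x ζ : Tan m) :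
    G (x, r, ζ, γ) = c * G (x, r, c⁻¹ • ζ, c⁻¹ * γ) := by
  have h := hG.homog _ (sliceMap_mem_XX hr (mul_pos (inv_pos.2 hc) hγ) x (c⁻¹ • ζ)) c hc
  rw [pow_one, Complex.real_smul] at h
  rw [← h]
  simp [dil, tan, xd, cov, gam, smul_smul, hc.ne']

/-- The slices of a compactly supported homogeneous symbol satisfy the symbol estimates,
uniformly in `x_d` and `γ`.  A dilation by the inverse of the weight moves a frequency to the unit
sphere, where the derivatives are bounded. -/
theorem exists_isOrderOne : ∃ R C : ℝ, ∀ r γ : ℝ, 0 ≤ r → 200 ≤ γ →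
    IsOrderOne (freqWeight γ) R C fun x k : Tan m => G (x, r, (2 * Real.pi) • k, γ) := by
  obtain ⟨R, hR⟩ := hG.exists_support_radius
  obtain ⟨M, hM0, hM⟩ := hG.exists_slice_bound (finrank ℝ (Tan m) + 5)
  obtain ⟨D, hD0, hD⟩ := exists_fourier_decay (Tan m) R
  refine ⟨R, M + 200 * (D * M), fun r γ hr hγ => ?_⟩
  have hγ0 : 0 < γ := by linarith
  have hl := isFreqWeight_freqWeight (m := m) hγ
  have hpi0 := Real.pi_pos
  have hpi : 2 * Real.pi ≤ 6.2832 := by linarith [Real.pi_lt_d4]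
  have hpi2 : (2 * Real.pi) ^ 2 ≤ 40 := by nlinarith
  have hDM : 0 ≤ D * M := by positivity
  set A : Tan m → Tan m → ℂ := partialFourier fun x k => G (x, r, (2 * Real.pi) • k, γ) with hA
  -- the estimates on the sphere, transported by homogeneity
  have key : ∀ (k κ : Tan m), ‖A κ k‖ * (1 + ‖κ‖) ^ 2 ≤ D * M * freqWeight γ k * polyDecay κ ∧
      ∀ w : Tan m, 2 * Real.pi * ‖w‖ ≤ freqWeight γ k / 2 →
        ‖A κ (k + w) - A κ k‖ * (1 + ‖κ‖) ^ 2 ≤ D * M * (2 * Real.pi * ‖w‖) * polyDecay κ ∧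
        ‖A κ (k + w) + A κ (k - w) - 2 * A κ k‖ * (1 + ‖κ‖) ^ 2 * freqWeight γ k
          ≤ 2 * (D * M) * (2 * Real.pi * ‖w‖) ^ 2 * polyDecay κ := by
    intro k κ
    set c := freqWeight γ k with hc
    have hc0 : 0 < c := hl.pos k
    have hcγ : 0 < c⁻¹ * γ := by positivity
    have hlam : lam (((0 : Tan m), r, c⁻¹ • (2 * Real.pi) • k, c⁻¹ * γ) : Phase m) = 1 := by
      have := lam_dil (inv_pos.2 hc0).le (((0 : Tan m), r, (2 * Real.pi) • k, γ) : Phase m)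
      rw [lam_mk, ← hc, inv_mul_cancel₀ hc0.ne'] at this
      exact this
    have hAe : ∀ k' κ, A κ k' = c * partialFourier (fun x ζ => G (x, r, ζ, c⁻¹ * γ)) κ
        (c⁻¹ • (2 * Real.pi) • k') := by
      intro k' κ
      simp only [hA, partialFourier]
      rw [← fourier_const_mul']
      exact congrArg (fun f : Tan m → ℂ => 𝓕 f κ) (funext fun x => hG.scale hc0 hr hγ0 x _)
    set ζ₀ := c⁻¹ • (2 * Real.pi) • k with hζ₀
    have hball : ∀ x : Tan m, ∀ ζ ∈ Metric.closedBall ζ₀ (1 / 2),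
        1 / 2 ≤ lam ((x, r, ζ, c⁻¹ * γ) : Phase m) ∧ lam ((x, r, ζ, c⁻¹ * γ) : Phase m) ≤ 2 := by
      intro x ζ hζ
      rw [Metric.mem_closedBall, dist_eq_norm] at hζ
      have h1 := lam_sq ((x, r, ζ, c⁻¹ * γ) : Phase m)
      have h2 := lam_sq (((0 : Tan m), r, ζ₀, c⁻¹ * γ) : Phase m)
      rw [hlam] at h2
      simp only [gam, cov] at h1 h2
      have h3 := abs_le.1 ((abs_norm_sub_norm_le ζ ζ₀).trans hζ)
      have h4 := lam_nonneg ((x, r, ζ, c⁻¹ * γ) : Phase m)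
      set L := lam ((x, r, ζ, c⁻¹ * γ) : Phase m)
      have h5 : ‖ζ₀‖ ≤ 1 := by nlinarith [norm_nonneg ζ₀, sq_nonneg (c⁻¹ * γ)]
      have h6 := norm_nonneg ζ
      have h7 := norm_nonneg ζ₀
      constructor
      · by_contra hlt
        rw [not_le] at hlt
        have : L ^ 2 < 1 / 4 := by nlinarith
        nlinarith
      · by_contra hlt
        rw [not_le] at hlt
        have : 4 < L ^ 2 := by nlinarith
        nlinarith
    have hsl := partialFourier_differences_le hD (hG.contDiff_slice hr hcγ)
      (fun x ζ hx => hR _ (sliceMap_mem_XX hr hcγ x ζ) hx) (ζ₀ := ζ₀) (M := M)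
      (fun i hi x ζ hζ => hM r _ hr hcγ i hi x ζ (hball x ζ hζ).1 (hball x ζ hζ).2) κ
    dsimp only at hsl
    obtain ⟨s1, s2⟩ := hsl
    constructor
    · rw [hAe, norm_mul, Complex.norm_real, Real.norm_of_nonneg hc0.le, mul_assoc]
      calc _ ≤ c * (D * M * polyDecay κ) := by gcongr
        _ = _ := by ring
    · intro w hw
      set w' := c⁻¹ • (2 * Real.pi) • w with hw'
      have hwn : ‖w'‖ = c⁻¹ * (2 * Real.pi * ‖w‖) := by
        rw [hw', norm_smul, norm_smul, Real.norm_of_nonneg (by positivity),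
          Real.norm_of_nonneg (by positivity)]
      have hw2 : ‖w'‖ ≤ 1 / 2 := by
        rw [hwn, inv_mul_le_iff₀ hc0]; linarith
      obtain ⟨t1, t2⟩ := s2 w' hw2
      have ep : c⁻¹ • (2 * Real.pi) • (k + w) = ζ₀ + w' := by rw [smul_add, smul_add]
      have em : c⁻¹ • (2 * Real.pi) • (k - w) = ζ₀ - w' := by rw [smul_sub, smul_sub]
      constructor
      · rw [hAe, hAe, ep, ← mul_sub, norm_mul, Complex.norm_real, Real.norm_of_nonneg hc0.le,
          mul_assoc]
        calc _ ≤ c * (D * (M * ‖w'‖) * polyDecay κ) := by gcongr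
          _ = _ := by rw [hwn]; field_simp
      · rw [hAe, hAe, hAe, ep, em]
        rw [show ∀ a b d : ℂ, (c : ℂ) * a + c * b - 2 * (c * d) = c * (a + b - 2 * d) from
          fun a b d => by ring, norm_mul, Complex.norm_real, Real.norm_of_nonneg hc0.le]
        rw [show ∀ a b : ℝ, c * a * b * c = c ^ 2 * (a * b) from fun a b => by ring]
        calc _ ≤ c ^ 2 * (D * (2 * M * ‖w'‖ ^ 2) * polyDecay κ) := by gcongr
          _ = _ := by rw [hwn]; field_simp
  refine ⟨?_, fun x k hx => hR _ (sliceMap_mem_XX hr hγ0 x _) hx, by positivity, ?_, ?_, ?_, ?_⟩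
  · exact (hG.contDiff_slice hr hγ0).continuous.comp
      (by fun_prop : Continuous fun q : Tan m × Tan m => (q.1, (2 * Real.pi) • q.2))
  · intro x k
    have hc0 : 0 < freqWeight γ k := hl.pos k
    have hX := sliceMap_mem_XX hr hγ0 x ((2 * Real.pi) • k)
    rw [hG.eq_lam_mul hX, lam_mk, norm_mul, Complex.norm_real, Real.norm_of_nonneg hc0.le,
      mul_comm]
    have hb : ‖G (toSphere (x, r, (2 * Real.pi) • k, γ))‖ ≤ M := by
      have h1 := toSphere_mem_XS hX
      have := hM r ((freqWeight γ k)⁻¹ * γ) hr (by positivity) 0 (Nat.zero_le _) x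
        ((freqWeight γ k)⁻¹ • (2 * Real.pi) • k)
        (by have := h1.2; unfold toSphere at this; rw [lam_mk] at this
            exact (by norm_num : (1:ℝ) / 2 ≤ 1).trans this.ge)
        (by have := h1.2; unfold toSphere at this; rw [lam_mk] at this
            exact this.le.trans one_le_two)
      rw [norm_iteratedFDeriv_zero] at this
      exact this
    gcongr
    linarith
  · intro κ k
    have := polyDecay_nonneg κ
    have := hl.pos k
    refine (key k κ).1.trans ?_
    gcongr
    linarith
  · intro κ k k'
    have hp := polyDecay_nonneg κ
    have hnn : ‖k' - k‖ = ‖k - k'‖ := norm_sub_rev _ _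
    -- for distant frequencies the size estimates suffice
    rcases le_total (2 * Real.pi * ‖k' - k‖) (freqWeight γ k / 2) with h | h
    · have := ((key k κ).2 (k' - k) h).1
      rw [add_sub_cancel, norm_sub_rev, hnn] at this
      refine this.trans ?_
      have h3 : D * M * (2 * Real.pi * ‖k - k'‖) ≤ (M + 200 * (D * M)) * ‖k - k'‖ := by
        have : D * M * (2 * Real.pi) ≤ M + 200 * (D * M) := by nlinarith
        calc _ = D * M * (2 * Real.pi) * ‖k - k'‖ := by ring
          _ ≤ _ := by gcongr
      gcongr
    · rw [hnn] at h
      have h1 := (key k κ).1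
      have h2 := (key k' κ).1
      have h3 := (abs_le.1 (hl.lip k k')).1
      have h4 : ‖A κ k - A κ k'‖ * (1 + ‖κ‖) ^ 2 ≤
          ‖A κ k‖ * (1 + ‖κ‖) ^ 2 + ‖A κ k'‖ * (1 + ‖κ‖) ^ 2 := by
        rw [← add_mul]
        gcongr
        exact norm_sub_le _ _
      have h5 : freqWeight γ k ≤ 26 * ‖k - k'‖ := by nlinarith [norm_nonneg (k - k')]
      calc _ ≤ D * M * (freqWeight γ k + freqWeight γ k') * polyDecay κ := by linarith
        _ ≤ D * M * (200 * ‖k - k'‖) * polyDecay κ := by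
            gcongr
            linarith [norm_nonneg (k - k')]
        _ = 200 * (D * M) * ‖k - k'‖ * polyDecay κ := by ring
        _ ≤ _ := by gcongr; linarith
  · intro κ k w hw
    have hp := polyDecay_nonneg κ
    have hc0 := hl.large k
    have hsmall : 2 * Real.pi * ‖w‖ ≤ freqWeight γ k / 2 := by
      refine (abs_le_of_sq_le_sq' ?_ (by linarith)).2
      rw [mul_pow]
      calc _ ≤ 40 * freqWeight γ k := by gcongr
        _ ≤ _ := by nlinarith
    have := ((key k κ).2 w hsmall).2
    refine le_of_mul_le_mul_right (this.trans ?_) (hl.pos k)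
    rw [mul_pow]
    calc 2 * (D * M) * ((2 * Real.pi) ^ 2 * ‖w‖ ^ 2) * polyDecay κ
        ≤ 2 * (D * M) * (40 * freqWeight γ k) * polyDecay κ := by gcongr
      _ = 80 * (D * M) * polyDecay κ * freqWeight γ k := by ring
      _ ≤ (M + 200 * (D * M)) * polyDecay κ * freqWeight γ k := by
          have := hl.pos k
          gcongr
          linarith

end IsCompactSymbol
end WRClass

/-! ### A maximum principle for transport equations -/

section Transport

/-- The derivative is nonnegative at a point that is maximal among the points on its left. -/
theorem deriv_nonneg_of_max_left {f : ℝ → ℝ} {d t ε : ℝ} (hf : HasDerivAt f d t) (hε : 0 < ε)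
    (h : ∀ s, t - ε < s → s < t → f s ≤ f t) : 0 ≤ d := by
  have h1 := (hasDerivWithinAt_iff_tendsto_slope' (s := Set.Iio t) (by simp)).1
    hf.hasDerivWithinAt
  refine ge_of_tendsto h1 ?_
  filter_upwards [Ioo_mem_nhdsLT (sub_lt_self t hε)] with s hs
  rw [slope_def_field]
  exact div_nonneg_of_nonpos (by linarith [h s hs.1 hs.2]) (by linarith [hs.2])

variable {ι : Type*} [Fintype ι] [DecidableEq ι]

/-- The barrier `‖x - x₀‖² + ‖ξ - ξ₀‖² + M t`. -/
noncomputable def barrier (x₀ ξ₀ : EuclideanSpace ℝ ι) (M : ℝ)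
    (q : EuclideanSpace ℝ ι × ℝ × EuclideanSpace ℝ ι) : ℝ :=
  ‖q.1 - x₀‖ ^ 2 + ‖q.2.2 - ξ₀‖ ^ 2 + M * q.2.1

theorem hasDerivAt_norm_sq_line (x x₀ : EuclideanSpace ℝ ι) (i : ι) :
    HasDerivAt (fun s : ℝ => ‖x + s • EuclideanSpace.single i (1 : ℝ) - x₀‖ ^ 2)
      (2 * (x i - x₀ i)) 0 := by
  have h : HasDerivAt (fun s : ℝ => x + s • EuclideanSpace.single i (1 : ℝ) - x₀)
      (EuclideanSpace.single i (1 : ℝ)) 0 := by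
    simpa using (((hasDerivAt_id (0 : ℝ)).smul_const
      (EuclideanSpace.single i (1 : ℝ) : EuclideanSpace ℝ ι)).const_add x).sub_const x₀
  have := h.norm_sq
  convert this using 1
  simp [EuclideanSpace.inner_single_right]

/-- A maximum principle for a first order transport equation whose coefficients are merely bounded:
a solution vanishing at time `0` is nonpositive in a neighbourhood of the centre.  The solution is
compared with the multiples `Q (b / R²) ^ k` of the powers of the barrier `b`, which are strict
supersolutions since `M` dominates the transport terms, and `k` tends to infinity.  Continuity of the
coefficients, and hence characteristics, are not needed. -/
theorem transport_nonpos {x₀ ξ₀ : EuclideanSpace ℝ ι} {R C M : ℝ} (hR : 0 < R) (hC : 0 ≤ C)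
    (hM : 4 * Fintype.card ι * C * R < M) {ρ : EuclideanSpace ℝ ι × ℝ × EuclideanSpace ℝ ι → ℝ}
    (hcont : ContinuousOn ρ {q | 0 ≤ q.2.1 ∧ q.2.1 ≤ R ∧ ‖q.1 - x₀‖ ^ 2 + ‖q.2.2 - ξ₀‖ ^ 2 ≤ R ^ 2})
    (h0 : ∀ x ξ, ‖x - x₀‖ ^ 2 + ‖ξ - ξ₀‖ ^ 2 ≤ R ^ 2 → ρ (x, 0, ξ) = 0)
    (heq : ∀ x t ξ, 0 < t → t ≤ R → ‖x - x₀‖ ^ 2 + ‖ξ - ξ₀‖ ^ 2 < R ^ 2 →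
      ∃ (r s v u : ι → ℝ) (τ : ℝ),
        (∀ i, HasDerivAt (fun h : ℝ => ρ (x + h • EuclideanSpace.single i (1 : ℝ), t, ξ)) (r i) 0) ∧
        (∀ i, HasDerivAt (fun h : ℝ => ρ (x, t, ξ + h • EuclideanSpace.single i (1 : ℝ))) (s i) 0) ∧
        HasDerivAt (fun t' : ℝ => ρ (x, t', ξ)) τ t ∧
        (∀ i, |v i| ≤ C ∧ |u i| ≤ C) ∧ τ + ∑ i, (r i * v i - s i * u i) = 0)
    {q : EuclideanSpace ℝ ι × ℝ × EuclideanSpace ℝ ι} (hq0 : 0 ≤ q.2.1) (hq1 : q.2.1 ≤ R)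
    (hq : barrier x₀ ξ₀ M q < R ^ 2) :
    ρ q ≤ 0 := by
  set D : Set (EuclideanSpace ℝ ι × ℝ × EuclideanSpace ℝ ι) :=
    {q | 0 ≤ q.2.1 ∧ q.2.1 ≤ R ∧ ‖q.1 - x₀‖ ^ 2 + ‖q.2.2 - ξ₀‖ ^ 2 ≤ R ^ 2} with hD
  have hM0 : 0 < M := lt_of_le_of_lt (by positivity) hM
  have hDc : IsCompact D := by
    have hcl : IsClosed D := by
      have c1 : Continuous fun q : EuclideanSpace ℝ ι × ℝ × EuclideanSpace ℝ ι => q.2.1 := by fun_prop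
      have c2 : Continuous fun q : EuclideanSpace ℝ ι × ℝ × EuclideanSpace ℝ ι =>
        ‖q.1 - x₀‖ ^ 2 + ‖q.2.2 - ξ₀‖ ^ 2 := by fun_prop
      exact (isClosed_le continuous_const c1).inter ((isClosed_le c1 continuous_const).inter
        (isClosed_le c2 continuous_const))
    refine ((isCompact_closedBall x₀ R).prod ((isCompact_Icc (a := (0 : ℝ)) (b := R)).prod
      (isCompact_closedBall ξ₀ R))).of_isClosed_subset hcl ?_
    rintro ⟨x, t, ξ⟩ ⟨h1, h2, h3⟩
    refine ⟨?_, ⟨h1, h2⟩, ?_⟩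
    · rw [Metric.mem_closedBall, dist_eq_norm]
      refine (abs_le_of_sq_le_sq' ?_ hR.le).2
      linarith [sq_nonneg ‖ξ - ξ₀‖]
    · rw [Metric.mem_closedBall, dist_eq_norm]
      refine (abs_le_of_sq_le_sq' ?_ hR.le).2
      linarith [sq_nonneg ‖x - x₀‖]
  have hb0 : ∀ q ∈ D, 0 ≤ barrier x₀ ξ₀ M q := fun q hq => by
    have := mul_nonneg hM0.le hq.1
    unfold barrier; positivity
  have hqD : q ∈ D := by
    refine ⟨hq0, hq1, ?_⟩
    have := mul_nonneg hM0.le hq0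
    unfold barrier at hq
    linarith
  obtain ⟨Q₀, hQ₀⟩ := hDc.exists_bound_of_continuousOn hcont
  set Q := |Q₀| + 1 with hQ
  have hQ0 : 0 < Q := by positivity
  have hQb : ∀ q ∈ D, ρ q ≤ Q := fun q hq => by
    have := (le_abs_self _).trans (hQ₀ q hq)
    linarith [le_abs_self Q₀]
  have hR2 : 0 < R ^ 2 := by positivity
  have hbc : Continuous (barrier x₀ ξ₀ M) := by unfold barrier; fun_prop
  -- comparison with the `k`-th barrier
  have key : ∀ k : ℕ, ρ q ≤ Q / (R ^ 2) ^ (k + 1) * barrier x₀ ξ₀ M q ^ (k + 1) := by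
    intro k
    set c := Q / (R ^ 2) ^ (k + 1) with hc
    have hc0 : 0 < c := by positivity
    have hΦc : ContinuousOn (fun q => ρ q - c * barrier x₀ ξ₀ M q ^ (k + 1)) D := by fun_prop
    obtain ⟨z, hzD, hz⟩ := hDc.exists_isMaxOn ⟨q, hqD⟩ hΦc
    have hmax : ∀ y ∈ D, ρ y - c * barrier x₀ ξ₀ M y ^ (k + 1) ≤
      ρ z - c * barrier x₀ ξ₀ M z ^ (k + 1) := fun y hy => hz hy
    suffices hz0 : ρ z - c * barrier x₀ ξ₀ M z ^ (k + 1) ≤ 0 by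
      linarith [hmax q hqD]
    obtain ⟨x, t, ξ⟩ := z
    obtain ⟨ht0, htR, hxR⟩ := hzD
    dsimp only at ht0 htR hxR
    have hbz := hb0 (x, t, ξ) ⟨ht0, htR, hxR⟩
    rcases ht0.eq_or_lt with ht | ht
    · subst ht
      rw [h0 x ξ hxR]
      have : 0 ≤ c * barrier x₀ ξ₀ M (x, 0, ξ) ^ (k + 1) := by positivity
      linarith
    rcases hxR.eq_or_lt with hx | hx
    · have h1 : R ^ 2 ≤ barrier x₀ ξ₀ M (x, t, ξ) := by
        unfold barrier
        have := mul_nonneg hM0.le ht.le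
        dsimp only
        linarith
      have h2 : Q ≤ c * barrier x₀ ξ₀ M (x, t, ξ) ^ (k + 1) := by
        calc Q = c * (R ^ 2) ^ (k + 1) := by rw [hc, div_mul_cancel₀ _ (by positivity)]
          _ ≤ _ := by gcongr
      linarith [hQb (x, t, ξ) ⟨ht.le, htR, hxR⟩]
    -- a maximum elsewhere contradicts the equation
    exfalso
    obtain ⟨r, s, v, u, τ, hr, hs, hτ, hvu, he⟩ := heq x t ξ ht htR hx
    set B := barrier x₀ ξ₀ M (x, t, ξ) with hB
    have hBpos : 0 < B := by
      have : 0 < M * t := by positivity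
      rw [hB]; unfold barrier; dsimp only; positivity
    set κ := c * ((k + 1 : ℕ) * B ^ k) with hκ
    have hκ0 : 0 < κ := by positivity
    have hri : ∀ i, r i = κ * (2 * (x i - x₀ i)) := by
      intro i
      have hb : HasDerivAt (fun h : ℝ =>
          barrier x₀ ξ₀ M (x + h • EuclideanSpace.single i (1 : ℝ), t, ξ)) (2 * (x i - x₀ i)) 0 := by
        simp only [barrier]
        exact ((hasDerivAt_norm_sq_line x x₀ i).add_const _).add_const _
      have hΦ := (hr i).sub ((hb.pow (k + 1)).const_mul c)
      have hloc : IsLocalMax (fun h : ℝ => ρ (x + h • EuclideanSpace.single i (1 : ℝ), t, ξ) -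
          c * barrier x₀ ξ₀ M (x + h • EuclideanSpace.single i (1 : ℝ), t, ξ) ^ (k + 1)) 0 := by
        have hev : ∀ᶠ h : ℝ in nhds 0,
            ‖x + h • EuclideanSpace.single i (1 : ℝ) - x₀‖ ^ 2 + ‖ξ - ξ₀‖ ^ 2 < R ^ 2 := by
          have hcn : Continuous fun h : ℝ =>
            ‖x + h • (EuclideanSpace.single i (1 : ℝ) : EuclideanSpace ℝ ι) - x₀‖ ^ 2 + ‖ξ - ξ₀‖ ^ 2 := by fun_prop
          exact hcn.continuousAt.eventually_lt continuousAt_const (by simpa using hx)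
        filter_upwards [hev] with h hh
        have := hmax (x + h • EuclideanSpace.single i (1 : ℝ), t, ξ) ⟨ht.le, htR, hh.le⟩
        simpa using this
      have := hloc.hasDerivAt_eq_zero hΦ
      simp only [zero_smul, add_zero, Nat.add_sub_cancel] at this
      rw [hκ]
      linarith
    have hsi : ∀ i, s i = κ * (2 * (ξ i - ξ₀ i)) := by
      intro i
      have hb : HasDerivAt (fun h : ℝ =>
          barrier x₀ ξ₀ M (x, t, ξ + h • EuclideanSpace.single i (1 : ℝ))) (2 * (ξ i - ξ₀ i)) 0 := by
        simp only [barrier]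
        exact ((hasDerivAt_norm_sq_line ξ ξ₀ i).const_add _).add_const _
      have hΦ := (hs i).sub ((hb.pow (k + 1)).const_mul c)
      have hloc : IsLocalMax (fun h : ℝ => ρ (x, t, ξ + h • EuclideanSpace.single i (1 : ℝ)) -
          c * barrier x₀ ξ₀ M (x, t, ξ + h • EuclideanSpace.single i (1 : ℝ)) ^ (k + 1)) 0 := by
        have hev : ∀ᶠ h : ℝ in nhds 0,
            ‖x - x₀‖ ^ 2 + ‖ξ + h • EuclideanSpace.single i (1 : ℝ) - ξ₀‖ ^ 2 < R ^ 2 := by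
          have hcn : Continuous fun h : ℝ =>
            ‖x - x₀‖ ^ 2 + ‖ξ + h • (EuclideanSpace.single i (1 : ℝ) : EuclideanSpace ℝ ι) - ξ₀‖ ^ 2 := by fun_prop
          exact hcn.continuousAt.eventually_lt continuousAt_const (by simpa using hx)
        filter_upwards [hev] with h hh
        have := hmax (x, t, ξ + h • EuclideanSpace.single i (1 : ℝ)) ⟨ht.le, htR, hh.le⟩
        simpa using this
      have := hloc.hasDerivAt_eq_zero hΦ
      simp only [zero_smul, add_zero, Nat.add_sub_cancel] at this
      rw [hκ]
      linarith
    have hτi : κ * M ≤ τ := by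
      have hb : HasDerivAt (fun t' : ℝ => barrier x₀ ξ₀ M (x, t', ξ)) M t := by
        unfold barrier
        simpa using ((hasDerivAt_id t).const_mul M).const_add (‖x - x₀‖ ^ 2 + ‖ξ - ξ₀‖ ^ 2)
      have hΦ := hτ.sub ((hb.pow (k + 1)).const_mul c)
      have := deriv_nonneg_of_max_left hΦ ht fun t' h1 h2 =>
        hmax (x, t', ξ) ⟨by dsimp only; linarith, by dsimp only; linarith, hxR⟩
      simp only [Nat.add_sub_cancel] at this
      rw [hκ]
      linarith
    have hcoord : ∀ (y y₀ : EuclideanSpace ℝ ι) (i : ι), ‖y - y₀‖ ^ 2 ≤ R ^ 2 → |y i - y₀ i| ≤ R := by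
      intro y y₀ i h
      have h1 : ‖(y - y₀) i‖ ≤ ‖y - y₀‖ := PiLp.norm_apply_le _ _
      exact h1.trans (abs_le_of_sq_le_sq' h hR.le).2
    have hsum : -(4 * Fintype.card ι * C * R) ≤
        ∑ i, (2 * (x i - x₀ i) * v i - 2 * (ξ i - ξ₀ i) * u i) := by
      have : ∀ i ∈ Finset.univ, -(4 * C * R) ≤
          2 * (x i - x₀ i) * v i - 2 * (ξ i - ξ₀ i) * u i := by
        intro i _
        have a1 := hcoord x x₀ i (by linarith [sq_nonneg ‖ξ - ξ₀‖])
        have a2 := hcoord ξ ξ₀ i (by linarith [sq_nonneg ‖x - x₀‖])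
        have b1 : |(x i - x₀ i) * v i| ≤ R * C := by
          rw [abs_mul]; exact mul_le_mul a1 (hvu i).1 (abs_nonneg _) hR.le
        have b2 : |(ξ i - ξ₀ i) * u i| ≤ R * C := by
          rw [abs_mul]; exact mul_le_mul a2 (hvu i).2 (abs_nonneg _) hR.le
        have c1 := (abs_le.1 b1).1
        have c2 := (abs_le.1 b2).2
        linarith
      have h2 := Finset.card_nsmul_le_sum _ _ _ this
      rw [nsmul_eq_mul, Finset.card_univ] at h2
      linarith
    have hfin : ∑ i, (r i * v i - s i * u i) =
        κ * ∑ i, (2 * (x i - x₀ i) * v i - 2 * (ξ i - ξ₀ i) * u i) := by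
      rw [Finset.mul_sum]
      refine Finset.sum_congr rfl fun i _ => ?_
      rw [hri, hsi]; ring
    rw [hfin] at he
    have : 0 < κ * (M + ∑ i, (2 * (x i - x₀ i) * v i - 2 * (ξ i - ξ₀ i) * u i)) :=
      mul_pos hκ0 (by linarith)
    linarith
  have hlim : Filter.Tendsto (fun k : ℕ => Q * (barrier x₀ ξ₀ M q / R ^ 2) ^ (k + 1)) Filter.atTop
      (nhds (Q * 0)) := by
    refine Filter.Tendsto.const_mul Q ?_
    exact (tendsto_pow_atTop_nhds_zero_of_lt_one (div_nonneg (hb0 q hqD) hR2.le)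
      ((div_lt_one hR2).2 hq)).comp (Filter.tendsto_add_atTop_nat 1)
  rw [mul_zero] at hlim
  refine ge_of_tendsto' hlim fun k => (key k).trans (le_of_eq ?_)
  rw [div_pow]; ring

end Transport

/-! ### Diagonal entries and coordinate lines -/

namespace WRClass
variable {m n p : ℕ}

/-- The set `x_d ≥ 0`, `γ ≥ 0`; unlike `𝕏`, it is convex. -/
def quarterSpace (m : ℕ) : Set (Phase m) := {X | 0 ≤ xd X ∧ 0 ≤ gam X}

theorem convex_quarterSpace : Convex ℝ (quarterSpace m) := by
  rintro X ⟨h1, h2⟩ Y ⟨h3, h4⟩ a b ha hb -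
  exact ⟨add_nonneg (mul_nonneg ha h1) (mul_nonneg hb h3),
    add_nonneg (mul_nonneg ha h2) (mul_nonneg hb h4)⟩

theorem isOpen_lam_pos : IsOpen {X : Phase m | 0 < lam X} :=
  isOpen_lt continuous_const continuous_lam

/-- Near a point with nonzero frequency, `V ∩ 𝕏` is the quarter space. -/
theorem nhdsWithin_quarterSpace {V : Set (Phase m)} (hV : IsOpen V) {X : Phase m} (hX : X ∈ V)
    (hl : 0 < lam X) : nhdsWithin X (quarterSpace m) = nhdsWithin X (V ∩ XX m) := by
  have h : V ∩ XX m = quarterSpace m ∩ (V ∩ {X | 0 < lam X}) := by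
    ext Y
    exact ⟨fun h => ⟨⟨h.2.1, h.2.2.1⟩, h.1, lam_pos h.2⟩,
      fun h => ⟨h.2.1, mem_XX_of_lam_pos h.1.1 h.1.2 h.2.2⟩⟩
  rw [h]
  exact (nhdsWithin_inter_of_mem' (mem_nhdsWithin_of_mem_nhds
    ((hV.inter isOpen_lam_pos).mem_nhds ⟨hX, hl⟩))).symm

theorem MatSmoothOn.mul {E : Type*} [NormedAddCommGroup E] [NormedSpace ℝ E] {k l r : ℕ}
    {A : E → Matrix (Fin k) (Fin l) ℂ} {B : E → Matrix (Fin l) (Fin r) ℂ} {s : Set E}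
    (hA : MatSmoothOn A s) (hB : MatSmoothOn B s) : MatSmoothOn (fun X => A X * B X) s := by
  intro i j
  simp only [Matrix.mul_apply]
  exact ContDiffOn.sum fun k _ => (hA i k).mul (hB k j)

section Eigenvalues
variable {V : Set (Phase m)} {a frame : Phase m → Matrix (Fin n) (Fin n) ℂ}
  {eig : Fin n → Phase m → ℂ}

/-- The diagonal entries of a smoothly diagonalized matrix are locally Lipschitz functions: an entry
is the quotient of the corresponding entries of `a * frame` and `frame`. -/
theorem exists_lipschitzOn_eig (hV : IsOpen V) (ha : MatSmoothOn a (XX m))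
    (hf : MatSmoothOn frame (V ∩ XX m)) (hu : ∀ X ∈ V ∩ XX m, IsUnit (frame X).det)
    (hd : ∀ X ∈ V ∩ XX m, (frame X)⁻¹ * a X * frame X = Matrix.diagonal fun j => eig j X)
    {X₀ : Phase m} (h0 : X₀ ∈ V ∩ XX m) (j : Fin n) :
    ∃ K : NNReal, ∃ U : Set (Phase m), IsOpen U ∧ X₀ ∈ U ∧
      LipschitzOnWith K (eig j) (U ∩ quarterSpace m) := by
  obtain ⟨i, hi⟩ : ∃ i, frame X₀ i j ≠ 0 := by
    by_contra! h
    exact (hu X₀ h0).ne_zero (Matrix.det_eq_zero_of_column_eq_zero j h)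
  have hmul : ∀ X ∈ V ∩ XX m, (a X * frame X) i j = frame X i j * eig j X := by
    intro X hX
    have h1 : a X * frame X = frame X * Matrix.diagonal fun j => eig j X := by
      rw [← hd X hX, mul_assoc, ← mul_assoc (frame X), Matrix.mul_nonsing_inv _ (hu X hX), one_mul]
    rw [h1, Matrix.mul_diagonal]
  have hnum : MatSmoothOn (fun X => a X * frame X) (V ∩ XX m) :=
    MatSmoothOn.mul (fun i j => (ha i j).mono Set.inter_subset_right) hf
  have hc : ContDiffWithinAt ℝ 1 (eig j) (V ∩ XX m) X₀ := by
    have e1 : ContDiffWithinAt ℝ ∞ (fun X => (a X * frame X) i j) (V ∩ XX m) X₀ := hnum i j X₀ h0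
    have e2 : ContDiffWithinAt ℝ ∞ (fun X => frame X i j) (V ∩ XX m) X₀ := hf i j X₀ h0
    have h1 : ContDiffWithinAt ℝ 1 (fun X => (a X * frame X) i j / frame X i j) (V ∩ XX m) X₀ :=
      (e1.of_le (by simp)).mul ((e2.of_le (by simp)).inv hi)
    refine h1.congr_of_eventuallyEq ?_ ?_
    · have h2 : ∀ᶠ X in nhdsWithin X₀ (V ∩ XX m), frame X i j ≠ 0 :=
        (hf i j X₀ h0).continuousWithinAt.eventually_ne hi
      filter_upwards [h2, self_mem_nhdsWithin] with X h3 h4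
      rw [hmul X h4, mul_div_cancel_left₀ _ h3]
    · rw [hmul X₀ h0, mul_div_cancel_left₀ _ hi]
  have hc' : ContDiffWithinAt ℝ 1 (eig j) (quarterSpace m) X₀ := by
    refine (contDiffWithinAt_congr_set ?_).1 hc
    exact nhdsWithin_eq_iff_eventuallyEq.1 (nhdsWithin_quarterSpace hV h0.1 (lam_pos h0.2)).symm
  obtain ⟨K, t, ht, hK⟩ := hc'.exists_lipschitzOnWith convex_quarterSpace
  obtain ⟨U, hU, hXU, hUt⟩ := mem_nhdsWithin.1 ht
  exact ⟨K, U, hU, hXU, hK.mono hUt⟩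

/-- Where two diagonalizations of the same matrix exist, their diagonal entries agree. -/
theorem exists_eq_of_diagonal {A e f : Matrix (Fin n) (Fin n) ℂ} {μ ν : Fin n → ℂ}
    (he : IsUnit e.det) (hf : IsUnit f.det) (h1 : e⁻¹ * A * e = Matrix.diagonal μ)
    (h2 : f⁻¹ * A * f = Matrix.diagonal ν) (j : Fin n) : ∃ k, ν j = μ k := by
  have hN : IsUnit (e⁻¹ * f).det := by
    rw [Matrix.det_mul]
    exact (Matrix.isUnit_nonsing_inv_det e he).mul hf
  have hcomm : Matrix.diagonal μ * (e⁻¹ * f) = (e⁻¹ * f) * Matrix.diagonal ν := by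
    rw [← h1, ← h2]
    simp only [mul_assoc]
    rw [Matrix.mul_nonsing_inv_cancel_left e _ he, Matrix.mul_nonsing_inv_cancel_left f _ hf]
  obtain ⟨k, hk⟩ : ∃ k, (e⁻¹ * f) k j ≠ 0 := by
    by_contra! h
    exact hN.ne_zero (Matrix.det_eq_zero_of_column_eq_zero j h)
  have := congrFun (congrFun hcomm k) j
  rw [Matrix.diagonal_mul, Matrix.mul_diagonal, mul_comm] at this
  exact ⟨k, (mul_left_cancel₀ hk this).symm⟩

/-- The derivative of a Lipschitz function along a line is bounded, including at points where the
derivative does not exist and `deriv` is zero. -/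
theorem norm_deriv_line_le {f : Phase m → ℂ} {K : NNReal} {U : Set (Phase m)} (hU : IsOpen U)
    (hK : LipschitzOnWith K f (U ∩ quarterSpace m)) {l : ℝ → Phase m} (hl : LipschitzWith 1 l)
    (hq : ∀ s, l s ∈ quarterSpace m) (h0 : l 0 ∈ U) : ‖deriv (fun s => f (l s)) 0‖ ≤ K := by
  have hn : l ⁻¹' U ∈ nhds (0 : ℝ) := hl.continuous.continuousAt.preimage_mem_nhds (hU.mem_nhds h0)
  have hL : LipschitzOnWith K (fun s => f (l s)) (l ⁻¹' U) := by
    have := hK.comp (hl.lipschitzOnWith (s := l ⁻¹' U)) fun s hs => ⟨hs, hq s⟩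
    rwa [mul_one] at this
  exact norm_deriv_le_of_lipschitzOn hn hL

theorem deriv_im_eq_zero {f : ℝ → ℂ} {x : ℝ} (h : ∀ᶠ s in nhds x, (f s).im = 0) :
    (deriv f x).im = 0 := by
  by_cases hf : DifferentiableAt ℝ f x
  · have h1 := Complex.imCLM.hasFDerivAt.comp_hasDerivAt x hf.hasDerivAt
    have h2 : (fun s => Complex.imCLM (f s)) =ᶠ[nhds x] fun _ => 0 := by
      filter_upwards [h] with s hs using hs
    exact h1.unique ((hasDerivAt_const x (0 : ℝ)).congr_of_eventuallyEq h2)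
  · rw [deriv_zero_of_not_differentiableAt hf, Complex.zero_im]

end Eigenvalues

/-- The line through `X` along the `i`-th tangential variable. -/
noncomputable def tanLine (X : Phase m) (i : Fin (m + 1)) (s : ℝ) : Phase m :=
  (tan X + s • EuclideanSpace.single i (1 : ℝ), xd X, cov X, gam X)

/-- The line through `X` along the `i`-th tangential covariable. -/
noncomputable def covLine (X : Phase m) (i : Fin (m + 1)) (s : ℝ) : Phase m :=
  (tan X, xd X, cov X + s • EuclideanSpace.single i (1 : ℝ), gam X)

theorem tanLine_zero (X : Phase m) (i : Fin (m + 1)) : tanLine X i 0 = X := by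
  simp [tanLine, tan, xd, cov, gam]

theorem covLine_zero (X : Phase m) (i : Fin (m + 1)) : covLine X i 0 = X := by
  simp [covLine, tan, xd, cov, gam]

theorem contDiff_tanLine (X : Phase m) (i : Fin (m + 1)) : ContDiff ℝ ∞ (tanLine X i) := by
  unfold tanLine; fun_prop

theorem contDiff_covLine (X : Phase m) (i : Fin (m + 1)) : ContDiff ℝ ∞ (covLine X i) := by
  unfold covLine; fun_prop

theorem lipschitz_tanLine (X : Phase m) (i : Fin (m + 1)) : LipschitzWith 1 (tanLine X i) := by
  refine LipschitzWith.of_dist_le_mul fun s t => ?_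
  simp [tanLine, dist_eq_norm, ← sub_smul, norm_smul]

theorem lipschitz_covLine (X : Phase m) (i : Fin (m + 1)) : LipschitzWith 1 (covLine X i) := by
  refine LipschitzWith.of_dist_le_mul fun s t => ?_
  simp [covLine, dist_eq_norm, ← sub_smul, norm_smul]

theorem hasDerivAt_re {f : ℝ → ℂ} {x : ℝ} {d : ℂ} (h : HasDerivAt f d x) :
    HasDerivAt (fun s => (f s).re) d.re x :=
  Complex.reCLM.hasFDerivAt.comp_hasDerivAt x h

theorem hasDerivAt_comp_line {f : Phase m → ℂ} {V : Set (Phase m)} (hV : IsOpen V)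
    (hf : ContDiffOn ℝ ∞ f (V ∩ XX m)) {l : ℝ → Phase m} (hl : ContDiff ℝ ∞ l) {s₀ : ℝ}
    (hq : ∀ᶠ s in nhds s₀, l s ∈ quarterSpace m) (h0 : l s₀ ∈ V) (hp : 0 < lam (l s₀)) :
    HasDerivAt (fun s => f (l s)) (deriv (fun s => f (l s)) s₀) s₀ := by
  have hn : l ⁻¹' (V ∩ XX m) ∈ nhds s₀ := by
    filter_upwards [hq, hl.continuous.continuousAt.preimage_mem_nhds
      ((hV.inter isOpen_lam_pos).mem_nhds ⟨h0, hp⟩)] with s h1 h2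
    exact ⟨h2.1, mem_XX_of_lam_pos h1.1 h1.2 h2.2⟩
  have hc : ContDiffAt ℝ ∞ (fun s => f (l s)) s₀ :=
    (hf.comp hl.contDiffOn (fun s hs => hs)).contDiffAt hn
  exact (hc.differentiableAt (by simp)).hasDerivAt

end WRClass

/-! ### The real part of the transported symbols -/

namespace WRClass
variable {m n p : ℕ} {S : BVP m n p} {V : Set (Phase m)}

namespace LopatinskiSymbol
variable (L : LopatinskiSymbol S V)

/-- Near a point of the hyperbolic region the eigenvalues are real for `γ = 0`, whichever
diagonalization they come from. -/
theorem eventually_eig_im_eq_zero (hV : IsOpen V) {X₀ : Phase m} (h0 : X₀ ∈ V)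
    (hX : X₀ ∈ hypRegion S.a) (j : Fin n) :
    ∀ᶠ X in nhds X₀, X ∈ XX m → gam X = 0 → (L.eig j X).im = 0 := by
  obtain ⟨hX1, hX2, V₁, e, μ, hV1, hm1, he, hd, hr⟩ := hX
  filter_upwards [(hV.inter hV1).mem_nhds ⟨h0, hm1⟩] with X hXV hXX hg
  obtain ⟨k, hk⟩ := exists_eq_of_diagonal (hd X ⟨hXV.2, hXX⟩).1 (L.frame_unit X ⟨hXV.1, hXX⟩)
    (hd X ⟨hXV.2, hXX⟩).2 (L.frame_diag X ⟨hXV.1, hXX⟩) j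
  rw [hk]
  exact (hr X ⟨hXV.2, hXX⟩ hg k).1

theorem re_lopDelta (om : Phase m → ℝ) (X : Phase m) : (lopDelta om X).re = gam X / lam X := by
  rw [lopDelta, Complex.div_ofReal_re]
  simp

/-- The functions `δ_j` are purely imaginary for `γ = 0`, near a point of the hyperbolic region:
their real part solves a transport equation with real bounded coefficients, and vanishes on the
boundary. -/
theorem eventually_entry_re_eq_zero (hV : IsOpen V) {X₀ : Phase m} (h0 : X₀ ∈ V) (hY : X₀ ∈ YY m)
    (hX : X₀ ∈ hypRegion S.a) {j : Fin n} (hj : (j : ℕ) < L.s) :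
    ∀ᶠ X in nhds X₀, X ∈ XX m → gam X = 0 → (L.entry j X).re = 0 := by
  have hg0 : gam X₀ = 0 := hX.2.1
  have hx0 : xd X₀ = 0 := hY.2
  obtain ⟨K, U, hU, hXU, hK⟩ := exists_lipschitzOn_eig hV S.a_smooth L.frame_smooth L.frame_unit
    L.frame_diag ⟨h0, hX.1⟩ j
  obtain ⟨ε, hε, hball⟩ := Metric.eventually_nhds_iff_ball.1
    ((L.eventually_eig_im_eq_zero hV h0 hX j).and
      ((hV.inter (hU.inter isOpen_lam_pos)).eventually_mem ⟨h0, hXU, lam_pos hX.1⟩))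
  set R := ε / 2 with hR
  have hR0 : 0 < R := by positivity
  set D : Set (Tan m × ℝ × Tan m) :=
    {q | 0 ≤ q.2.1 ∧ q.2.1 ≤ R ∧ ‖q.1 - tan X₀‖ ^ 2 + ‖q.2.2 - cov X₀‖ ^ 2 ≤ R ^ 2} with hD
  set emb : Tan m × ℝ × Tan m → Phase m := fun q => (q.1, q.2.1, q.2.2, 0) with hemb
  have hDb : ∀ q ∈ D, emb q ∈ Metric.ball X₀ ε := by
    rintro ⟨x, t, ξ⟩ ⟨h1, h2, h3⟩
    dsimp only at h1 h2 h3
    have e1 : ‖x - tan X₀‖ ≤ R :=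
      (abs_le_of_sq_le_sq' (by linarith [sq_nonneg ‖ξ - cov X₀‖]) hR0.le).2
    have e2 : ‖ξ - cov X₀‖ ≤ R :=
      (abs_le_of_sq_le_sq' (by linarith [sq_nonneg ‖x - tan X₀‖]) hR0.le).2
    have hlt : R < ε := by rw [hR]; linarith
    rw [Metric.mem_ball, Prod.dist_eq, Prod.dist_eq, Prod.dist_eq]
    refine max_lt ?_ (max_lt ?_ (max_lt ?_ ?_))
    · rw [dist_eq_norm]; exact e1.trans_lt hlt
    · change dist t (xd X₀) < ε
      rw [hx0, Real.dist_eq, sub_zero, abs_of_nonneg h1]; linarith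
    · rw [dist_eq_norm]; exact e2.trans_lt hlt
    · change dist (0 : ℝ) (gam X₀) < ε
      rw [hg0, dist_self]; exact hε
  have hDX : ∀ q ∈ D, emb q ∈ XX m := fun q hq =>
    mem_XX_of_lam_pos hq.1 le_rfl (hball _ (hDb q hq)).2.2.2
  have hcont : ContinuousOn (fun q => (L.entry j (emb q)).re) D := by
    have := (L.entry_smooth j hj).continuousOn
    refine Complex.continuous_re.comp_continuousOn (this.comp (by fun_prop) fun q hq => ?_)
    exact ⟨(hball _ (hDb q hq)).2.1, hDX q hq⟩
  have hbd : ∀ x ξ, ‖x - tan X₀‖ ^ 2 + ‖ξ - cov X₀‖ ^ 2 ≤ R ^ 2 →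
      (L.entry j (emb (x, 0, ξ))).re = 0 := by
    intro x ξ h
    have hq : ((x, 0, ξ) : Tan m × ℝ × Tan m) ∈ D := ⟨le_rfl, hR0.le, h⟩
    rw [L.boundary_value j hj _ ⟨(hball _ (hDb _ hq)).2.1, hDX _ hq, rfl⟩, re_lopDelta]
    simp [hemb, gam]
  have heq : ∀ x t ξ, 0 < t → t ≤ R → ‖x - tan X₀‖ ^ 2 + ‖ξ - cov X₀‖ ^ 2 < R ^ 2 →
      ∃ (r s v u : Fin (m + 1) → ℝ) (τ : ℝ),
        (∀ i, HasDerivAt (fun h : ℝ =>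
          (L.entry j (emb (x + h • EuclideanSpace.single i (1 : ℝ), t, ξ))).re) (r i) 0) ∧
        (∀ i, HasDerivAt (fun h : ℝ =>
          (L.entry j (emb (x, t, ξ + h • EuclideanSpace.single i (1 : ℝ)))).re) (s i) 0) ∧
        HasDerivAt (fun t' : ℝ => (L.entry j (emb (x, t', ξ))).re) τ t ∧
        (∀ i, |v i| ≤ K ∧ |u i| ≤ K) ∧ τ + ∑ i, (r i * v i - s i * u i) = 0 := by
    intro x t ξ ht htR hx
    have hq : ((x, t, ξ) : Tan m × ℝ × Tan m) ∈ D := ⟨ht.le, htR, hx.le⟩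
    set X : Phase m := emb (x, t, ξ) with hXdef
    have hXb := hDb _ hq
    obtain ⟨-, hXV, hXU', hXl⟩ := hball _ hXb
    have hXX := hDX _ hq
    have hqT : ∀ i s, tanLine X i s ∈ quarterSpace m := fun i s => ⟨ht.le, le_rfl⟩
    have hqC : ∀ i s, covLine X i s ∈ quarterSpace m := fun i s => ⟨ht.le, le_rfl⟩
    have hT0 : ∀ i, tanLine X i 0 ∈ U := fun i => by rw [tanLine_zero]; exact hXU'
    have hC0 : ∀ i, covLine X i 0 ∈ U := fun i => by rw [covLine_zero]; exact hXU'
    have hT : ∀ i, (dTan i (L.eig j) X).im = 0 := by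
      intro i
      refine deriv_im_eq_zero ?_
      have hn : (tanLine X i) ⁻¹' Metric.ball X₀ ε ∈ nhds (0 : ℝ) :=
        (contDiff_tanLine X i).continuous.continuousAt.preimage_mem_nhds
          (Metric.isOpen_ball.mem_nhds (by rw [tanLine_zero]; exact hXb))
      filter_upwards [hn] with s hs
      have h1 := hball _ hs
      exact h1.1 (mem_XX_of_lam_pos (hqT i s).1 (hqT i s).2 h1.2.2.2) rfl
    have hC : ∀ i, (dCov i (L.eig j) X).im = 0 := by
      intro i
      refine deriv_im_eq_zero ?_
      have hn : (covLine X i) ⁻¹' Metric.ball X₀ ε ∈ nhds (0 : ℝ) :=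
        (contDiff_covLine X i).continuous.continuousAt.preimage_mem_nhds
          (Metric.isOpen_ball.mem_nhds (by rw [covLine_zero]; exact hXb))
      filter_upwards [hn] with s hs
      have h1 := hball _ hs
      exact h1.1 (mem_XX_of_lam_pos (hqC i s).1 (hqC i s).2 h1.2.2.2) rfl
    refine ⟨fun i => (dTan i (L.entry j) X).re, fun i => (dCov i (L.entry j) X).re,
      fun i => (dCov i (L.eig j) X).re, fun i => (dTan i (L.eig j) X).re,
      (dXd (L.entry j) X).re, fun i => ?_, fun i => ?_, ?_, fun i => ⟨?_, ?_⟩, ?_⟩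
    · exact hasDerivAt_re (hasDerivAt_comp_line hV (L.entry_smooth j hj) (contDiff_tanLine X i)
        (Filter.Eventually.of_forall (hqT i)) (by rw [tanLine_zero]; exact hXV)
        (by rw [tanLine_zero]; exact hXl))
    · exact hasDerivAt_re (hasDerivAt_comp_line hV (L.entry_smooth j hj) (contDiff_covLine X i)
        (Filter.Eventually.of_forall (hqC i)) (by rw [covLine_zero]; exact hXV)
        (by rw [covLine_zero]; exact hXl))
    · have h1 := hasDerivAt_comp_line hV (L.entry_smooth j hj)
        (l := fun t' : ℝ => (emb (x, t', ξ))) (s₀ := t) (by rw [hemb]; fun_prop)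
        (by filter_upwards [Ioi_mem_nhds ht] with s hs using ⟨le_of_lt hs, le_rfl⟩) hXV hXl
      have h2 : dXd (L.entry j) X = deriv (fun t' => L.entry j (emb (x, t', ξ))) t :=
        derivWithin_of_mem_nhds (Ici_mem_nhds ht)
      rw [h2]
      exact hasDerivAt_re h1
    · exact (Complex.abs_re_le_norm _).trans (norm_deriv_line_le hU hK (lipschitz_covLine X i)
        (hqC i) (hC0 i))
    · exact (Complex.abs_re_le_norm _).trans (norm_deriv_line_le hU hK (lipschitz_tanLine X i)
        (hqT i) (hT0 i))
    · have h1 := congrArg Complex.re (L.transport j hj X ⟨hXV, hXX⟩)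
      rw [poisson, Complex.add_re, Complex.re_sum, Complex.zero_re] at h1
      rw [← h1]
      congr 1
      refine Finset.sum_congr rfl fun i _ => ?_
      rw [Complex.sub_re, Complex.mul_re, Complex.mul_re, hT, hC]
      ring
  set M : ℝ := 4 * Fintype.card (Fin (m + 1)) * K * R + 1 with hM
  have hM0 : 0 < M := by positivity
  have hev : ∀ᶠ X : Phase m in nhds X₀,
      barrier (tan X₀) (cov X₀) M (tan X, xd X, cov X) < R ^ 2 ∧ xd X ≤ R := by
    have c1 : Continuous fun X : Phase m =>
        barrier (tan X₀) (cov X₀) M (tan X, xd X, cov X) := by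
      unfold barrier tan xd cov; fun_prop
    have c2 : Continuous (xd : Phase m → ℝ) := by unfold xd; fun_prop
    refine (c1.continuousAt.eventually_lt continuousAt_const ?_).and
      ((c2.continuousAt.eventually_lt continuousAt_const ?_).mono fun _ h => le_of_lt h)
    · simp only [barrier, sub_self, norm_zero, hx0]
      norm_num
      positivity
    · rw [hx0]; exact hR0
  filter_upwards [hev] with X hXe hXX hXg
  have hemX : emb (tan X, xd X, cov X) = X := by
    simp only [hemb]; rw [← hXg]; rfl
  -- the maximum principle is applied to the real part and to its opposite
  have h1 := transport_nonpos hR0 K.2 (lt_add_one _) hcont hbd heq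
    (q := (tan X, xd X, cov X)) hXX.1 hXe.2 hXe.1
  have h2 := transport_nonpos (ρ := fun q => -(L.entry j (emb q)).re) hR0 K.2 (lt_add_one _)
    hcont.neg (fun x ξ h => by rw [hbd x ξ h, neg_zero])
    (fun x t ξ ht htR hx => by
      obtain ⟨r, s, v, u, τ, a1, a2, a3, a4, a5⟩ := heq x t ξ ht htR hx
      refine ⟨-r, -s, v, u, -τ, fun i => (a1 i).neg, fun i => (a2 i).neg, a3.neg, a4, ?_⟩
      rw [← neg_eq_zero, neg_add, neg_neg, ← Finset.sum_neg_distrib, ← a5]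
      congr 1
      refine Finset.sum_congr rfl fun i _ => ?_
      simp only [Pi.neg_apply]; ring)
    (q := (tan X, xd X, cov X)) hXX.1 hXe.2 hXe.1
  simp only [hemX] at h1 h2
  linarith

/-- The real part of `δ_j` is at least `γ / 2` near a point of the hyperbolic region: it vanishes for
`γ = 0`, and its derivative in `γ` is `1` at that point, by the boundary condition. -/
theorem eventually_le_entry_re (hV : IsOpen V) {X₀ : Phase m} (h0 : X₀ ∈ V) (hY : X₀ ∈ YY m)
    (hS : X₀ ∈ XS m) (hX : X₀ ∈ hypRegion S.a) {j : Fin n} (hj : (j : ℕ) < L.s) :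
    ∀ᶠ X in nhds X₀, X ∈ XX m → gam X / 2 ≤ (L.entry j X).re := by
  have hg0 : gam X₀ = 0 := hX.2.1
  have hx0 : xd X₀ = 0 := hY.2
  have hc1 : ‖cov X₀‖ = 1 := by
    have := lam_sq X₀
    rw [hS.2, hg0] at this
    have h2 := norm_nonneg (cov X₀)
    nlinarith
  set W := V ∩ XX m with hW
  have hWu : UniqueDiffOn ℝ W := by rw [hW, Set.inter_comm]; exact uniqueDiffOn_XX.inter hV
  have hXW : X₀ ∈ W := ⟨h0, hX.1⟩
  have hsm := L.entry_smooth j hj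
  set e : Phase m := (0, 0, 0, 1) with he
  set F : Phase m → ℝ := fun X => (fderivWithin ℝ (L.entry j) W X e).re with hF
  have hFc : ContinuousOn F W := by
    have := hsm.continuousOn_fderivWithin hWu (by simp)
    exact Complex.continuous_re.comp_continuousOn (this.clm_apply continuousOn_const)
  -- derivatives along the lines on which only `γ` varies
  have hline : ∀ X ∈ W, ∀ s : Set ℝ,
      (∀ᶠ σ in nhdsWithin (gam X) s, ((tan X, xd X, cov X, σ) : Phase m) ∈ W) →
      HasDerivWithinAt (fun σ : ℝ => (L.entry j (tan X, xd X, cov X, σ)).re) (F X) s (gam X) := by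
    intro X hXm s hs
    have h1 := (((hsm X hXm).differentiableWithinAt (by simp)).hasFDerivWithinAt)
    have h2 : HasDerivAt (fun σ : ℝ => ((tan X, xd X, cov X, σ) : Phase m)) e (gam X) :=
      (hasDerivAt_const _ (tan X)).prodMk ((hasDerivAt_const _ (xd X)).prodMk
        ((hasDerivAt_const _ (cov X)).prodMk (hasDerivAt_id _)))
    set t : Set ℝ := {σ | ((tan X, xd X, cov X, σ) : Phase m) ∈ W} with ht
    have h3 := HasFDerivWithinAt.comp_hasDerivWithinAt (gam X) (s := t) (l := L.entry j)
      (t := W) h1 h2.hasDerivWithinAt (fun σ hσ => hσ)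
    have h4 := Complex.reCLM.hasFDerivAt.comp_hasDerivWithinAt (gam X) h3
    exact h4.mono_of_mem_nhdsWithin hs
  have hF1 : F X₀ = 1 := by
    have hev : ∀ᶠ σ in nhdsWithin (gam X₀) (Set.Ici 0),
        ((tan X₀, xd X₀, cov X₀, σ) : Phase m) ∈ W := by
      have hc : Continuous fun σ : ℝ => ((tan X₀, xd X₀, cov X₀, σ) : Phase m) := by fun_prop
      filter_upwards [mem_nhdsWithin_of_mem_nhds (hc.continuousAt.preimage_mem_nhds
        ((hV.inter isOpen_lam_pos).mem_nhds (x := X₀) ⟨h0, lam_pos hX.1⟩)), self_mem_nhdsWithin]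
        with σ h1 h2
      exact ⟨h1.1, mem_XX_of_lam_pos hX.1.1 h2 h1.2⟩
    have h1 := hline X₀ hXW (Set.Ici 0) hev
    rw [hg0] at h1 hev
    -- on the boundary the real part is `γ / λ`, and `‖cov X₀‖ = 1`
    have h2 : HasDerivAt (fun σ : ℝ => σ / √(σ ^ 2 + 1)) 1 0 := by
      have a1 : HasDerivAt (fun σ : ℝ => σ ^ 2 + 1) 0 (0 : ℝ) := by
        simpa using (hasDerivAt_pow 2 (0 : ℝ)).add_const 1
      have a2 := a1.sqrt (by norm_num)
      have a3 := (hasDerivAt_id (0 : ℝ)).div a2 (by norm_num)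
      exact a3.congr_deriv (by simp)
    have h3 : HasDerivWithinAt (fun σ : ℝ => (L.entry j (tan X₀, xd X₀, cov X₀, σ)).re) 1
        (Set.Ici 0) 0 := by
      refine h2.hasDerivWithinAt.congr_of_eventuallyEq_of_mem ?_ Set.self_mem_Ici
      filter_upwards [hev] with σ hσ
      rw [L.boundary_value j hj _ ⟨hσ.1, hσ.2, hx0⟩, re_lopDelta]
      simp only [gam, lam, cov]
      simp only [cov] at hc1
      rw [hc1, one_pow]
    exact ((uniqueDiffOn_Ici (0 : ℝ)) 0 Set.self_mem_Ici).eq_deriv _ h1 h3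
  have hFev : ∀ᶠ X in nhds X₀, X ∈ W → 1 / 2 ≤ F X := by
    rw [← eventually_nhdsWithin_iff]
    have := (hFc X₀ hXW).eventually_const_lt (u := 1 / 2) (by rw [hF1]; norm_num)
    exact this.mono fun _ h => h.le
  obtain ⟨ε, hε, hball⟩ := Metric.eventually_nhds_iff_ball.1
    (((hFev.and ((hV.inter isOpen_lam_pos).eventually_mem ⟨h0, lam_pos hX.1⟩))).and
      (L.eventually_entry_re_eq_zero hV h0 hY hX hj))
  filter_upwards [Metric.ball_mem_nhds X₀ hε] with X hXb hXX
  have hin : ∀ σ ∈ Set.Icc 0 (gam X), ((tan X, xd X, cov X, σ) : Phase m) ∈ Metric.ball X₀ ε := by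
    intro σ hσ
    rw [Metric.mem_ball] at hXb ⊢
    refine lt_of_le_of_lt ?_ hXb
    rw [Prod.dist_eq, Prod.dist_eq, Prod.dist_eq, Prod.dist_eq, Prod.dist_eq, Prod.dist_eq]
    refine max_le_max le_rfl (max_le_max le_rfl (max_le_max le_rfl ?_))
    change dist σ (gam X₀) ≤ dist (gam X) (gam X₀)
    rw [hg0, Real.dist_eq, Real.dist_eq, sub_zero, sub_zero, abs_of_nonneg hσ.1,
      abs_of_nonneg hXX.2.1]
    exact hσ.2
  have hinW : ∀ σ ∈ Set.Icc 0 (gam X), ((tan X, xd X, cov X, σ) : Phase m) ∈ W := fun σ hσ =>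
    ⟨(hball _ (hin σ hσ)).1.2.1,
      mem_XX_of_lam_pos hXX.1 hσ.1 (hball _ (hin σ hσ)).1.2.2⟩
  have hd : ∀ σ ∈ Set.Icc 0 (gam X), HasDerivWithinAt
      (fun σ : ℝ => (L.entry j (tan X, xd X, cov X, σ)).re) (F (tan X, xd X, cov X, σ))
      (Set.Icc 0 (gam X)) σ := fun σ hσ =>
    hline _ (hinW σ hσ) _ (by filter_upwards [self_mem_nhdsWithin] with t ht using hinW t ht)
  have hmv := Convex.mul_sub_le_image_sub_of_le_deriv (convex_Icc 0 (gam X))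
    (f := fun σ : ℝ => (L.entry j (tan X, xd X, cov X, σ)).re) (C := 1 / 2)
    (fun σ hσ => (hd σ hσ).continuousWithinAt)
    (fun σ hσ => ((hd σ (interior_subset hσ)).differentiableWithinAt).mono interior_subset)
    (fun σ hσ => by
      rw [((hd σ (interior_subset hσ)).hasDerivAt (mem_interior_iff_mem_nhds.1 hσ)).deriv]
      exact (hball _ (hin σ (interior_subset hσ))).1.1 (hinW σ (interior_subset hσ)))
    0 ⟨le_rfl, hXX.2.1⟩ (gam X) ⟨hXX.2.1, le_rfl⟩ hXX.2.1
  have hz : (L.entry j (tan X, xd X, cov X, 0)).re = 0 :=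
    (hball _ (hin 0 ⟨le_rfl, hXX.2.1⟩)).2 (hinW 0 ⟨le_rfl, hXX.2.1⟩).2 rfl
  rw [hz] at hmv
  have : (L.entry j X).re = (L.entry j (tan X, xd X, cov X, gam X)).re := rfl
  rw [this]
  linarith

/-- A conic neighbourhood in which the symbols `δ_j` have real part at least `γ / (2 λ)`. -/
theorem exists_conicNhd {X₀ : Phase m} (hV : IsConicNhd V X₀) (hY : X₀ ∈ YY m)
    (hS : X₀ ∈ XS m) (hX : X₀ ∈ hypRegion S.a) :
    ∃ V' ⊆ V, IsConicNhd V' X₀ ∧ ∀ j : Fin n, (j : ℕ) < L.s → ∀ X ∈ V' ∩ XX m,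
      gam X / (2 * lam X) ≤ (L.entry j X).re := by
  have hev : ∀ᶠ X in nhds X₀, X ∈ V ∧ ∀ j : Fin n, (j : ℕ) < L.s → X ∈ XX m →
      gam X / 2 ≤ (L.entry j X).re := by
    refine (hV.1.eventually_mem hV.2.1).and (Filter.eventually_all.2 fun j => ?_)
    by_cases hj : (j : ℕ) < L.s
    · exact (L.eventually_le_entry_re hV.1 hV.2.1 hY hS hX hj).mono fun X h _ => h
    · exact Filter.Eventually.of_forall fun X h => absurd h hj
  obtain ⟨B, hB, hBo, hXB⟩ := eventually_nhds_iff.1 hev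
  have hts : toSphere X₀ = X₀ := by rw [toSphere, hS.2, inv_one, dil_one]
  refine ⟨{X | 0 < lam X} ∩ toSphere ⁻¹' B, ?_, ⟨?_, ?_, ?_⟩, ?_⟩
  · rintro X ⟨h1, h2⟩
    rw [← dil_lam_toSphere h1]
    exact hV.2.2 _ (hB _ h2).1 _ h1
  · exact ContinuousOn.isOpen_inter_preimage
      (fun X hX => (continuousAt_toSphere hX).continuousWithinAt) isOpen_lam_pos hBo
  · exact ⟨lam_pos hX.1, by rw [Set.mem_preimage, hts]; exact hXB⟩
  · rintro X ⟨h1, h2⟩ r hr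
    have h1' : 0 < lam X := h1
    refine ⟨?_, ?_⟩
    · change 0 < lam (dil r X)
      rw [lam_dil hr.le]; positivity
    · have : toSphere (dil r X) = toSphere X := by
        rw [toSphere, toSphere, lam_dil hr.le, dil_dil]
        congr 1
        field_simp
      rw [Set.mem_preimage, this]
      exact h2
  · rintro j hj X ⟨⟨h1, h2⟩, hXX⟩
    have h3 := toSphere_mem_XS hXX
    have h4 := (hB _ h2).2 j hj h3.1
    have h5 := L.entry_homog j hj (toSphere X) ⟨(hB _ h2).1, h3.1⟩ (lam X) h1
    rw [dil_lam_toSphere h1, pow_zero, one_smul] at h5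
    rw [h5]
    refine le_trans (le_of_eq ?_) h4
    change gam X / (2 * lam X) = (lam X)⁻¹ * gam X / 2
    have h1' : lam X ≠ 0 := ne_of_gt h1
    field_simp

end LopatinskiSymbol
end WRClass

/-! ### The cut-off symbol -/

namespace WRClass
variable {m n p : ℕ} {S : BVP m n p} {V : Set (Phase m)}

theorem contDiffAt_lam {X : Phase m} (hX : 0 < lam X) : ContDiffAt ℝ ∞ (lam : Phase m → ℝ) X := by
  have h : ContDiff ℝ ∞ fun X : Phase m => gam X ^ 2 + ‖cov X‖ ^ 2 := by
    unfold gam cov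
    exact (by fun_prop : ContDiff ℝ ∞ fun X : Phase m => X.2.2.2 ^ 2).add
      ((by fun_prop : ContDiff ℝ ∞ fun X : Phase m => X.2.2.1).norm_sq ℝ)
  refine h.contDiffAt.sqrt ?_
  rw [← lam_sq]
  positivity

theorem gam_le_lam (X : Phase m) : gam X ≤ lam X :=
  Real.le_sqrt_of_sq_le (by nlinarith [sq_nonneg ‖cov X‖])

namespace IsCutoff
variable {θ : Phase m → ℝ} {V : Set (Phase m)}

theorem apply_toSphere (hθ : IsCutoff V θ) {X : Phase m} (hX : X ∈ XX m) :
    θ (toSphere X) = θ X := by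
  have h := hθ.2.1 X hX (lam X)⁻¹ (inv_pos.2 (lam_pos hX))
  rwa [pow_zero, one_smul] at h

end IsCutoff

namespace LopatinskiSymbol
variable (L : LopatinskiSymbol S V)

/-- The symbol `λ θ (δ_j - 1)`, so that the `j`-th entry of the global symbol is the sum of `1` and
of the quotient of this symbol by `λ`. -/
noncomputable def cutSymbol (θ : Phase m → ℝ) (j : Fin n) (X : Phase m) : ℂ :=
  if (j : ℕ) < L.s then (lam X : ℂ) * ((θ X : ℂ) * (L.entry j X - 1)) else 0

theorem globalSymbol_mulVec (θ : Phase m → ℝ) {X : Phase m} (hX : X ∈ XX m) (v : Fin n → ℂ)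
    (j : Fin n) :
    (L.globalSymbol θ X).mulVec v j = (1 + L.cutSymbol θ j X / lam X) * v j := by
  have hl : (lam X : ℂ) ≠ 0 := by exact_mod_cast (lam_pos hX).ne'
  rw [globalSymbol, Matrix.add_mulVec, Matrix.smul_mulVec, Matrix.smul_mulVec, Matrix.one_mulVec,
    Pi.add_apply, Pi.smul_apply, Pi.smul_apply, delta, Matrix.mulVec_diagonal, cutSymbol]
  simp only [Complex.real_smul, Complex.ofReal_sub, Complex.ofReal_one]
  split_ifs with h
  · rw [mul_div_cancel_left₀ _ hl]; ring
  · ring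

section Cutoff
variable {V' : Set (Phase m)} {X₀ : Phase m} {θ : Phase m → ℝ}

/-- The cutoff makes `λ θ (δ_j - 1)` smooth on the whole of `𝕏`, although `δ_j` is smooth only on `V`. -/
theorem isCompactSymbol_cutSymbol (hV : IsConicNhd V X₀) (hsub : V' ⊆ V)
    (hθ : IsCutoff V' θ) (j : Fin n) : IsCompactSymbol (L.cutSymbol θ j) := by
  by_cases hj : (j : ℕ) < L.s
  swap
  · have : L.cutSymbol θ j = fun _ => 0 := funext fun X => if_neg hj
    rw [this]
    exact ⟨contDiffOn_const, fun X _ r _ => (smul_zero _).symm, ∅, isCompact_empty, fun _ _ _ => rfl⟩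
  have he : L.cutSymbol θ j = fun X => (lam X : ℂ) * ((θ X : ℂ) * (L.entry j X - 1)) :=
    funext fun X => if_pos hj
  obtain ⟨K, hK, hKV, hKs⟩ := hθ.2.2.2
  have hmem : ∀ X ∈ XX m, toSphere X ∈ K → X ∈ V := fun X hX h => by
    rw [← dil_lam_toSphere (lam_pos hX)]
    exact hV.2.2 _ (hsub (hKV h)) _ (lam_pos hX)
  have hzero : ∀ X ∈ XX m, toSphere X ∉ K → θ X = 0 := fun X hX h => by
    rw [← hθ.apply_toSphere hX]
    exact hKs _ (toSphere_mem_XS hX) h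
  rw [he]
  refine ⟨fun X hX => ?_, fun X hX r hr => ?_, K, hK, fun X hX h => ?_⟩
  · by_cases h : toSphere X ∈ K
    · have hXV := hmem X hX h
      have h1 : ContDiffWithinAt ℝ ∞ (L.entry j) (XX m) X :=
        (L.entry_smooth j hj X ⟨hXV, hX⟩).mono_of_mem_nhdsWithin
          (Filter.inter_mem (mem_nhdsWithin_of_mem_nhds (hV.1.mem_nhds hXV)) self_mem_nhdsWithin)
      have h2 : ContDiffWithinAt ℝ ∞ (fun X => (θ X : ℂ)) (XX m) X :=
        Complex.ofRealCLM.contDiff.contDiffAt.comp_contDiffWithinAt X (hθ.1 X hX)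
      have h3 : ContDiffWithinAt ℝ ∞ (fun X : Phase m => (lam X : ℂ)) (XX m) X :=
        Complex.ofRealCLM.contDiff.contDiffAt.comp_contDiffWithinAt X
          (contDiffAt_lam (lam_pos hX)).contDiffWithinAt
      exact h3.mul (h2.mul (h1.sub contDiffWithinAt_const))
    · refine (contDiffWithinAt_const (c := (0 : ℂ))).congr_of_eventuallyEq_of_mem ?_ hX
      have : ∀ᶠ Y in nhdsWithin X (XX m), toSphere Y ∈ Kᶜ :=
        (continuousAt_toSphere (lam_pos hX)).continuousWithinAt.eventually
          (hK.isClosed.isOpen_compl.mem_nhds h)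
      filter_upwards [this, self_mem_nhdsWithin] with Y h1 h2
      rw [hzero Y h2 h1]
      simp
  · have hθd : θ (dil r X) = θ X := by
      have := hθ.2.1 X hX r hr
      rwa [pow_zero, one_smul] at this
    rw [lam_dil hr.le, hθd, pow_one, Complex.real_smul]
    by_cases h : toSphere X ∈ K
    · have h1 := L.entry_homog j hj X ⟨hmem X hX h, hX⟩ r hr
      rw [pow_zero, one_smul] at h1
      rw [h1]; push_cast; ring
    · rw [hzero X hX h]; simp
  · rw [hKs X hX h]; simp

/-- The lower bound for `λ (1 + θ (δ_j - 1)) = (1 - θ) λ + θ λ δ_j`, by convexity from `γ / 2 ≤ λ` and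
`γ / 2 ≤ λ Re δ_j`. -/
theorem le_re_cutSymbol (hV' : IsConicNhd V' X₀) (hθ : IsCutoff V' θ)
    (hre : ∀ j : Fin n, (j : ℕ) < L.s → ∀ X ∈ V' ∩ XX m, gam X / (2 * lam X) ≤ (L.entry j X).re)
    (j : Fin n) {X : Phase m} (hX : X ∈ XX m) :
    gam X / 2 ≤ lam X + (L.cutSymbol θ j X).re := by
  have hl := lam_pos hX
  have hgl := gam_le_lam X
  have hg : 0 ≤ gam X := hX.2.1
  rw [cutSymbol]
  split_ifs with hj
  swap
  · simp only [Complex.zero_re]; linarith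
  rw [Complex.re_ofReal_mul, Complex.re_ofReal_mul, Complex.sub_re, Complex.one_re]
  by_cases h0 : θ X = 0
  · rw [h0]; linarith
  obtain ⟨K, hK, hKV, hKs⟩ := hθ.2.2.2
  have hmem : X ∈ V' := by
    by_contra h
    refine h0 ?_
    rw [← hθ.apply_toSphere hX]
    refine hKs _ (toSphere_mem_XS hX) fun hm => h ?_
    rw [← dil_lam_toSphere hl]
    exact hV'.2.2 _ (hKV hm) _ hl
  obtain ⟨t0, t1⟩ := hθ.2.2.1 X
  have h1 : gam X / 2 ≤ lam X * (L.entry j X).re := by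
    have := mul_le_mul_of_nonneg_left (hre j hj X ⟨hmem, hX⟩) hl.le
    rwa [show lam X * (gam X / (2 * lam X)) = gam X / 2 by field_simp] at this
  nlinarith [mul_le_mul_of_nonneg_left h1 t0,
    mul_nonneg (sub_nonneg.2 t1) (by linarith : 0 ≤ lam X - gam X / 2)]

end Cutoff
end LopatinskiSymbol
end WRClass

/-! ### The operator on test functions -/

section SliceOperatorIntegrand
set_option linter.unusedSectionVars false
variable {E : Type*} [NormedAddCommGroup E] [InnerProductSpace ℝ E] [FiniteDimensional ℝ E]
  [MeasurableSpace E] [BorelSpace E]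

theorem IsOrderOne.integrable_sliceOp_integrand {l : E → ℝ} {R C : ℝ} {G : E → E → ℂ}
    (hG : IsOrderOne l R C G) (hl : IsFreqWeight l) (f : SchwartzMap E ℂ) (x : E) :
    Integrable fun k => Real.fourierChar (inner ℝ k x) • ((1 + G x k / l k) * 𝓕 (f : E → ℂ) k) := by
  have hlc := hl.continuous
  have hGc : Continuous fun k : E => G x k :=
    hG.cont.comp (by fun_prop : Continuous fun k : E => (x, k))
  have hch := Real.continuous_fourierChar
  have hfc : Continuous fun k => (𝓕 f : SchwartzMap E ℂ) k := (𝓕 f).continuous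
  have hC := hG.nonneg
  rw [← SchwartzMap.fourier_coe]
  refine ((𝓕 f).integrable.norm.const_mul (1 + C)).mono' ?_
    (Filter.Eventually.of_forall fun k => ?_)
  · refine Continuous.aestronglyMeasurable ?_
    simp only [Circle.smul_def, smul_eq_mul]
    refine Continuous.mul (by fun_prop) (Continuous.mul (continuous_const.add
      (Continuous.div₀ hGc (by fun_prop) fun q => ?_)) hfc)
    exact_mod_cast (hl.pos _).ne'
  · rw [Circle.norm_smul, norm_mul]
    have h1 : ‖1 + G x k / l k‖ ≤ 1 + C := by
      refine (norm_add_le _ _).trans ?_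
      rw [norm_one, norm_div, Complex.norm_real, Real.norm_of_nonneg (hl.pos _).le]
      gcongr
      rw [div_le_iff₀ (hl.pos k)]
      exact hG.bdd x k
    gcongr

end SliceOperatorIntegrand

section EuclideanValues
variable {n : ℕ}

theorem EuclideanSpace.enorm_sq_eq (v : EuclideanSpace ℂ (Fin n)) :
    ‖v‖ₑ ^ 2 = ∑ j, ‖v j‖ₑ ^ 2 := by
  rw [← ofReal_norm, ← ENNReal.ofReal_pow (norm_nonneg _), EuclideanSpace.norm_sq_eq,
    ENNReal.ofReal_sum_of_nonneg fun j _ => sq_nonneg _]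
  refine Finset.sum_congr rfl fun j _ => ?_
  rw [ENNReal.ofReal_pow (norm_nonneg _), ofReal_norm]

theorem lintegral_enorm_sq_eq_sum {α : Type*} [MeasurableSpace α] {μ : Measure α}
    {f : α → EuclideanSpace ℂ (Fin n)} (hf : ∀ j, AEStronglyMeasurable (fun x => f x j) μ) :
    ∫⁻ x, ‖f x‖ₑ ^ 2 ∂μ = ∑ j, ∫⁻ x, ‖f x j‖ₑ ^ 2 ∂μ := by
  simp_rw [EuclideanSpace.enorm_sq_eq]
  exact lintegral_finsetSum' _ fun j _ => (hf j).enorm.pow_const 2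

end EuclideanValues

namespace WRClass
variable {m n p : ℕ}

/-- The diagonal symbols `1 + G_j / λ`, with `G_j` compactly supported and with real part bounded
from below by `γ / 2 - λ`. -/
structure IsDiagonalSymbol (g : Phase m → Matrix (Fin n) (Fin n) ℂ) (G : Fin n → Phase m → ℂ) :
    Prop where
  symbol : ∀ j, IsCompactSymbol (G j)
  mulVec : ∀ X ∈ XX m, ∀ v j, (g X).mulVec v j = (1 + G j X / lam X) * v j
  le_re : ∀ j, ∀ X ∈ XX m, gam X / 2 ≤ lam X + (G j X).re

theorem contDiff_exp_time (c : ℝ) :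
    ContDiff ℝ ∞ fun x : Tan m × ℝ => Real.exp (c * x.1 0) := by
  have h : ContDiff ℝ ∞ fun x : Tan m × ℝ => (EuclideanSpace.proj (𝕜 := ℝ) (0 : Fin (m + 1))) x.1 :=
    (ContinuousLinearMap.contDiff _).comp contDiff_fst
  exact Real.contDiff_exp.comp (contDiff_const.mul h)

theorem IsTest.exp_smul {φ : Tan m × ℝ → Vec n} (hφ : IsTest φ) (c : ℝ) :
    IsTest fun x => ((Real.exp (c * x.1 0) : ℝ) : ℂ) • φ x := by
  have h3 : (fun x : Tan m × ℝ => ((Real.exp (c * x.1 0) : ℝ) : ℂ) • φ x) =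
      fun x => Real.exp (c * x.1 0) • φ x := funext fun x => Complex.coe_smul _ _
  rw [h3]
  exact ⟨(contDiff_exp_time c).smul hφ.1, HasCompactSupport.smul_left
    (f := fun x : Tan m × ℝ => Real.exp (c * x.1 0)) (f' := φ) hφ.2⟩

theorem IsTest.weight {γ : ℝ} {φ : Tan m × ℝ → Vec n} (hφ : IsTest φ) :
    IsTest (weight γ φ) :=
  hφ.exp_smul (-γ)

/-- The components of the slices of a test function are Schwartz functions. -/
theorem IsTest.exists_schwartz {ψ : Tan m × ℝ → Vec n} (hψ : IsTest ψ) (r : ℝ) (j : Fin n) :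
    ∃ f : SchwartzMap (Tan m) ℂ, (f : Tan m → ℂ) = fun z => ψ (z, r) j := by
  have h1 : HasCompactSupport fun z => ψ (z, r) j := by
    refine HasCompactSupport.intro (hψ.2.isCompact.image continuous_fst) fun z hz => ?_
    have : ψ (z, r) = 0 := by
      by_contra h
      exact hz ⟨(z, r), subset_tsupport _ h, rfl⟩
    rw [this]; rfl
  have h2 : ContDiff ℝ ∞ fun z => ψ (z, r) j := by
    have h0 := hψ.1
    exact (EuclideanSpace.proj (𝕜 := ℂ) j).restrictScalars ℝ |>.contDiff.comp
      (h0.comp (by fun_prop : ContDiff ℝ ∞ fun z : Tan m => (z, r)))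
  exact ⟨h1.toSchwartzMap h2, rfl⟩

theorem fourier_apply_coord {F : Tan m → Vec n} (hF : Integrable F) (k : Tan m) (j : Fin n) :
    (𝓕 F k) j = 𝓕 (fun z => F z j) k := by
  rw [Real.fourier_eq, Real.fourier_eq]
  rw [eval_integral_piLp fun i => ?_]
  · rfl
  · exact Integrable.eval_piLp ((Real.fourierIntegral_convergent_iff k).2 hF) i

theorem IsTest.integrable_slice {ψ : Tan m × ℝ → Vec n} (hψ : IsTest ψ) (r : ℝ) :
    Integrable (fun z => ψ (z, r)) ∧ MemLp (fun z => ψ (z, r)) 2 volume := by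
  constructor
  · refine Integrable.of_eval_piLp fun j => ?_
    obtain ⟨f, hf⟩ := hψ.exists_schwartz r j
    rw [← hf]; exact f.integrable
  · refine MemLp.of_eval_piLp fun j => ?_
    obtain ⟨f, hf⟩ := hψ.exists_schwartz r j
    rw [← hf]; exact f.memLp 2

/-- The slices of a symbol, as functions of `(t, y)` and of the dual variable. -/
noncomputable def sliceSymbol (G : Phase m → ℂ) (γ r : ℝ) (x k : Tan m) : ℂ :=
  G (x, r, (2 * Real.pi) • k, γ)

/-- On test functions the operator acts on slices and on components by the scalar operators with the
symbols `1 + G_j / λ`. -/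
theorem weight_op_apply {g : Phase m → Matrix (Fin n) (Fin n) ℂ} {G : Fin n → Phase m → ℂ}
    (hg : IsDiagonalSymbol g G) {γ : ℝ} (hγ : 200 ≤ γ) {φ : Tan m × ℝ → Vec n} (hφ : IsTest φ)
    (x : Tan m) {r : ℝ} (hr : 0 ≤ r) (j : Fin n) :
    weight γ (op g γ φ) (x, r) j =
      sliceOp (freqWeight γ) (sliceSymbol (G j) γ r) (fun z => weight γ φ (z, r) j) x := by
  have hγ0 : 0 < γ := by linarith
  have hψ := hφ.weight (γ := γ)
  rw [weight, op, smul_smul, ← Complex.ofReal_mul, ← Real.exp_add]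
  rw [show -γ * (x, r).1 0 + γ * (x, r).1 0 = 0 by ring, Real.exp_zero, Complex.ofReal_one, one_smul]
  have hint : ∀ k j, (Complex.exp (2 * Real.pi * Complex.I * ((inner ℝ k x : ℝ) : ℂ)) •
      WithLp.toLp 2 ((g (x, r, (2 * Real.pi) • k, γ)).mulVec
        (WithLp.ofLp (𝓕 (fun z : Tan m => weight γ φ (z, r)) k)))) j =
      Real.fourierChar (inner ℝ k x) • ((1 + sliceSymbol (G j) γ r x k / freqWeight γ k) *
        𝓕 (fun z => weight γ φ (z, r) j) k) := by
    intro k j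
    rw [PiLp.smul_apply]
    dsimp only
    rw [hg.mulVec _ (sliceMap_mem_XX hr hγ0 x _), fourier_apply_coord (hψ.integrable_slice r).1,
      lam_mk, Circle.smul_def, Real.fourierChar_apply, smul_eq_mul, smul_eq_mul, sliceSymbol]
    congr 2
    push_cast; ring
  have hi : ∀ j, Integrable fun k => (Complex.exp (2 * Real.pi * Complex.I *
      ((inner ℝ k x : ℝ) : ℂ)) • WithLp.toLp 2 ((g (x, r, (2 * Real.pi) • k, γ)).mulVec
        (WithLp.ofLp (𝓕 (fun z : Tan m => weight γ φ (z, r)) k))) : Vec n) j := by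
    intro j
    simp_rw [hint]
    obtain ⟨R, C, hRC⟩ := (hg.symbol j).exists_isOrderOne
    obtain ⟨f, hf⟩ := hψ.exists_schwartz r j
    rw [← hf]
    exact (hRC r γ hr hγ).integrable_sliceOp_integrand (isFreqWeight_freqWeight hγ) f x
  rw [eval_integral_piLp hi]
  simp_rw [hint]
  rfl

end WRClass

/-! ### Estimates on test functions -/

section SliceOperatorLintegral
set_option linter.unusedSectionVars false
variable {E : Type*} [NormedAddCommGroup E] [InnerProductSpace ℝ E] [FiniteDimensional ℝ E]
  [MeasurableSpace E] [BorelSpace E]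
namespace IsOrderOne
variable {l : E → ℝ} {R C : ℝ} {G : E → E → ℂ} (hG : IsOrderOne l R C G) (hl : IsFreqWeight l)
include hG hl

theorem lintegral_sliceOp_sq_le (f : SchwartzMap E ℂ) :
    ∫⁻ x, ‖sliceOp l G f x‖ₑ ^ 2 ≤
      ENNReal.ofReal (2 + 2 * (C * ∫ κ : E, polyDecay κ) ^ 2) * ∫⁻ x, ‖f x‖ₑ ^ 2 := by
  have hf2 : MemLp f 2 volume := f.memLp 2
  rw [← (hG.memLp_sliceOp hl f).ofReal_integral_norm_sq, ← hf2.ofReal_integral_norm_sq,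
    ← ENNReal.ofReal_mul (by positivity)]
  exact ENNReal.ofReal_le_ofReal (hG.integral_sliceOp_sq_le hl f)

theorem lintegral_fourier_div_sq_le (f : SchwartzMap E ℂ) {c : ℝ}
    (hc : ∀ x ζ, c ≤ l ζ + (G x ζ).re)
    (hcC : 20 + 2 * (C * (2 + windowVar E)) * (∫ κ : E, polyDecay κ) ≤ c / 2) :
    ENNReal.ofReal ((c / 2) ^ 2) *
      ∫⁻ ξ, ENNReal.ofReal ((l ξ ^ 2)⁻¹) * ‖𝓕 (f : E → ℂ) ξ‖ₑ ^ 2 ≤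
        ∫⁻ x, ‖sliceOp l G f x‖ₑ ^ 2 := by
  have hF2 : MemLp (𝓕 (f : E → ℂ)) 2 volume := Real.memLp_two_fourier f.integrable (f.memLp 2)
  have hFi : Integrable fun ξ => ‖𝓕 (f : E → ℂ) ξ‖ ^ 2 := hF2.integrable_norm_pow (by norm_num)
  have hlc := hl.continuous
  have hi : Integrable fun ξ => ‖𝓕 (f : E → ℂ) ξ‖ ^ 2 / l ξ ^ 2 := by
    refine hFi.mono' ?_ (Filter.Eventually.of_forall fun ξ => ?_)
    · exact hFi.1.aemeasurable.div (by fun_prop) |>.aestronglyMeasurable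
    · rw [Real.norm_of_nonneg (by positivity)]
      refine div_le_self (sq_nonneg _) ?_
      have := hl.large ξ
      nlinarith
  have h1 : ∫⁻ ξ, ENNReal.ofReal ((l ξ ^ 2)⁻¹) * ‖𝓕 (f : E → ℂ) ξ‖ₑ ^ 2 =
      ENNReal.ofReal (∫ ξ, ‖𝓕 (f : E → ℂ) ξ‖ ^ 2 / l ξ ^ 2) := by
    rw [ofReal_integral_eq_lintegral_ofReal hi
      (Filter.Eventually.of_forall fun ξ => by positivity)]
    refine lintegral_congr fun ξ => ?_
    rw [← ofReal_norm, ← ENNReal.ofReal_pow (norm_nonneg _), ← ENNReal.ofReal_mul (by positivity)]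
    congr 1
    ring
  rw [h1, ← ENNReal.ofReal_mul (by positivity), ← (hG.memLp_sliceOp hl f).ofReal_integral_norm_sq]
  exact ENNReal.ofReal_le_ofReal (hG.integral_fourier_div_sq_le hl f hc hcC)

end IsOrderOne
end SliceOperatorLintegral

namespace WRClass
variable {m n p : ℕ}

/-- The square of the norm of order `-1` of one slice `x_d = r`. -/
noncomputable def sliceNormSq (γ : ℝ) (u : Tan m × ℝ → Vec n) (r : ℝ) : ℝ≥0∞ :=
  ∫⁻ k : Tan m, ENNReal.ofReal ((γ ^ 2 + ‖(2 * Real.pi) • k‖ ^ 2) ^ (-1 : ℝ)) *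
    ‖sliceFourier γ u r k‖ₑ ^ 2

theorem sliceNormSq_weight (γ : ℝ) (k : Tan m) :
    (γ ^ 2 + ‖(2 * Real.pi) • k‖ ^ 2) ^ (-1 : ℝ) = (freqWeight γ k ^ 2)⁻¹ := by
  rw [freqWeight, Real.sq_sqrt (by positivity), Real.rpow_neg_one]

/-- On test functions the `L²` Fourier transform of a slice is the Fourier integral. -/
theorem sliceFourier_of_isTest {γ : ℝ} {φ : Tan m × ℝ → Vec n} (hφ : IsTest φ) (r : ℝ) :
    sliceFourier γ φ r =ᵐ[volume] 𝓕 fun z => weight γ φ (z, r) := by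
  obtain ⟨h1, h2⟩ := hφ.weight (γ := γ) |>.integrable_slice r
  rw [sliceFourier, dif_pos h2]
  exact h2.fourier_toLp_ae_eq h1

theorem sliceNormSq_of_isTest {γ : ℝ} {φ : Tan m × ℝ → Vec n} (hφ : IsTest φ) (r : ℝ) :
    sliceNormSq γ φ r = ∑ j, ∫⁻ k, ENNReal.ofReal ((freqWeight γ k ^ 2)⁻¹) *
      ‖𝓕 (fun z => weight γ φ (z, r) j) k‖ₑ ^ 2 := by
  have h1 := (hφ.weight (γ := γ) |>.integrable_slice r).1
  have hmeas : ∀ j, Measurable fun k => ENNReal.ofReal ((freqWeight γ k ^ 2)⁻¹) *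
      ‖𝓕 (fun z => weight γ φ (z, r) j) k‖ₑ ^ 2 := by
    intro j
    have hc : Continuous (𝓕 fun z => weight γ φ (z, r) j) :=
      Real.continuous_fourier_of_integrable (h1.eval_piLp j)
    have hl : Continuous (freqWeight γ : Tan m → ℝ) := by unfold freqWeight; fun_prop
    have := hc.enorm.measurable
    have := hl.measurable
    fun_prop
  rw [← lintegral_finsetSum _ fun j _ => hmeas j]
  refine lintegral_congr_ae ?_
  filter_upwards [sliceFourier_of_isTest (γ := γ) hφ r] with k hk
  rw [hk, EuclideanSpace.enorm_sq_eq, Finset.mul_sum, sliceNormSq_weight]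
  refine Finset.sum_congr rfl fun j _ => ?_
  rw [fourier_apply_coord h1]

/-- The estimates of the operator on the slices `x_d = r` of test functions, uniform in `r` and `γ`. -/
theorem IsDiagonalSymbol.exists_slice_bounds {g : Phase m → Matrix (Fin n) (Fin n) ℂ}
    {G : Fin n → Phase m → ℂ} (hg : IsDiagonalSymbol g G) :
    ∃ γ₁ A : ℝ, 200 ≤ γ₁ ∧ 0 < A ∧ ∀ γ, γ₁ ≤ γ → ∀ φ : Tan m × ℝ → Vec n, IsTest φ →
      ∀ r, 0 ≤ r →
        ∫⁻ x, ‖weight γ (op g γ φ) (x, r)‖ₑ ^ 2 ≤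
          ENNReal.ofReal A * ∫⁻ x, ‖weight γ φ (x, r)‖ₑ ^ 2 ∧
        ENNReal.ofReal ((γ / 4) ^ 2) * sliceNormSq γ φ r ≤
          ∫⁻ x, ‖weight γ (op g γ φ) (x, r)‖ₑ ^ 2 := by
  choose R C hRC using fun j => (hg.symbol j).exists_isOrderOne
  set I : ℝ := ∫ κ : Tan m, polyDecay κ
  set W : ℝ := windowVar (Tan m)
  -- the lower bound on `γ` ensures that the errors are at most a quarter of `γ`, for every component
  refine ⟨200 + 4 * ∑ j, |20 + 2 * (C j * (2 + W)) * I|, 1 + ∑ j, (2 + 2 * (C j * I) ^ 2),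
    by have : 0 ≤ ∑ j, |20 + 2 * (C j * (2 + W)) * I| := Finset.sum_nonneg fun j _ => abs_nonneg _
       linarith, by positivity, fun γ hγ φ hφ r hr => ?_⟩
  have hs0 : 0 ≤ ∑ j, |20 + 2 * (C j * (2 + W)) * I| := Finset.sum_nonneg fun j _ => abs_nonneg _
  have hγ200 : 200 ≤ γ := by linarith
  have hl := isFreqWeight_freqWeight (m := m) hγ200
  have hψ := hφ.weight (γ := γ)
  choose f hf using fun j => hψ.exists_schwartz r j
  have hG : ∀ j, IsOrderOne (freqWeight γ) (R j) (C j) (sliceSymbol (G j) γ r) := fun j =>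
    hRC j r γ hr hγ200
  have hcomp : ∀ j, (fun x => weight γ (op g γ φ) (x, r) j) =
      sliceOp (freqWeight γ) (sliceSymbol (G j) γ r) (f j) := fun j => by
    funext x
    rw [weight_op_apply hg hγ200 hφ x hr, hf]
  have e1 : ∫⁻ x, ‖weight γ (op g γ φ) (x, r)‖ₑ ^ 2 =
      ∑ j, ∫⁻ x, ‖sliceOp (freqWeight γ) (sliceSymbol (G j) γ r) (f j) x‖ₑ ^ 2 := by
    rw [lintegral_enorm_sq_eq_sum fun j => by
      rw [hcomp]; exact ((hG j).memLp_sliceOp hl (f j)).1]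
    refine Finset.sum_congr rfl fun j _ => ?_
    simp only [← hcomp]
  have e2 : ∫⁻ x, ‖weight γ φ (x, r)‖ₑ ^ 2 = ∑ j, ∫⁻ x, ‖f j x‖ₑ ^ 2 := by
    rw [lintegral_enorm_sq_eq_sum fun j => by
      rw [← hf]; exact (f j).continuous.aestronglyMeasurable]
    refine Finset.sum_congr rfl fun j _ => ?_
    rw [hf]
  constructor
  · rw [e1, e2, Finset.mul_sum]
    refine Finset.sum_le_sum fun j _ => ((hG j).lintegral_sliceOp_sq_le hl (f j)).trans ?_
    refine mul_le_mul' (ENNReal.ofReal_le_ofReal ?_) le_rfl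
    have := Finset.single_le_sum (f := fun j => 2 + 2 * (C j * I) ^ 2)
      (fun j _ => by positivity) (Finset.mem_univ j)
    linarith
  · rw [e1, sliceNormSq_of_isTest hφ, Finset.mul_sum]
    refine Finset.sum_le_sum fun j _ => ?_
    rw [← hf, show γ / 4 = γ / 2 / 2 by ring]
    refine (hG j).lintegral_fourier_div_sq_le hl (f j) (fun x ζ => ?_) ?_
    · exact hg.le_re j _ (sliceMap_mem_XX hr (by linarith) x _)
    · have h1 := Finset.single_le_sum (f := fun j => |20 + 2 * (C j * (2 + W)) * I|)
        (fun j _ => abs_nonneg _) (Finset.mem_univ j)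
      have h2 := le_abs_self (20 + 2 * (C j * (2 + W)) * I)
      linarith

/-! ### Measurability on the half-space -/

theorem halfMeasure_eq_prod : halfMeasure m =
    (volume : Measure (Tan m)).prod (volume.restrict (Set.Ioi (0 : ℝ))) := by
  have h : {x : Tan m × ℝ | 0 < x.2} = Set.univ ×ˢ Set.Ioi (0 : ℝ) := by
    ext x; simp
  rw [halfMeasure, h, Measure.volume_eq_prod, ← Measure.prod_restrict, Measure.restrict_univ]

theorem lintegral_halfMeasure {f : Tan m × ℝ → Vec n}
    (hf : AEStronglyMeasurable f (halfMeasure m)) :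
    ∫⁻ x, ‖f x‖ₑ ^ 2 ∂(halfMeasure m) = ∫⁻ r in Set.Ioi (0 : ℝ), ∫⁻ x, ‖f (x, r)‖ₑ ^ 2 := by
  rw [halfMeasure_eq_prod] at hf ⊢
  exact lintegral_prod_symm _ (hf.enorm.pow_const 2)

theorem eLpNorm_two_eq {α F : Type*} [MeasurableSpace α] [NormedAddCommGroup F] (μ : Measure α)
    (f : α → F) : eLpNorm f 2 μ = (∫⁻ x, ‖f x‖ₑ ^ 2 ∂μ) ^ (1 / 2 : ℝ) := by
  rw [eLpNorm_eq_lintegral_rpow_enorm_toReal two_ne_zero ENNReal.ofNat_ne_top]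
  simp

theorem aestronglyMeasurable_euclidean {α : Type*} [MeasurableSpace α] {μ : Measure α}
    {f : α → Vec n} (hf : ∀ j, AEStronglyMeasurable (fun x => f x j) μ) :
    AEStronglyMeasurable f μ := by
  have h : AEMeasurable (fun x => WithLp.ofLp (f x)) μ :=
    aemeasurable_pi_lambda _ fun j => (hf j).aemeasurable
  exact ((WithLp.measurable_toLp 2 _).comp_aemeasurable h).aestronglyMeasurable

theorem IsTest.stronglyMeasurable_fourier_slice {ψ : Tan m × ℝ → Vec n} (hψ : IsTest ψ)
    (j : Fin n) : StronglyMeasurable fun q : ℝ × Tan m => 𝓕 (fun z => ψ (z, q.1) j) q.2 := by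
  have hch := Real.continuous_fourierChar
  have hψc := hψ.1.continuous
  have h1 : Continuous fun s : (ℝ × Tan m) × Tan m =>
      Real.fourierChar (-(inner ℝ s.2 s.1.2)) • ψ (s.2, s.1.1) j := by
    have h2 : Continuous fun s : (ℝ × Tan m) × Tan m => ψ (s.2, s.1.1) j :=
      (EuclideanSpace.proj (𝕜 := ℂ) j).continuous.comp (hψc.comp (by fun_prop))
    simp only [Circle.smul_def, smul_eq_mul]
    exact Continuous.mul (by fun_prop) h2
  have := h1.stronglyMeasurable.integral_prod_right' (ν := volume)
  simp_rw [Real.fourier_eq]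
  exact this

theorem measurableSet_halfSpace : MeasurableSet {x : Tan m × ℝ | 0 < x.2} :=
  measurableSet_lt measurable_const measurable_snd

theorem IsCompactSymbol.aestronglyMeasurable_slice {G : Phase m → ℂ} (hG : IsCompactSymbol G)
    {γ : ℝ} (hγ : 0 < γ) : AEStronglyMeasurable (fun q : (Tan m × ℝ) × Tan m =>
      sliceSymbol G γ q.1.2 q.1.1 q.2) ((halfMeasure m).prod volume) := by
  have hc : ContinuousOn (fun q : (Tan m × ℝ) × Tan m => sliceSymbol G γ q.1.2 q.1.1 q.2)
      ({x : Tan m × ℝ | 0 < x.2} ×ˢ Set.univ) :=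
    ContinuousOn.comp (g := G)
      (f := fun q : (Tan m × ℝ) × Tan m => ((q.1.1, q.1.2, (2 * Real.pi) • q.2, γ) : Phase m))
      hG.smooth.continuousOn
      (by fun_prop : Continuous fun q : (Tan m × ℝ) × Tan m =>
        ((q.1.1, q.1.2, (2 * Real.pi) • q.2, γ) : Phase m)).continuousOn
      fun q hq => sliceMap_mem_XX (le_of_lt hq.1) hγ _ _
  have := hc.aestronglyMeasurable (μ := volume) (measurableSet_halfSpace.prod MeasurableSet.univ)
  rwa [Measure.volume_eq_prod, ← Measure.prod_restrict, Measure.restrict_univ] at this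

theorem IsCompactSymbol.aestronglyMeasurable_integral {G : Phase m → ℂ} (hG : IsCompactSymbol G)
    {γ : ℝ} (hγ : 0 < γ) {Φ : ℝ × Tan m → ℂ} (hΦ : StronglyMeasurable Φ) :
    AEStronglyMeasurable (fun x : Tan m × ℝ => ∫ k, Real.fourierChar (inner ℝ k x.1) •
      ((1 + sliceSymbol G γ x.2 x.1 k / freqWeight γ k) * Φ (x.2, k))) (halfMeasure m) := by
  have hch := Real.continuous_fourierChar
  refine AEStronglyMeasurable.integral_prod_right' (f := fun q : (Tan m × ℝ) × Tan m =>
    Real.fourierChar (inner ℝ q.2 q.1.1) •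
      ((1 + sliceSymbol G γ q.1.2 q.1.1 q.2 / freqWeight γ q.2) * Φ (q.1.2, q.2))) ?_
  have h1 : Continuous fun q : (Tan m × ℝ) × Tan m =>
      (Real.fourierChar (inner ℝ q.2 q.1.1) : ℂ) := by fun_prop
  have h3 : StronglyMeasurable fun q : (Tan m × ℝ) × Tan m => Φ (q.1.2, q.2) :=
    hΦ.comp_measurable (by fun_prop)
  have hl : Continuous fun q : (Tan m × ℝ) × Tan m => (freqWeight γ q.2 : ℂ) := by
    unfold freqWeight; fun_prop
  simp only [Circle.smul_def, smul_eq_mul]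
  refine h1.aestronglyMeasurable.mul (AEStronglyMeasurable.mul ?_ h3.aestronglyMeasurable)
  exact aestronglyMeasurable_const.add
    ((hG.aestronglyMeasurable_slice hγ).aemeasurable.div
      hl.measurable.aemeasurable).aestronglyMeasurable

/-- The operator maps test functions to measurable functions; the formula for it by components is
available only in the half-space, which suffices. -/
theorem IsDiagonalSymbol.aestronglyMeasurable_weight_op {g : Phase m → Matrix (Fin n) (Fin n) ℂ}
    {G : Fin n → Phase m → ℂ} (hg : IsDiagonalSymbol g G) {γ : ℝ} (hγ : 200 ≤ γ)
    {φ : Tan m × ℝ → Vec n} (hφ : IsTest φ) :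
    AEStronglyMeasurable (weight γ (op g γ φ)) (halfMeasure m) := by
  refine aestronglyMeasurable_euclidean fun j => ?_
  refine ((hg.symbol j).aestronglyMeasurable_integral (by linarith : 0 < γ)
    ((hφ.weight (γ := γ)).stronglyMeasurable_fourier_slice j)).congr ?_
  filter_upwards [ae_restrict_mem measurableSet_halfSpace] with x hx
  exact (weight_op_apply hg hγ hφ x.1 (le_of_lt hx) j).symm

/-- The two-sided estimate on test functions. -/
theorem IsDiagonalSymbol.exists_test_bounds {g : Phase m → Matrix (Fin n) (Fin n) ℂ}
    {G : Fin n → Phase m → ℂ} (hg : IsDiagonalSymbol g G) :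
    ∃ γ₁ A : ℝ, 200 ≤ γ₁ ∧ 0 < A ∧ ∀ γ, γ₁ ≤ γ → ∀ φ : Tan m × ℝ → Vec n, IsTest φ →
      MemL2 γ φ ∧ MemL2 γ (op g γ φ) ∧
        normL2 γ (op g γ φ) ≤ ENNReal.ofReal A * normL2 γ φ ∧
        ENNReal.ofReal (γ / 4) * normSobolev (-1) γ φ ≤ normL2 γ (op g γ φ) := by
  obtain ⟨γ₁, A, h1, hA, hb⟩ := hg.exists_slice_bounds
  refine ⟨γ₁, √A, h1, Real.sqrt_pos.2 hA, fun γ hγ φ hφ => ?_⟩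
  have hm := hg.aestronglyMeasurable_weight_op (h1.trans hγ) hφ
  have hψ := hφ.weight (γ := γ)
  have hφ2 : MemL2 γ φ := by
    have : IsFiniteMeasureOnCompacts (halfMeasure m) := by unfold halfMeasure; infer_instance
    exact hψ.1.continuous.memLp_of_hasCompactSupport hψ.2
  have sq : ∀ B : ℝ, 0 ≤ B → ∀ x : ℝ≥0∞, (ENNReal.ofReal (B ^ 2) * x) ^ (1 / 2 : ℝ) =
      ENNReal.ofReal B * x ^ (1 / 2 : ℝ) := by
    intro B hB x
    rw [ENNReal.mul_rpow_of_nonneg _ _ (by norm_num), ENNReal.ofReal_rpow_of_nonneg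
      (sq_nonneg B) (by norm_num), ← Real.sqrt_eq_rpow, Real.sqrt_sq hB]
  have up : normL2 γ (op g γ φ) ≤ ENNReal.ofReal √A * normL2 γ φ := by
    rw [normL2, normL2, eLpNorm_two_eq, eLpNorm_two_eq, ← sq _ (Real.sqrt_nonneg A),
      Real.sq_sqrt hA.le]
    gcongr
    rw [lintegral_halfMeasure hm, lintegral_halfMeasure hφ2.1, ← lintegral_const_mul' _ _ ENNReal.ofReal_ne_top]
    exact setLIntegral_mono' measurableSet_Ioi fun r hr => (hb γ hγ φ hφ r (le_of_lt hr)).1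
  refine ⟨hφ2, ⟨hm, up.trans_lt (ENNReal.mul_lt_top ENNReal.ofReal_lt_top hφ2.2)⟩, up, ?_⟩
  rw [normL2, eLpNorm_two_eq, normSobolev, ← sq _ (by linarith)]
  gcongr
  rw [lintegral_halfMeasure hm, ← lintegral_const_mul' _ _ ENNReal.ofReal_ne_top]
  exact setLIntegral_mono' measurableSet_Ioi fun r hr => (hb γ hγ φ hφ r (le_of_lt hr)).2

end WRClass

/-! ### The norm of order `-1` -/

namespace WRClass
variable {m n p : ℕ}

theorem weight_sub (γ : ℝ) (u v : Tan m × ℝ → Vec n) :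
    weight γ (u - v) = weight γ u - weight γ v := by
  funext x
  simp only [weight, Pi.sub_apply, smul_sub]

/-- The norm of order `-1` of a slice as the `L²` norm of the Fourier transform divided by `λ`. -/
theorem sliceNormSq_eq (γ : ℝ) (u : Tan m × ℝ → Vec n) (r : ℝ) :
    sliceNormSq γ u r =
      eLpNorm (fun k : Tan m => (freqWeight γ k)⁻¹ • sliceFourier γ u r k) 2 volume ^ 2 := by
  rw [eLpNorm_two_eq, ← ENNReal.rpow_natCast, ← ENNReal.rpow_mul]
  norm_num
  refine lintegral_congr fun k => ?_
  have h0 : 0 ≤ (freqWeight γ k)⁻¹ := inv_nonneg.2 (Real.sqrt_nonneg _)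
  rw [sliceNormSq_weight, enorm_smul, mul_pow, Real.enorm_of_nonneg h0,
    ← ENNReal.ofReal_pow h0, inv_pow]

/-- The triangle inequality on one slice, where the multiplier is bounded by `1 / γ`. -/
theorem sqrt_sliceNormSq_le {γ : ℝ} (hγ : 0 < γ) {u v : Tan m × ℝ → Vec n} {r : ℝ}
    (hu : MemLp (fun z => weight γ u (z, r)) 2 volume)
    (hv : MemLp (fun z => weight γ v (z, r)) 2 volume) :
    sliceNormSq γ u r ^ (1 / 2 : ℝ) ≤ sliceNormSq γ v r ^ (1 / 2 : ℝ) +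
      ENNReal.ofReal (1 / γ) * (∫⁻ z, ‖weight γ (v - u) (z, r)‖ₑ ^ 2) ^ (1 / 2 : ℝ) := by
  have hsq : ∀ x : ℝ≥0∞, (x ^ 2) ^ (1 / 2 : ℝ) = x := fun x => by
    rw [← ENNReal.rpow_natCast, ← ENNReal.rpow_mul]; norm_num
  have hl : Continuous fun k : Tan m => (freqWeight γ k)⁻¹ := by
    unfold freqWeight
    exact Continuous.inv₀ (by fun_prop) fun k => (Real.sqrt_pos.2 (by positivity)).ne'
  have hlb : ∀ k : Tan m, (freqWeight γ k)⁻¹ ≤ 1 / γ := fun k => by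
    rw [one_div]
    exact inv_anti₀ hγ (Real.le_sqrt_of_sq_le (by nlinarith [sq_nonneg ‖(2 * Real.pi) • k‖]))
  rw [sliceNormSq_eq, sliceNormSq_eq, hsq, hsq, ← eLpNorm_two_eq]
  have eu : sliceFourier γ u r = ((𝓕 (hu.toLp _) : Lp (Vec n) 2 (volume : Measure (Tan m))) :
    Tan m → Vec n) := by rw [sliceFourier, dif_pos hu]
  have ev : sliceFourier γ v r = ((𝓕 (hv.toLp _) : Lp (Vec n) 2 (volume : Measure (Tan m))) :
    Tan m → Vec n) := by rw [sliceFourier, dif_pos hv]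
  have mu : AEStronglyMeasurable (sliceFourier γ u r) volume := by
    rw [eu]; exact (Lp.memLp _).1
  have mv : AEStronglyMeasurable (sliceFourier γ v r) volume := by
    rw [ev]; exact (Lp.memLp _).1
  have hdec : (fun k : Tan m => (freqWeight γ k)⁻¹ • sliceFourier γ u r k) =
      (fun k : Tan m => (freqWeight γ k)⁻¹ • sliceFourier γ v r k) +
        fun k : Tan m => (freqWeight γ k)⁻¹ • (sliceFourier γ u r - sliceFourier γ v r) k := by
    funext k
    simp only [Pi.add_apply, Pi.sub_apply, smul_sub, add_sub_cancel]
  have hFd : eLpNorm (sliceFourier γ u r - sliceFourier γ v r) 2 volume =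
      eLpNorm (fun z => weight γ (v - u) (z, r)) 2 volume := by
    rw [eu, ev, ← Lp.edist_def]
    have h1 : edist (𝓕 (hu.toLp _) : Lp (Vec n) 2 (volume : Measure (Tan m))) (𝓕 (hv.toLp _)) =
      edist (hu.toLp _) (hv.toLp _) := (Lp.fourierTransformₗᵢ (Tan m) (Vec n)).isometry _ _
    rw [h1, edist_comm, Lp.edist_toLp_toLp, weight_sub]
    rfl
  rw [hdec]
  refine (eLpNorm_add_le (hl.aestronglyMeasurable.smul mv)
    (hl.aestronglyMeasurable.smul (mu.sub mv)) (by norm_num)).trans ?_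
  refine add_le_add le_rfl ?_
  rw [← hFd]
  refine eLpNorm_le_mul_eLpNorm_of_ae_le_mul (Filter.Eventually.of_forall fun k => ?_) 2
  rw [Pi.smul_apply', norm_smul, Real.norm_of_nonneg (by unfold freqWeight; positivity)]
  gcongr
  exact hlb k

theorem aemeasurable_lintegral_slice {f : Tan m × ℝ → Vec n}
    (hf : AEStronglyMeasurable f (halfMeasure m)) :
    AEMeasurable (fun r => ∫⁻ x, ‖f (x, r)‖ₑ ^ 2) (volume.restrict (Set.Ioi (0 : ℝ))) := by
  rw [halfMeasure_eq_prod] at hf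
  exact (hf.enorm.pow_const 2).lintegral_prod_left'

theorem ae_memLp_slice {f : Tan m × ℝ → Vec n} (hf : MemLp f 2 (halfMeasure m)) :
    ∀ᵐ r ∂(volume.restrict (Set.Ioi (0 : ℝ))), MemLp (fun z => f (z, r)) 2 volume := by
  have h1 : ∀ᵐ r ∂(volume.restrict (Set.Ioi (0 : ℝ))), AEStronglyMeasurable (fun z => f (z, r))
      volume := by
    have := hf.1
    rw [halfMeasure_eq_prod] at this
    exact this.prodMk_right
  have h2 : ∀ᵐ r ∂(volume.restrict (Set.Ioi (0 : ℝ))), ∫⁻ x, ‖f (x, r)‖ₑ ^ 2 < ⊤ := by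
    refine ae_lt_top' (aemeasurable_lintegral_slice hf.1) ?_
    rw [← lintegral_halfMeasure hf.1]
    have := hf.2
    rw [eLpNorm_two_eq] at this
    exact ((ENNReal.rpow_lt_top_iff_of_pos (by norm_num)).1 this).ne
  filter_upwards [h1, h2] with r h3 h4
  refine ⟨h3, ?_⟩
  rw [eLpNorm_two_eq]
  exact ENNReal.rpow_lt_top_of_nonneg (by norm_num) h4.ne

theorem measurable_sliceNormSq {γ : ℝ} {φ : Tan m × ℝ → Vec n} (hφ : IsTest φ) :
    Measurable (sliceNormSq γ φ) := by
  rw [show sliceNormSq γ φ = fun r => ∑ j, ∫⁻ k, ENNReal.ofReal ((freqWeight γ k ^ 2)⁻¹) *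
      ‖𝓕 (fun z => weight γ φ (z, r) j) k‖ₑ ^ 2 from funext fun r => sliceNormSq_of_isTest hφ r]
  refine Finset.measurable_sum _ fun j _ => ?_
  have h := (hφ.weight (γ := γ)).stronglyMeasurable_fourier_slice j
  have hl : Continuous fun q : ℝ × Tan m => freqWeight γ q.2 := by unfold freqWeight; fun_prop
  exact Measurable.lintegral_prod_right'
    (f := fun q : ℝ × Tan m => ENNReal.ofReal ((freqWeight γ q.2 ^ 2)⁻¹) *
      ‖𝓕 (fun z => weight γ φ (z, q.1) j) q.2‖ₑ ^ 2)
    (((hl.measurable.pow_const 2).inv.ennreal_ofReal).mul (h.enorm.pow_const 2))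

/-- The triangle inequality for the norm of order `-1`, where the norm of the difference is bounded by
`1 / γ` times its norm in `L²_γ`. -/
theorem normSobolev_le_add {γ : ℝ} (hγ : 0 < γ) {u φ : Tan m × ℝ → Vec n} (hu : MemL2 γ u)
    (hφ : IsTest φ) (hφ2 : MemL2 γ φ) :
    normSobolev (-1) γ u ≤ normSobolev (-1) γ φ +
      ENNReal.ofReal (1 / γ) * normL2 γ (φ - u) := by
  set ν := volume.restrict (Set.Ioi (0 : ℝ))
  set N : ℝ → ℝ≥0∞ := fun r => sliceNormSq γ φ r ^ (1 / 2 : ℝ)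
  set M : ℝ → ℝ≥0∞ := fun r => ENNReal.ofReal (1 / γ) *
    (∫⁻ z, ‖weight γ (φ - u) (z, r)‖ₑ ^ 2) ^ (1 / 2 : ℝ)
  have hd : AEStronglyMeasurable (weight γ (φ - u)) (halfMeasure m) := by
    rw [weight_sub]; exact hφ2.1.sub hu.1
  have hN : AEMeasurable N ν := ((measurable_sliceNormSq hφ).pow_const _).aemeasurable
  have hM : AEMeasurable M ν := ((aemeasurable_lintegral_slice hd).pow_const _).const_mul _
  have hsq : ∀ x : ℝ≥0∞, (x ^ (1 / 2 : ℝ)) ^ (2 : ℝ) = x := fun x => by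
    rw [← ENNReal.rpow_mul]; norm_num
  have hae : ∀ᵐ r ∂ν, sliceNormSq γ u r ≤ (N + M) r ^ (2 : ℝ) := by
    filter_upwards [ae_memLp_slice hu, ae_memLp_slice hφ2] with r h1 h2
    rw [← hsq (sliceNormSq γ u r)]
    exact ENNReal.rpow_le_rpow (sqrt_sliceNormSq_le hγ h1 h2) (by norm_num)
  have h1 : normSobolev (-1) γ u ≤ (∫⁻ r, (N + M) r ^ (2 : ℝ) ∂ν) ^ (1 / 2 : ℝ) :=
    ENNReal.rpow_le_rpow (lintegral_mono_ae hae) (by norm_num)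
  refine (h1.trans (ENNReal.lintegral_Lp_add_le hN hM (by norm_num))).trans (le_of_eq ?_)
  congr 1
  · simp only [N, hsq]
    rfl
  · have : ∀ r, M r ^ (2 : ℝ) = ENNReal.ofReal (1 / γ) ^ (2 : ℝ) *
        ∫⁻ z, ‖weight γ (φ - u) (z, r)‖ₑ ^ 2 := fun r => by
      simp only [M]
      rw [ENNReal.mul_rpow_of_nonneg _ _ (by norm_num), hsq]
    simp_rw [this]
    rw [lintegral_const_mul' _ _ (ENNReal.rpow_ne_top_of_nonneg (by norm_num)
      ENNReal.ofReal_ne_top), ENNReal.mul_rpow_of_nonneg _ _ (by norm_num), ← ENNReal.rpow_mul,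
      normL2, eLpNorm_two_eq, lintegral_halfMeasure hd]
    norm_num
    rfl

end WRClass

/-! ### The closure of the operator -/

namespace WRClass
variable {m n p : ℕ}

theorem IsTest.sub {φ ψ : Tan m × ℝ → Vec n} (hφ : IsTest φ) (hψ : IsTest ψ) : IsTest (φ - ψ) :=
  ⟨hφ.1.sub hψ.1, hφ.2.sub hψ.2⟩

theorem normL2_sub_comm (γ : ℝ) (u v : Tan m × ℝ → Vec n) :
    normL2 γ (u - v) = normL2 γ (v - u) := by
  rw [normL2, normL2, weight_sub, weight_sub, eLpNorm_sub_comm]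

theorem normL2_le_add {γ : ℝ} {u v : Tan m × ℝ → Vec n} (hu : MemL2 γ u) (hv : MemL2 γ v) :
    normL2 γ u ≤ normL2 γ v + normL2 γ (v - u) := by
  rw [normL2_sub_comm, normL2, normL2, normL2, weight_sub]
  have := eLpNorm_add_le hv.1 (hu.1.sub hv.1) (p := 2) (by norm_num)
  rwa [add_sub_cancel] at this

/-- Elements of `L²_γ` are limits of test functions. -/
theorem exists_test_tendsto {γ : ℝ} {u : Tan m × ℝ → Vec n} (hu : MemL2 γ u) :
    ∃ φ : ℕ → Tan m × ℝ → Vec n, (∀ k, IsTest (φ k)) ∧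
      Filter.Tendsto (fun k => normL2 γ (φ k - u)) Filter.atTop (nhds 0) := by
  have : IsFiniteMeasureOnCompacts (halfMeasure m) := by unfold halfMeasure; infer_instance
  have h : ∀ k : ℕ, ∃ φ : Tan m × ℝ → Vec n, IsTest φ ∧
      normL2 γ (φ - u) ≤ ENNReal.ofReal (1 / ((k : ℝ) + 1)) := by
    intro k
    obtain ⟨ψ, h1, h2, h3⟩ := MemLp.exist_eLpNorm_sub_le (p := 2) ENNReal.ofNat_ne_top
      (by norm_num) hu (ε := 1 / ((k : ℝ) + 1)) (by positivity)
    refine ⟨fun x => ((Real.exp (γ * x.1 0) : ℝ) : ℂ) • ψ x, IsTest.exp_smul ⟨h2, h1⟩ γ, ?_⟩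
    rw [normL2_sub_comm, normL2, weight_sub]
    have : weight γ (fun x => ((Real.exp (γ * x.1 0) : ℝ) : ℂ) • ψ x) = ψ := by
      funext x
      rw [weight, smul_smul, ← Complex.ofReal_mul, ← Real.exp_add, neg_mul, neg_add_cancel,
        Real.exp_zero, Complex.ofReal_one, one_smul]
    rw [this]
    exact h3
  choose φ h1 h2 using h
  refine ⟨φ, h1, tendsto_of_tendsto_of_tendsto_of_le_of_le tendsto_const_nhds ?_
    (fun _ => zero_le) h2⟩
  rw [← ENNReal.ofReal_zero]
  exact ENNReal.tendsto_ofReal tendsto_one_div_add_atTop_nhds_zero_nat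

section Operator
variable {g : Phase m → Matrix (Fin n) (Fin n) ℂ} {G : Fin n → Phase m → ℂ}

/-- The operator is additive on test functions. -/
theorem IsDiagonalSymbol.weight_op_sub (hg : IsDiagonalSymbol g G) {γ : ℝ} (hγ : 200 ≤ γ)
    {φ ψ : Tan m × ℝ → Vec n} (hφ : IsTest φ) (hψ : IsTest ψ) :
    weight γ (op g γ (φ - ψ)) =ᵐ[halfMeasure m] weight γ (op g γ φ - op g γ ψ) := by
  filter_upwards [ae_restrict_mem measurableSet_halfSpace] with x hx
  have hr : 0 ≤ x.2 := le_of_lt hx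
  ext j
  rw [weight_sub, Pi.sub_apply, PiLp.sub_apply, weight_op_apply hg hγ (hφ.sub hψ) x.1 hr,
    weight_op_apply hg hγ hφ x.1 hr, weight_op_apply hg hγ hψ x.1 hr]
  obtain ⟨R, C, hRC⟩ := (hg.symbol j).exists_isOrderOne
  have hG : IsOrderOne (freqWeight γ) R C (sliceSymbol (G j) γ x.2) := hRC x.2 γ hr hγ
  have hl := isFreqWeight_freqWeight (m := m) hγ
  obtain ⟨f₁, h1⟩ := (hφ.weight (γ := γ)).exists_schwartz x.2 j
  obtain ⟨f₂, h2⟩ := (hψ.weight (γ := γ)).exists_schwartz x.2 j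
  have h3 : (fun z => weight γ (φ - ψ) (z, x.2) j) = fun z => f₁ z - f₂ z := by
    rw [h1, h2, weight_sub]; rfl
  rw [h3, ← h1, ← h2]
  unfold sliceOp
  rw [← integral_sub (hG.integrable_sliceOp_integrand hl f₁ x.1)
    (hG.integrable_sliceOp_integrand hl f₂ x.1)]
  refine integral_congr_ae (Filter.Eventually.of_forall fun k => ?_)
  dsimp only
  rw [fourier_sub_of_integrable f₁.integrable f₂.integrable, mul_sub, smul_sub]

/-- The closure of the operator is everywhere defined, and satisfies the two-sided estimate. -/
theorem IsDiagonalSymbol.exists_bounds (hg : IsDiagonalSymbol g G) :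
    ∃ γ₁ A : ℝ, 200 ≤ γ₁ ∧ 0 < A ∧ ∀ γ, γ₁ ≤ γ → ∀ u : Tan m × ℝ → Vec n, MemL2 γ u →
      (∃ w, IsOp g γ u w) ∧ ∀ w, IsOp g γ u w →
        normL2 γ w ≤ ENNReal.ofReal A * normL2 γ u ∧
        ENNReal.ofReal (γ / 4) * normSobolev (-1) γ u ≤ normL2 γ w := by
  obtain ⟨γ₁, A, h1, hA, hb⟩ := hg.exists_test_bounds
  refine ⟨γ₁, A, h1, hA, fun γ hγ u hu => ⟨?_, ?_⟩⟩
  · obtain ⟨φ, hφ, hlim⟩ := exists_test_tendsto hu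
    have hm : ∀ k, MemLp (weight γ (φ k)) 2 (halfMeasure m) := fun k =>
      (hb γ hγ (φ k) (hφ k)).1
    have hmo : ∀ k, MemLp (weight γ (op g γ (φ k))) 2 (halfMeasure m) := fun k =>
      (hb γ hγ (φ k) (hφ k)).2.1
    have hu2 : MemLp (weight γ u) 2 (halfMeasure m) := hu
    -- images of test functions form a Cauchy sequence
    have hdiff : ∀ k l, edist ((hmo k).toLp _) ((hmo l).toLp _) ≤
        ENNReal.ofReal A * edist ((hm k).toLp _) ((hm l).toLp _) := by
      intro k l
      rw [Lp.edist_toLp_toLp, Lp.edist_toLp_toLp, ← weight_sub, ← weight_sub,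
        ← eLpNorm_congr_ae (hg.weight_op_sub (h1.trans hγ) (hφ k) (hφ l))]
      exact (hb γ hγ _ ((hφ k).sub (hφ l))).2.2.1
    have hΦ : Filter.Tendsto (fun k => (hm k).toLp _) Filter.atTop (nhds (hu2.toLp _)) := by
      rw [tendsto_iff_edist_tendsto_0]
      simp_rw [Lp.edist_toLp_toLp, ← weight_sub]
      exact hlim
    have hcs : CauchySeq fun k => (hmo k).toLp _ := by
      rw [EMetric.cauchySeq_iff]
      intro ε hε
      obtain ⟨N, hN⟩ := EMetric.cauchySeq_iff.1 hΦ.cauchySeq (ε / ENNReal.ofReal A)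
        (ENNReal.div_pos hε.ne' ENNReal.ofReal_ne_top)
      refine ⟨N, fun k hk l hl => (hdiff k l).trans_lt ?_⟩
      rw [mul_comm]
      exact ENNReal.mul_lt_of_lt_div (hN k hk l hl)
    obtain ⟨W, hW⟩ := cauchySeq_tendsto_of_complete hcs
    have hw : weight γ (fun x => ((Real.exp (γ * x.1 0) : ℝ) : ℂ) • W x) = W := by
      funext x
      rw [weight, smul_smul, ← Complex.ofReal_mul, ← Real.exp_add, neg_mul, neg_add_cancel,
        Real.exp_zero, Complex.ofReal_one, one_smul]
    refine ⟨fun x => ((Real.exp (γ * x.1 0) : ℝ) : ℂ) • W x, hu, ?_, φ, hφ, hlim, ?_⟩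
    · rw [MemL2, hw]; exact Lp.memLp W
    · rw [tendsto_iff_edist_tendsto_0] at hW
      refine hW.congr fun k => ?_
      rw [Lp.edist_def, normL2, weight_sub, hw]
      exact eLpNorm_congr_ae ((hmo k).coeFn_toLp.sub (Filter.EventuallyEq.refl _ _))
  · rintro w ⟨-, hw, φ, hφ, hlim, hlimw⟩
    have hγ0 : 0 < γ := by linarith
    constructor
    · have hk : ∀ k, normL2 γ w ≤ ENNReal.ofReal A * (normL2 γ u + normL2 γ (φ k - u)) +
          normL2 γ (op g γ (φ k) - w) := by
        intro k
        obtain ⟨b1, b2, b3, -⟩ := hb γ hγ (φ k) (hφ k)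
        refine (normL2_le_add hw b2).trans (add_le_add (b3.trans ?_) le_rfl)
        gcongr
        rw [normL2_sub_comm]
        exact normL2_le_add b1 hu
      have hl : Filter.Tendsto (fun k => ENNReal.ofReal A * (normL2 γ u + normL2 γ (φ k - u)) +
          normL2 γ (op g γ (φ k) - w)) Filter.atTop
          (nhds (ENNReal.ofReal A * (normL2 γ u + 0) + 0)) :=
        (ENNReal.Tendsto.const_mul (tendsto_const_nhds.add hlim)
          (Or.inr ENNReal.ofReal_ne_top)).add hlimw
      rw [add_zero, add_zero] at hl
      exact ge_of_tendsto' hl hk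
    · have hk : ∀ k, ENNReal.ofReal (γ / 4) * normSobolev (-1) γ u ≤
          normL2 γ w + normL2 γ (op g γ (φ k) - w) +
            ENNReal.ofReal (γ / 4) * (ENNReal.ofReal (1 / γ) * normL2 γ (φ k - u)) := by
        intro k
        obtain ⟨b1, b2, -, b4⟩ := hb γ hγ (φ k) (hφ k)
        refine (mul_le_mul' le_rfl (normSobolev_le_add hγ0 hu (hφ k) b1)).trans ?_
        rw [mul_add]
        refine add_le_add (b4.trans ?_) le_rfl
        rw [normL2_sub_comm]
        exact normL2_le_add b2 hw
      have hl : Filter.Tendsto (fun k => normL2 γ w + normL2 γ (op g γ (φ k) - w) +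
            ENNReal.ofReal (γ / 4) * (ENNReal.ofReal (1 / γ) * normL2 γ (φ k - u))) Filter.atTop
          (nhds (normL2 γ w + 0 + ENNReal.ofReal (γ / 4) * (ENNReal.ofReal (1 / γ) * 0))) :=
        (tendsto_const_nhds.add hlimw).add (ENNReal.Tendsto.const_mul (ENNReal.Tendsto.const_mul
          hlim (Or.inr ENNReal.ofReal_ne_top)) (Or.inr ENNReal.ofReal_ne_top))
      rw [mul_zero, mul_zero, add_zero, add_zero] at hl
      exact ge_of_tendsto' hl hk

end Operator
end WRClass

end

theorem proposition1p1 {m n p : ℕ} (S : WRClass.BVP m n p)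
    (hhyp : WRClass.IsHyperbolic S.a) (hC : S.PropertyC) (hrank : S.MaximalRank) (hWR : S.IsWR)
    (X₀ : WRClass.Phase m) (hX₀S : X₀ ∈ WRClass.XS m) (hX₀Y : X₀ ∈ WRClass.YY m)
    (hX₀ : X₀ ∈ WRClass.hypRegion S.a)
    (V : Set (WRClass.Phase m)) (hV : WRClass.IsConicNhd V X₀)
    (L : WRClass.LopatinskiSymbol S V) :
    ∃ V' ⊆ V, WRClass.IsConicNhd V' X₀ ∧
      ∀ θ : WRClass.Phase m → ℝ, WRClass.IsCutoff V' θ →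
        ∃ γ₁ : ℝ, 1 ≤ γ₁ ∧ ∃ C₁ : ℝ, 0 < C₁ ∧ ∃ C₂ : ℝ, 0 < C₂ ∧
          ∀ γ₀ : ℝ, γ₁ ≤ γ₀ → ∀ γ : ℝ, γ₀ < γ →
            ∀ u : WRClass.Tan m × ℝ → WRClass.Vec n, WRClass.MemL2 γ u →
              (∃ w, WRClass.IsOp (L.globalSymbol θ) γ u w) ∧
              ∀ w, WRClass.IsOp (L.globalSymbol θ) γ u w →
                ENNReal.ofReal C₁ * WRClass.normSobolev (-1) γ u ≤
                    ENNReal.ofReal (1 / γ₀) * WRClass.normL2 γ w ∧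
                ENNReal.ofReal (1 / γ₀) * WRClass.normL2 γ w ≤
                    ENNReal.ofReal C₂ * WRClass.normL2 γ u := by
  obtain ⟨V', hsub, hV', hre⟩ := L.exists_conicNhd hV hX₀Y hX₀S hX₀
  refine ⟨V', hsub, hV', fun θ hθ => ?_⟩
  have hg : WRClass.IsDiagonalSymbol (L.globalSymbol θ) (L.cutSymbol θ) :=
    ⟨fun j => L.isCompactSymbol_cutSymbol hV hsub hθ j,
      fun X hX v j => L.globalSymbol_mulVec θ hX v j,
      fun j X hX => L.le_re_cutSymbol hV' hθ hre j hX⟩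
  obtain ⟨γ₁, A, h1, hA, hb⟩ := hg.exists_bounds
  refine ⟨γ₁, by linarith, 1 / 4, by norm_num, A, hA, fun γ₀ hγ₀ γ hγ u hu => ?_⟩
  obtain ⟨hex, hw⟩ := hb γ (hγ₀.trans hγ.le) u hu
  have hγ₀0 : 0 < γ₀ := by linarith
  refine ⟨hex, fun w hop => ⟨?_, ?_⟩⟩
  · refine le_trans ?_ (mul_le_mul' le_rfl (hw w hop).2)
    rw [← mul_assoc, ← ENNReal.ofReal_mul (by positivity)]
    gcongr
    rw [one_div_mul_eq_div, div_div, div_le_div_iff₀ (by norm_num) (by positivity)]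
    linarith
  · refine le_trans ?_ (hw w hop).1
    refine (mul_le_mul' (ENNReal.ofReal_le_ofReal (q := 1) ?_) le_rfl).trans ?_
    · rw [div_le_one hγ₀0]; linarith
    · rw [ENNReal.ofReal_one, one_mul]
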